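/- \textbf{Conventions.} Let $\Bbbk=\mathbb R$ or $\mathbb C$. Manifolds are finite-dimensional, without boundary, Hausdorff and second countable, and are smooth if $\Bbbk=\mathbb R$, complex if $\Bbbk=\mathbb C$; all maps are smooth, resp. holomorphic. In a Lie groupoid $\Gamma\rightrightarrows M$ with source $s$ and target $t$ (both submersions) the product $\gamma\gamma'$ is defined when $t(\gamma)=s(\gamma')$. A \emph{Lie subgroupoid} $R\rightrightarrows L$ of $\Gamma\rightrightarrows M$ is a Lie groupoid such that $R\subset\Gamma$ and $L\subset M$ are (injectively immersed) submanifolds and the structural maps of $R\rightrightarrows L$ are the restrictions of those of $\Gamma\rightrightarrows M$. A \emph{$\Gamma$-$\Gamma'$-bimodule}, for Lie groupoids $\Gamma\rightrightarrows M$ and $\Gamma'\rightrightarrows M'$, is a manifold $X$ with surjective submersions $p:X\to M$, $p':X\to M'$, a smooth left action $\gamma\cdot x$ of $\Gamma$ along $p$ (defined when $t(\gamma)=p(x)$, with $p(\gamma\cdot x)=s(\gamma)$) and a smooth right action $x\cdot\gamma'$ of $\Gamma'$ along $p'$ (defined when $p'(x)=s(\gamma')$, with $p'(x\cdot\gamma')=t(\gamma')$),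 such that the left action preserves $p'$, the right action preserves $p$, and the two actions commute. It is a \emph{Morita equivalence} between $\Gamma$ and $\Gamma'$ if both actions are free and proper, the left action is transitive on the fibres of $p'$, and the right action is transitive on the fibres of $p$. A \emph{Morita equivalence of Lie subgroupoids} between $R\rightrightarrows L$ in $\Gamma\rightrightarrows M$ and $R'\rightrightarrows L'$ in $\Gamma'\rightrightarrows M'$ is a triple $(X,Y,i)$ where $X$ is a Morita equivalence between $\Gamma$ and $\Gamma'$, $Y$ is a Morita equivalence between $R$ and $R'$, and $i:Y\to X$ is an injective immersion with $p\circ i=p$, $p'\circ i=p'$ and $i(r\cdot y\cdot r')=r\cdot i(y)\cdot r'$ for all $r\in R$, $y\in Y$, $r'\in R'$ with $t(r)=p(y)$, $p'(y)=s(r')$. \textbf{Proposition.} For $k=1,2,3$ let $R_k\rightrightarrows L_k$ be a Lie subgroupoid of a Lie groupoid $\Gamma_k\rightrightarrows M_k$. Let $(X,Y,i)$ be a Morita equivalence of Lie subgroupoids between $R_1\subset\Gamma_1$ and $R_2\subset\Gamma_2$, and $(X',Y',i')$ one between $R_2\subset\Gamma_2$ and $R_3\subset\Gamma_3$. Let $$X''=\frac{X\times_{p',M_2,p}X'}{\Gamma_2},\qquad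 Y''=\frac{Y\times_{p',L_2,p}Y'}{R_2}$$ be the topological quotients by the actions $\gamma\cdot(x,x')=(x\cdot\gamma^{-1},\gamma\cdot x')$ of $\Gamma_2$ and of $R_2$, with $p([(x,x')])=p(x)$, $p'([(x,x')])=p'(x')$, $\gamma_1\cdot[(x,x')]\cdot\gamma_3=[(\gamma_1\cdot x,\,x'\cdot\gamma_3)]$, and likewise on $Y''$. Then $X''$ and $Y''$ are manifolds in such a way that the projections from the embedded submanifolds $X\times_{p',M_2,p}X'\subset X\times X'$ and $Y\times_{p',L_2,p}Y'\subset Y\times Y'$ onto them are submersions; $X''$ is a Morita equivalence between $\Gamma_1$ and $\Gamma_3$; $Y''$ is a Morita equivalence between $R_1$ and $R_3$; and $$i'':Y''\to X'',\qquad i''([(y,y')])=[(i(y),i'(y'))]$$ is a well-defined injective immersion compatible with the maps $p,p'$ and with the actions of $R_1$ and $R_3$. That is, $(X'',Y'',i'')$ is a Morita equivalence of Lie subgroupoids between $R_1\subset\Gamma_1$ and $R_3\subset\Gamma_3$. -/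

import Mathlib

open Topology Manifold
open scoped ContDiff

universe u

/-! ### Manifolds

`𝕜` is `ℝ` or `ℂ`; a `C^∞` manifold over `ℝ` is a smooth manifold, a `C^∞` manifold over `ℂ` is a
complex manifold. Manifolds are finite-dimensional, without boundary, Hausdorff and second
countable. -/

/-- A smooth (if `𝕜 = ℝ`) or holomorphic (if `𝕜 = ℂ`) manifold structure on a topological space,
compatible with the given topology. -/
structure SmoothStructure (𝕜 : Type) [RCLike 𝕜] (X : Type u) [TopologicalSpace X] where
  /-- the dimension -/
  dim : ℕ
  /-- the charts -/
  charts : ChartedSpace (EuclideanSpace 𝕜 (Fin dim)) X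
  isManifold : IsManifold 𝓘(𝕜, EuclideanSpace 𝕜 (Fin dim)) ∞ X
  t2 : T2Space X
  secondCountable : SecondCountableTopology X

/-- A bundled manifold over `𝕜`. -/
structure Mfd (𝕜 : Type) [RCLike 𝕜] : Type (u + 1) where
  /-- the underlying set -/
  carrier : Type u
  [top : TopologicalSpace carrier]
  /-- the manifold structure -/
  str : SmoothStructure 𝕜 carrier

namespace Mfd

variable {𝕜 : Type} [RCLike 𝕜]

instance : CoeSort (Mfd.{u} 𝕜) (Type u) := ⟨Mfd.carrier⟩

instance (X : Mfd.{u} 𝕜) : TopologicalSpace X := X.top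

/-- The dimension of a manifold. -/
abbrev dim (X : Mfd.{u} 𝕜) : ℕ := X.str.dim

instance (X : Mfd.{u} 𝕜) : ChartedSpace (EuclideanSpace 𝕜 (Fin X.dim)) X := X.str.charts

instance (X : Mfd.{u} 𝕜) : IsManifold 𝓘(𝕜, EuclideanSpace 𝕜 (Fin X.dim)) ∞ X := X.str.isManifold

instance (X : Mfd.{u} 𝕜) : T2Space X := X.str.t2

instance (X : Mfd.{u} 𝕜) : SecondCountableTopology X := X.str.secondCountable

/-- The model with corners (without boundary) of a manifold. -/
noncomputable abbrev I (X : Mfd.{u} 𝕜) :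
    ModelWithCorners 𝕜 (EuclideanSpace 𝕜 (Fin X.dim)) (EuclideanSpace 𝕜 (Fin X.dim)) :=
  𝓘(𝕜, EuclideanSpace 𝕜 (Fin X.dim))

/-- Smooth (or holomorphic) maps. -/
abbrev Smooth {X Y : Mfd.{u} 𝕜} (f : X → Y) : Prop := ContMDiff X.I Y.I ∞ f

/-- Submersions. -/
abbrev Submersion {X Y : Mfd.{u} 𝕜} (f : X → Y) : Prop := IsSubmersion X.I Y.I ∞ f

/-- Injective immersions. -/
def InjImmersion {X Y : Mfd.{u} 𝕜} (f : X → Y) : Prop :=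
  Function.Injective f ∧ IsImmersion X.I Y.I ∞ f

/-- A map defined on a subset `S` of a product manifold `A × B`, with values in a manifold `C`, is
smooth if near every point of `S` it is the restriction of a smooth map defined on a neighbourhood
of that point in `A × B`. If `S` is an embedded submanifold (such as the fibre product
`{(a, b) | f a = g b}` of two smooth maps one of which is a submersion), these are the smooth maps
from the manifold `S` to `C`. -/
def SmoothOnSubset {A B C : Mfd.{u} 𝕜} (S : Set (A × B)) (f : S → C) : Prop :=
  ∀ z : S, ∃ U : Set (A × B), IsOpen U ∧ (z : A × B) ∈ U ∧
    ∃ F : A × B → C, ContMDiffOn (A.I.prod B.I) C.I ∞ F U ∧ ∀ w : S, (w : A × B) ∈ U → F w = f w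

end Mfd

/-- The manifold given by a manifold structure on a topological space. -/
def SmoothStructure.toMfd {𝕜 : Type} [RCLike 𝕜] {X : Type u} [TopologicalSpace X]
    (S : SmoothStructure 𝕜 X) : Mfd.{u} 𝕜 := ⟨X, S⟩

/-! ### Lie groupoids -/

/-- A Lie groupoid. The product `g h` is defined when `t g = s h`. -/
structure LieGroupoid (𝕜 : Type) [RCLike 𝕜] : Type (u + 1) where
  /-- the manifold of arrows -/
  Arr : Mfd.{u} 𝕜
  /-- the manifold of objects -/
  Obj : Mfd.{u} 𝕜
  /-- source -/
  s : Arr → Obj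
  /-- target -/
  t : Arr → Obj
  /-- unit -/
  unit : Obj → Arr
  /-- inverse -/
  inv : Arr → Arr
  /-- product -/
  mul : (g h : Arr) → t g = s h → Arr
  s_unit : ∀ m, s (unit m) = m
  t_unit : ∀ m, t (unit m) = m
  s_inv : ∀ g, s (inv g) = t g
  t_inv : ∀ g, t (inv g) = s g
  s_mul : ∀ g h (e : t g = s h), s (mul g h e) = s g
  t_mul : ∀ g h (e : t g = s h), t (mul g h e) = t h
  unit_mul : ∀ g, mul (unit (s g)) g (t_unit _) = g
  mul_unit : ∀ g, mul g (unit (t g)) (s_unit _).symm = g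
  mul_inv : ∀ g, mul g (inv g) (s_inv g).symm = unit (s g)
  inv_mul : ∀ g, mul (inv g) g (t_inv g) = unit (t g)
  mul_assoc : ∀ g h k (e : t g = s h) (e' : t h = s k),
    mul (mul g h e) k ((t_mul g h e).trans e') = mul g (mul h k e') (e.trans (s_mul h k e').symm)
  submersion_s : Mfd.Submersion s
  submersion_t : Mfd.Submersion t
  smooth_unit : Mfd.Smooth unit
  smooth_inv : Mfd.Smooth inv
  smooth_mul : Mfd.SmoothOnSubset {z : Arr × Arr | t z.1 = s z.2} (fun z => mul z.1.1 z.1.2 z.2)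

/-- A Lie subgroupoid `R ⇉ L` of `Γ ⇉ M`: a Lie groupoid `R ⇉ L` whose arrows and objects form
(injectively immersed) submanifolds of `Γ` and `M`, and whose structural maps are induced by those
of `Γ ⇉ M`. -/
structure LieSubgroupoid {𝕜 : Type} [RCLike 𝕜] (G : LieGroupoid.{u} 𝕜) : Type (u + 1) where
  /-- the Lie groupoid `R ⇉ L` -/
  R : LieGroupoid.{u} 𝕜
  /-- the inclusion of arrows -/
  arr : R.Arr → G.Arr
  /-- the inclusion of objects -/
  obj : R.Obj → G.Obj
  injImmersion_arr : Mfd.InjImmersion arr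
  injImmersion_obj : Mfd.InjImmersion obj
  s_arr : ∀ r, G.s (arr r) = obj (R.s r)
  t_arr : ∀ r, G.t (arr r) = obj (R.t r)
  arr_unit : ∀ l, arr (R.unit l) = G.unit (obj l)
  arr_inv : ∀ r, arr (R.inv r) = G.inv (arr r)
  arr_mul : ∀ r r' (e : R.t r = R.s r'),
    arr (R.mul r r' e) = G.mul (arr r) (arr r') (by rw [t_arr, s_arr, e])

/-! ### Bimodules and Morita equivalences -/

section Morita

variable {𝕜 : Type} [RCLike 𝕜]

/-- The data of a `G`-`H`-bimodule on a set `X`: the two moment maps and the two actions. The left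
action `g · x` is defined when `t g = p x`, the right action `x · h` when `p' x = s h`. -/
structure BimoduleData (G H : LieGroupoid.{u} 𝕜) (X : Type u) where
  /-- the left moment map -/
  p : X → G.Obj
  /-- the right moment map -/
  p' : X → H.Obj
  /-- the left action -/
  lact : (g : G.Arr) → (x : X) → G.t g = p x → X
  /-- the right action -/
  ract : (x : X) → (h : H.Arr) → p' x = H.s h → X

/-- The axioms of a `G`-`H`-bimodule. -/
structure IsBimodule (G H : LieGroupoid.{u} 𝕜) (X : Mfd.{u} 𝕜) (B : BimoduleData G H X) :
    Prop where
  submersion_p : Mfd.Submersion B.p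
  submersion_p' : Mfd.Submersion B.p'
  surjective_p : Function.Surjective B.p
  surjective_p' : Function.Surjective B.p'
  /- left module -/
  p_lact : ∀ g x e, B.p (B.lact g x e) = G.s g
  unit_lact : ∀ x, B.lact (G.unit (B.p x)) x (G.t_unit _) = x
  mul_lact : ∀ g g' x (e : G.t g = G.s g') (e' : G.t g' = B.p x),
    B.lact (G.mul g g' e) x ((G.t_mul g g' e).trans e') =
      B.lact g (B.lact g' x e') (e.trans (p_lact g' x e').symm)
  smooth_lact : Mfd.SmoothOnSubset {z : G.Arr × X | G.t z.1 = B.p z.2}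
    (fun z => B.lact z.1.1 z.1.2 z.2)
  /- right module -/
  p'_ract : ∀ x h e, B.p' (B.ract x h e) = H.t h
  ract_unit : ∀ x, B.ract x (H.unit (B.p' x)) (H.s_unit _).symm = x
  ract_mul : ∀ x h h' (e : B.p' x = H.s h) (e' : H.t h = H.s h'),
    B.ract x (H.mul h h' e') (e.trans (H.s_mul h h' e').symm) =
      B.ract (B.ract x h e) h' ((p'_ract x h e).trans e')
  smooth_ract : Mfd.SmoothOnSubset {z : X × H.Arr | B.p' z.1 = H.s z.2}
    (fun z => B.ract z.1.1 z.1.2 z.2)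
  /- each action preserves the fibres of the other moment map -/
  p_ract : ∀ x h e, B.p (B.ract x h e) = B.p x
  p'_lact : ∀ g x e, B.p' (B.lact g x e) = B.p' x
  /- the actions commute -/
  comm : ∀ g x h (e : G.t g = B.p x) (e' : B.p' x = H.s h),
    B.ract (B.lact g x e) h ((p'_lact g x e).trans e') =
      B.lact g (B.ract x h e') (e.trans (p_ract x h e').symm)

/-- A bimodule is a Morita equivalence if both actions are free and proper, the left action is
transitive on the fibres of `p'` and the right action is transitive on the fibres of `p`. -/
structure IsMoritaEquivalence (G H : LieGroupoid.{u} 𝕜) (X : Mfd.{u} 𝕜)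
    (B : BimoduleData G H X) : Prop extends IsBimodule G H X B where
  free_left : ∀ g x e, B.lact g x e = x → g = G.unit (B.p x)
  free_right : ∀ x h e, B.ract x h e = x → h = H.unit (B.p' x)
  transitive_left : ∀ x y, B.p' x = B.p' y → ∃ g e, B.lact g x e = y
  transitive_right : ∀ x y, B.p x = B.p y → ∃ h e, B.ract x h e = y
  proper_left : IsProperMap
    (fun z : {z : G.Arr × X // G.t z.1 = B.p z.2} => (B.lact z.1.1 z.1.2 z.2, z.1.2))
  proper_right : IsProperMap
    (fun z : {z : X × H.Arr // B.p' z.1 = H.s z.2} => (z.1.1, B.ract z.1.1 z.1.2 z.2))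

/-- A Morita equivalence between two Lie groupoids. -/
structure LieMoritaEquivalence (G H : LieGroupoid.{u} 𝕜) : Type (u + 1) where
  /-- the underlying manifold -/
  X : Mfd.{u} 𝕜
  /-- moment maps and actions -/
  data : BimoduleData G H X
  isMorita : IsMoritaEquivalence G H X data

/-! ### Composition of Morita equivalences -/

variable {G₁ G₂ G₃ : LieGroupoid.{u} 𝕜}

/-- The fibre product `X ×_{p', M₂, p} X'`. -/
abbrev FibreProduct (A : LieMoritaEquivalence G₁ G₂) (B : LieMoritaEquivalence G₂ G₃) : Type u :=
  {z : A.X × B.X // A.data.p' z.1 = B.data.p z.2}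

/-- `γ · (x, x') = (x · γ⁻¹, γ · x')` for `γ ∈ Γ₂` with `t γ = p' x = p x'`. -/
def diagAct (A : LieMoritaEquivalence G₁ G₂) (B : LieMoritaEquivalence G₂ G₃) (g : G₂.Arr)
    (z : FibreProduct A B) (e : G₂.t g = B.data.p z.1.2) : FibreProduct A B :=
  ⟨(A.data.ract z.1.1 (G₂.inv g) (by rw [G₂.s_inv, e, z.2]), B.data.lact g z.1.2 e), by
    rw [A.isMorita.p'_ract, B.isMorita.p_lact, G₂.t_inv]⟩

/-- `z` and `w` are related if `w = γ · z` for some `γ ∈ Γ₂`. -/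
def diagRel (A : LieMoritaEquivalence G₁ G₂) (B : LieMoritaEquivalence G₂ G₃)
    (z w : FibreProduct A B) : Prop :=
  ∃ g e, diagAct A B g z e = w

/-- The quotient `X'' = (X ×_{p', M₂, p} X') / Γ₂`, with the quotient topology. -/
abbrev CompSpace (A : LieMoritaEquivalence G₁ G₂) (B : LieMoritaEquivalence G₂ G₃) : Type u :=
  Quot (diagRel A B)

/-- The class `[(x, x')]`. -/
abbrev compMk (A : LieMoritaEquivalence G₁ G₂) (B : LieMoritaEquivalence G₂ G₃) :
    FibreProduct A B → CompSpace A B :=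
  Quot.mk _

/-- `p [(x, x')] = p x`. -/
def compP (A : LieMoritaEquivalence G₁ G₂) (B : LieMoritaEquivalence G₂ G₃) :
    CompSpace A B → G₁.Obj :=
  Quot.lift (fun z => A.data.p z.1.1) (by
    rintro z _ ⟨g, e, rfl⟩
    exact (A.isMorita.p_ract _ _ _).symm)

/-- `p' [(x, x')] = p' x'`. -/
def compP' (A : LieMoritaEquivalence G₁ G₂) (B : LieMoritaEquivalence G₂ G₃) :
    CompSpace A B → G₃.Obj :=
  Quot.lift (fun z => B.data.p' z.1.2) (by
    rintro z _ ⟨g, e, rfl⟩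
    exact (B.isMorita.p'_lact _ _ _).symm)

/-- `γ₁ · (x, x') = (γ₁ · x, x')` on the fibre product. -/
def fibLact (A : LieMoritaEquivalence G₁ G₂) (B : LieMoritaEquivalence G₂ G₃) (g : G₁.Arr)
    (z : FibreProduct A B) (e : G₁.t g = A.data.p z.1.1) : FibreProduct A B :=
  ⟨(A.data.lact g z.1.1 e, z.1.2), (A.isMorita.p'_lact _ _ _).trans z.2⟩

/-- `(x, x') · γ₃ = (x, x' · γ₃)` on the fibre product. -/
def fibRact (A : LieMoritaEquivalence G₁ G₂) (B : LieMoritaEquivalence G₂ G₃)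
    (z : FibreProduct A B) (h : G₃.Arr) (e : B.data.p' z.1.2 = G₃.s h) : FibreProduct A B :=
  ⟨(z.1.1, B.data.ract z.1.2 h e), z.2.trans (B.isMorita.p_ract _ _ _).symm⟩

/-- The left action `γ₁ · [(x, x')] = [(γ₁ · x, x')]`. -/
def compLact (A : LieMoritaEquivalence G₁ G₂) (B : LieMoritaEquivalence G₂ G₃) (g : G₁.Arr)
    (c : CompSpace A B) : G₁.t g = compP A B c → CompSpace A B :=
  Quot.hrecOn (motive := fun c => G₁.t g = compP A B c → CompSpace A B) c
    (fun z e => compMk A B (fibLact A B g z e)) (by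
      rintro z w hzw
      have hP : compP A B (compMk A B z) = compP A B (compMk A B w) :=
        congrArg _ (Quot.sound hzw)
      refine Function.hfunext (congrArg (G₁.t g = ·) hP) fun e e' _ => heq_of_eq ?_
      obtain ⟨k, hk, rfl⟩ := hzw
      refine Quot.sound ⟨k, hk, Subtype.ext (Prod.ext ?_ rfl)⟩
      exact A.isMorita.comm _ _ _ _ _)

/-- The right action `[(x, x')] · γ₃ = [(x, x' · γ₃)]`. -/
def compRact (A : LieMoritaEquivalence G₁ G₂) (B : LieMoritaEquivalence G₂ G₃)
    (c : CompSpace A B) (h : G₃.Arr) : compP' A B c = G₃.s h → CompSpace A B :=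
  Quot.hrecOn (motive := fun c => compP' A B c = G₃.s h → CompSpace A B) c
    (fun z e => compMk A B (fibRact A B z h e)) (by
      rintro z w hzw
      have hP : compP' A B (compMk A B z) = compP' A B (compMk A B w) :=
        congrArg _ (Quot.sound hzw)
      refine Function.hfunext (congrArg (· = G₃.s h) hP) fun e e' _ => heq_of_eq ?_
      obtain ⟨k, hk, rfl⟩ := hzw
      refine Quot.sound ⟨k, hk.trans (B.isMorita.p_ract _ _ _).symm,
        Subtype.ext (Prod.ext rfl ?_)⟩
      exact (B.isMorita.comm _ _ _ _ _).symm)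

/-- The bimodule data of the composition of two Morita equivalences. -/
def compData (A : LieMoritaEquivalence G₁ G₂) (B : LieMoritaEquivalence G₂ G₃) :
    BimoduleData G₁ G₃ (CompSpace A B) where
  p := compP A B
  p' := compP' A B
  lact := compLact A B
  ract := compRact A B

/-- The manifold structure `S` on `X'' = (X ×_{p', M₂, p} X') / Γ₂` is the quotient one: the fibre
product is an embedded submanifold of `X × X'`, and the projection `(x, x') ↦ [(x, x')]` from this
submanifold onto `X''` is a submersion. -/
def IsQuotientStructure (A : LieMoritaEquivalence G₁ G₂) (B : LieMoritaEquivalence G₂ G₃)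
    (S : SmoothStructure 𝕜 (CompSpace A B)) : Prop :=
  ∃ P : SmoothStructure 𝕜 (FibreProduct A B),
    IsSmoothEmbedding (M := P.toMfd) P.toMfd.I (A.X.I.prod B.X.I) ∞ Subtype.val ∧
    Mfd.Submersion (X := P.toMfd) (Y := S.toMfd) (compMk A B)

/-! ### Morita equivalences of Lie subgroupoids -/

/-- `(X, Y, i)` is a Morita equivalence between the Lie subgroupoids `R ⇉ L` of `Γ ⇉ M` and
`R' ⇉ L'` of `Γ' ⇉ M'`, where `X` and `Y` are Morita equivalences between `Γ` and `Γ'`, and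
between `R` and `R'`: the map `i : Y → X` is an injective immersion, compatible with the moment
maps and with the actions. -/
structure IsSubgroupoidMorita {G H : LieGroupoid.{u} 𝕜} (R : LieSubgroupoid G)
    (R' : LieSubgroupoid H) (X : LieMoritaEquivalence G H) (Y : LieMoritaEquivalence R.R R'.R)
    (i : Y.X → X.X) : Prop where
  injImmersion : Mfd.InjImmersion i
  p_i : ∀ y, X.data.p (i y) = R.obj (Y.data.p y)
  p'_i : ∀ y, X.data.p' (i y) = R'.obj (Y.data.p' y)
  /- `i (r · y · r') = r · i y · r'` -/
  i_act : ∀ r y r' (e : R.R.t r = Y.data.p y) (e' : Y.data.p' y = R'.R.s r'),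
    i (Y.data.ract (Y.data.lact r y e) r' ((Y.isMorita.p'_lact r y e).trans e')) =
      X.data.ract (X.data.lact (R.arr r) (i y) (by rw [R.t_arr, p_i, e])) (R'.arr r')
        (by rw [X.isMorita.p'_lact, p'_i, e', R'.s_arr])

/-- A Morita equivalence `(X, Y, i)` between two Lie subgroupoids. -/
structure SubgroupoidMorita {G H : LieGroupoid.{u} 𝕜} (R : LieSubgroupoid G)
    (R' : LieSubgroupoid H) : Type (u + 1) where
  /-- the Morita equivalence of the ambient groupoids -/
  X : LieMoritaEquivalence G H
  /-- the Morita equivalence of the subgroupoids -/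
  Y : LieMoritaEquivalence R.R R'.R
  /-- the map `Y → X` -/
  i : Y.X → X.X
  isMorita : IsSubgroupoidMorita R R' X Y i

/-- The compatibility of `i` with the left action alone. -/
lemma SubgroupoidMorita.i_lact {G H : LieGroupoid.{u} 𝕜} {R : LieSubgroupoid G}
    {R' : LieSubgroupoid H} (E : SubgroupoidMorita R R') (r : R.R.Arr) (y : E.Y.X)
    (e : R.R.t r = E.Y.data.p y) (e' : G.t (R.arr r) = E.X.data.p (E.i y)) :
    E.i (E.Y.data.lact r y e) = E.X.data.lact (R.arr r) (E.i y) e' := by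
  have h := E.isMorita.i_act r y (R'.R.unit (E.Y.data.p' y)) e (R'.R.s_unit _).symm
  have h1 := E.Y.isMorita.ract_unit (E.Y.data.lact r y e)
  have h2 := E.X.isMorita.ract_unit (E.X.data.lact (R.arr r) (E.i y) e')
  simp only [E.Y.isMorita.p'_lact] at h1
  simp only [E.X.isMorita.p'_lact, E.isMorita.p'_i] at h2
  simp only [R'.arr_unit] at h
  rw [h1, h2] at h
  exact h

/-- The compatibility of `i` with the right action alone. -/
lemma SubgroupoidMorita.i_ract {G H : LieGroupoid.{u} 𝕜} {R : LieSubgroupoid G}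
    {R' : LieSubgroupoid H} (E : SubgroupoidMorita R R') (y : E.Y.X) (r' : R'.R.Arr)
    (e : E.Y.data.p' y = R'.R.s r') (e' : E.X.data.p' (E.i y) = H.s (R'.arr r')) :
    E.i (E.Y.data.ract y r' e) = E.X.data.ract (E.i y) (R'.arr r') e' := by
  have h := E.isMorita.i_act (R.R.unit (E.Y.data.p y)) y r' (R.R.t_unit _) e
  have h1 := E.Y.isMorita.unit_lact y
  have h2 := E.X.isMorita.unit_lact (E.i y)
  simp only [E.isMorita.p_i] at h2
  simp only [R.arr_unit] at h
  simp only [h1, h2] at h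
  exact h

variable {R₁ : LieSubgroupoid G₁} {R₂ : LieSubgroupoid G₂} {R₃ : LieSubgroupoid G₃}

/-- The map `(y, y') ↦ (i y, i' y')` between fibre products. -/
def fibMap (E : SubgroupoidMorita R₁ R₂) (E' : SubgroupoidMorita R₂ R₃)
    (z : FibreProduct E.Y E'.Y) : FibreProduct E.X E'.X :=
  ⟨(E.i z.1.1, E'.i z.1.2), by rw [E.isMorita.p'_i, E'.isMorita.p_i, z.2]⟩

/-- The map `i'' : Y'' → X''`, `[(y, y')] ↦ [(i y, i' y')]`. -/
def compMap (E : SubgroupoidMorita R₁ R₂) (E' : SubgroupoidMorita R₂ R₃) :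
    CompSpace E.Y E'.Y → CompSpace E.X E'.X :=
  Quot.map (fibMap E E') (by
    rintro z _ ⟨r, e, rfl⟩
    refine ⟨R₂.arr r, by rw [R₂.t_arr, e]; exact (E'.isMorita.p_i _).symm,
      Subtype.ext (Prod.ext ?_ ?_)⟩
    · have h := E.i_ract z.1.1 (R₂.R.inv r) (by rw [R₂.R.s_inv, e, z.2])
        (by rw [R₂.s_arr, E.isMorita.p'_i, R₂.R.s_inv, e, z.2])
      simp only [R₂.arr_inv] at h
      exact h.symm
    · exact (E'.i_lact r z.1.2 e _).symm)

end Morita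

/-! Near a given class, a point of `X''` has exactly one representative whose first component lies
on a chosen smooth local section σ of `p : X → M₁`. Indeed, for any representative (x, x') there is
a unique γ in `Γ₂` with σ(p x) · γ = x, and [(x, x')] = [(σ(p x), γ · x')]. So `X''` is locally the
fibre product of the domain of σ with `X'` over `M₂`, which is a manifold because `p : X' → M₂` is a
submersion. Everything rests on γ depending smoothly on x, that is, on smoothness of the division
map `dr`, which sends a pair (x, y) with p x = p y to the arrow γ with x · γ = y.

Division is continuous because (x, γ) ↦ (x, x · γ) is injective by freeness and proper, hence a
closed embedding. For smoothness, fix x. The map γ ↦ x · γ is injective on a fibre of the source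
map, and an injective smooth map is immersive somewhere in every nonempty open set
(`exists_injective_fderiv_of_injOn`). Hence division is smooth at (x, y) for a dense open set of y
in the fibre of p through x. Choosing y good for both x and z, the identity dr(x, z) = dr(x, y)
dr(z, y)⁻¹ carries smoothness to every pair (`contMDiffOn_dr`).

The bimodule axioms pass to classes by computing on representatives. Division in `X''` is composed
of divisions and actions in `X` and `X'`, so it is continuous; the image of the action map is a
closed fibre product, so that map is a closed embedding and therefore proper.

For `i''`, dividing i y by i w in `X` gives the arrow of `R₂` that divides y by w (`dr_i`), so
equality of classes in `X''` forces equality in `Y''`. To see that `i''` is an immersion, take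
sections of `Y → L₁` and `X → M₁` compatible with i. Normal representatives then correspond under
(i, i'), and local left inverses of `L₁ → M₁` and of i' combine into a smooth local left inverse of
`i''`. Throughout, immersions and submersions are recognised as smooth maps with smooth local left
inverses, respectively with smooth local sections through every point. -/

/-! ### Inverse function theorem and points of maximal rank -/

section Analysis

variable {𝕜 : Type*} [RCLike 𝕜]
  {E : Type*} [NormedAddCommGroup E] [NormedSpace 𝕜 E]
  {E' : Type*} [NormedAddCommGroup E'] [NormedSpace 𝕜 E']
  {F : Type*} [NormedAddCommGroup F] [NormedSpace 𝕜 F]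

/-- The inverse function theorem, with the local inverse smooth on its whole domain. -/
theorem exists_openPartialHomeomorph_of_hasFDerivAt [CompleteSpace E] {g : E → E'} {U : Set E}
    {a : E} (hU : IsOpen U) (ha : a ∈ U) {n : ℕ∞} (hn : 1 ≤ n) (hg : ContDiffOn 𝕜 n g U)
    (L : E ≃L[𝕜] E') (hL : HasFDerivAt g (L : E →L[𝕜] E') a) :
    ∃ Θ : OpenPartialHomeomorph E E', a ∈ Θ.source ∧ Θ.source ⊆ U ∧ (∀ x, Θ x = g x) ∧
      ContDiffOn 𝕜 n Θ Θ.source ∧ ContDiffOn 𝕜 n Θ.symm Θ.target := by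
  have hn0 : (n : WithTop ℕ∞) ≠ 0 := by
    rintro h
    have : n = 0 := by exact_mod_cast h
    simp [this] at hn
  have hn1 : (1 : WithTop ℕ∞) ≤ n := by exact_mod_cast hn
  have hga : ContDiffAt 𝕜 n g a := hg.contDiffAt (hU.mem_nhds ha)
  have hc : ContinuousOn (fderiv 𝕜 g) U := hg.continuousOn_fderiv_of_isOpen hU hn1
  -- Cutting the source down to points with invertible derivative makes the inverse smooth on the
  -- whole target, not just near the image of `a`.
  have hW : IsOpen (U ∩ fderiv 𝕜 g ⁻¹' Set.range ((↑) : (E ≃L[𝕜] E') → E →L[𝕜] E')) :=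
    hc.isOpen_inter_preimage hU ContinuousLinearEquiv.isOpen
  set W := U ∩ fderiv 𝕜 g ⁻¹' Set.range ((↑) : (E ≃L[𝕜] E') → E →L[𝕜] E') with hWdef
  refine ⟨(hga.toOpenPartialHomeomorph g hL hn0).restrOpen W hW, ?_, ?_, fun x => rfl, ?_, ?_⟩
  · exact ⟨hga.mem_toOpenPartialHomeomorph_source hL hn0, ha, L, hL.fderiv.symm⟩
  · exact fun x hx => hx.2.1
  · exact hg.mono fun x hx => hx.2.1
  · intro y hy
    set Θ := (hga.toOpenPartialHomeomorph g hL hn0).restrOpen W hW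
    have hx : Θ.symm y ∈ Θ.source := Θ.map_target hy
    obtain ⟨L', hL'⟩ := hx.2.2
    have hgx : ContDiffAt 𝕜 n g (Θ.symm y) := hg.contDiffAt (hU.mem_nhds hx.2.1)
    refine (Θ.contDiffAt_symm (f₀' := L') hy ?_ hgx).contDiffWithinAt
    rw [hL']
    exact (hgx.differentiableAt hn0).hasFDerivAt

/-- Compose `g` with a linear left inverse Λ of its derivative: Λ ∘ g has identity derivative at
`a`, hence a local inverse Θ⁻¹, and Θ⁻¹ ∘ Λ inverts `g` from the left. -/
theorem exists_contDiffOn_leftInverse [FiniteDimensional 𝕜 E] [FiniteDimensional 𝕜 E']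
    {g : E → E'} {U : Set E} {a : E} (hU : IsOpen U) (ha : a ∈ U) (hg : ContDiffOn 𝕜 ∞ g U)
    (hinj : Function.Injective (fderiv 𝕜 g a)) :
    ∃ (W : Set E') (r : E' → E), IsOpen W ∧ g a ∈ W ∧ ContDiffOn 𝕜 ∞ r W ∧
      ∀ᶠ x in 𝓝 a, r (g x) = x := by
  have : CompleteSpace E := FiniteDimensional.complete 𝕜 E
  obtain ⟨Λ, hΛ⟩ := LinearMap.exists_leftInverse_of_injective (fderiv 𝕜 g a).toLinearMap
    (LinearMap.ker_eq_bot.2 hinj)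
  set Λ' : E' →L[𝕜] E := LinearMap.toContinuousLinearMap Λ
  have hda : HasFDerivAt g (fderiv 𝕜 g a) a :=
    ((hg.contDiffAt (hU.mem_nhds ha)).differentiableAt (by simp)).hasFDerivAt
  have hd : HasFDerivAt (fun x => Λ' (g x)) (ContinuousLinearEquiv.refl 𝕜 E : E →L[𝕜] E) a := by
    have := Λ'.hasFDerivAt.comp a hda
    convert! this using 1
    ext x
    exact (DFunLike.congr_fun hΛ x).symm
  obtain ⟨Θ, haΘ, hΘU, hΘ, -, hs⟩ := exists_openPartialHomeomorph_of_hasFDerivAt hU ha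
    (n := ⊤) le_top (Λ'.contDiff.comp_contDiffOn hg) _ hd
  refine ⟨Λ' ⁻¹' Θ.target, Θ.symm ∘ Λ', Θ.open_target.preimage Λ'.continuous, ?_, ?_, ?_⟩
  · have := Θ.map_source haΘ
    rwa [hΘ] at this
  · exact hs.comp Λ'.contDiff.contDiffOn fun x hx => hx
  · filter_upwards [Θ.open_source.mem_nhds haΘ] with x hx
    have := Θ.left_inv hx
    rwa [hΘ] at this

/-- A linear projection onto the kernel completes `L` to a linear coordinate system. This supplies
the extra coordinates whenever a surjective derivative has to be straightened. -/
theorem ContinuousLinearMap.exists_equiv_prod_ker [FiniteDimensional 𝕜 E]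
    [FiniteDimensional 𝕜 E'] (L : E →L[𝕜] E') (hL : Function.Surjective L) :
    ∃ (K : Submodule 𝕜 E) (P : E →L[𝕜] K) (e : E ≃L[𝕜] E' × K),
      (∀ x, x ∈ K ↔ L x = 0) ∧ (e : E →L[𝕜] E' × K) = L.prod P := by
  obtain ⟨P, hP⟩ := LinearMap.exists_leftInverse_of_injective
    (LinearMap.ker L.toLinearMap).subtype (Submodule.ker_subtype _)
  have hP' : ∀ k : LinearMap.ker L.toLinearMap, P k = k := fun k => DFunLike.congr_fun hP k
  have hk : ∀ k : LinearMap.ker L.toLinearMap, L k = 0 := fun k => k.2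
  have hbij : Function.Bijective (L.toLinearMap.prod P) := by
    constructor
    · rw [injective_iff_map_eq_zero]
      intro x hx
      have h1 : L x = 0 := congrArg Prod.fst hx
      have h2 : P x = 0 := congrArg Prod.snd hx
      have h3 := hP' ⟨x, h1⟩
      rw [h2] at h3
      exact (congrArg Subtype.val h3).symm
    · rintro ⟨y, k⟩
      obtain ⟨x, rfl⟩ := hL y
      refine ⟨x - P x + k, Prod.ext ?_ ?_⟩
      · simp [hk]
      · simp [hP']
  exact ⟨LinearMap.ker L.toLinearMap, LinearMap.toContinuousLinearMap P,
    (LinearEquiv.ofBijective _ hbij).toContinuousLinearEquiv, fun x => Iff.rfl, rfl⟩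

/-- An injective `C¹` map on a nonempty open set is immersive somewhere. -/
theorem exists_injective_fderiv_of_injOn [FiniteDimensional 𝕜 E] [FiniteDimensional 𝕜 E']
    {g : E → E'} {U : Set E} (hU : IsOpen U) (hne : U.Nonempty) (hg : ContDiffOn 𝕜 1 g U)
    (hinj : Set.InjOn g U) : ∃ a ∈ U, Function.Injective (fderiv 𝕜 g a) := by
  have : CompleteSpace E := FiniteDimensional.complete 𝕜 E
  -- a point of maximal rank
  obtain ⟨a, ha, hmax⟩ : ∃ a ∈ U, ∀ x ∈ U,
      Module.finrank 𝕜 (LinearMap.range (fderiv 𝕜 g x).toLinearMap) ≤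
        Module.finrank 𝕜 (LinearMap.range (fderiv 𝕜 g a).toLinearMap) := by
    set rk : E → ℕ := fun x => Module.finrank 𝕜 (LinearMap.range (fderiv 𝕜 g x).toLinearMap)
    have hb : BddAbove (rk '' U) := ⟨Module.finrank 𝕜 E', by
      rintro _ ⟨x, -, rfl⟩
      exact Submodule.finrank_le _⟩
    obtain ⟨a, ha, h⟩ := Nat.sSup_mem (hne.image rk) hb
    refine ⟨a, ha, fun x hx => ?_⟩
    have := le_csSup hb (Set.mem_image_of_mem rk hx)
    rwa [← h] at this
  refine ⟨a, ha, ?_⟩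
  have hda : HasFDerivAt g (fderiv 𝕜 g a) a :=
    ((hg.contDiffAt (hU.mem_nhds ha)).differentiableAt (by simp)).hasFDerivAt
  generalize fderiv 𝕜 g a = L at hmax hda ⊢
  obtain ⟨R, hR⟩ : ∃ R, R = LinearMap.range L.toLinearMap := ⟨_, rfl⟩
  rw [← hR] at hmax
  obtain ⟨PR₀, hPR₀⟩ := LinearMap.exists_leftInverse_of_injective R.subtype (Submodule.ker_subtype _)
  set PR : E' →L[𝕜] R := LinearMap.toContinuousLinearMap PR₀
  have hPR : ∀ y : R, PR y = y := fun y => DFunLike.congr_fun hPR₀ y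
  have hsurj : Function.Surjective (PR ∘L L) := by
    subst hR
    rintro ⟨_, x, rfl⟩
    exact ⟨x, hPR ⟨L x, x, rfl⟩⟩
  obtain ⟨K, P, e, hK, he⟩ := (PR ∘L L).exists_equiv_prod_ker hsurj
  -- Coordinates adapted to the rank: the component of `g` along the range of its derivative at `a`,
  -- completed by a projection onto the kernel.
  have hd : HasFDerivAt (fun x => (PR (g x), P x))
      (e : E →L[𝕜] R × K) a := by
    have := (PR.hasFDerivAt.comp a hda).prodMk (P.hasFDerivAt (x := a))
    rwa [← he] at this
  obtain ⟨Θ, haΘ, hΘU, hΘ, hs, hs'⟩ := exists_openPartialHomeomorph_of_hasFDerivAt hU ha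
    (n := 1) le_rfl ((PR.contDiff.comp_contDiffOn hg).prodMk P.contDiff.contDiffOn) e hd
  -- in the new coordinates the derivative vanishes along the kernel
  have hvan : ∀ y ∈ Θ.target, ∃ D : (R × K) →L[𝕜] E',
      HasFDerivAt (g ∘ Θ.symm) D y ∧ ∀ k, D (0, k) = 0 := by
    intro y hy
    have hx := Θ.map_target hy
    have h1 : HasFDerivAt g (fderiv 𝕜 g (Θ.symm y)) (Θ.symm y) :=
      ((hg.contDiffAt (hU.mem_nhds (hΘU hx))).differentiableAt (by simp)).hasFDerivAt
    have h2 : HasFDerivAt Θ.symm (fderiv 𝕜 Θ.symm y) y :=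
      ((hs'.contDiffAt (Θ.open_target.mem_nhds hy)).differentiableAt (by simp)).hasFDerivAt
    set D := (fderiv 𝕜 g (Θ.symm y)) ∘L (fderiv 𝕜 Θ.symm y)
    have hD : HasFDerivAt (g ∘ Θ.symm) D y := h1.comp y h2
    have hfst : PR ∘L D = ContinuousLinearMap.fst 𝕜 _ _ := by
      have h3 : HasFDerivAt (fun z => PR (g (Θ.symm z))) (PR ∘L D) y := PR.hasFDerivAt.comp y hD
      refine h3.unique (HasFDerivAt.congr_of_eventuallyEq (f := fun z : R × K => z.1)
        (ContinuousLinearMap.fst 𝕜 R K).hasFDerivAt ?_)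
      filter_upwards [Θ.open_target.mem_nhds hy] with z hz
      have := Θ.right_inv hz
      rw [hΘ] at this
      exact congrArg Prod.fst this
    have hrk : Module.finrank 𝕜 (LinearMap.range D.toLinearMap) ≤ Module.finrank 𝕜 R := by
      refine le_trans (Submodule.finrank_mono ?_) (hmax _ (hΘU hx))
      exact LinearMap.range_comp_le_range _ _
    -- `PR` maps the range of `D` onto `R`, and maximality of the rank bounds the dimension of that
    -- range by that of `R`. So `PR` is injective on the range, and `D (0, k)`, which it kills, must
    -- vanish.
    set T : LinearMap.range D.toLinearMap →ₗ[𝕜] R :=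
      PR.toLinearMap.comp (LinearMap.range D.toLinearMap).subtype
    have hT : Function.Surjective T := fun r =>
      ⟨⟨D (r, 0), (r, 0), rfl⟩, DFunLike.congr_fun hfst (r, 0)⟩
    have hTi : Function.Injective T :=
      (LinearMap.injective_iff_surjective_of_finrank_eq_finrank
        (le_antisymm hrk (LinearMap.finrank_le_finrank_of_surjective hT))).2 hT
    refine ⟨D, hD, fun k => ?_⟩
    have h4 : T ⟨D (0, k), (0, k), rfl⟩ = T 0 := by
      rw [map_zero]
      exact DFunLike.congr_fun hfst (0, k)
    exact congrArg Subtype.val (hTi h4)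
  rw [injective_iff_map_eq_zero]
  intro k hk
  by_contra hk0
  obtain ⟨k', hk'⟩ : ∃ k' : K, (k' : E) = k := ⟨⟨k, (hK k).2 (by simp [hk])⟩, rfl⟩
  set y₀ := Θ a
  have hy₀ : y₀ ∈ Θ.target := Θ.map_source haΘ
  -- If the derivative at `a` killed `k ≠ 0`, then `g` would be constant along this segment in the
  -- adapted coordinates, contradicting injectivity at the parameters 0 and ε / 2.
  set line : 𝕜 → R × K := fun t => y₀ + t • (0, k')
  have hline : ∀ t, HasFDerivAt line
      ((ContinuousLinearMap.id 𝕜 𝕜).smulRight (0, k')) t := fun t =>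
    (((ContinuousLinearMap.id 𝕜 𝕜).hasFDerivAt.smul_const (0, k')).const_add y₀)
  have hlc : Continuous line := by fun_prop
  have hl0 : line 0 = y₀ := by simp [line]
  obtain ⟨ε, hε, hball⟩ := Metric.mem_nhds_iff.1 (hlc.continuousAt.preimage_mem_nhds
    (show Θ.target ∈ 𝓝 (line 0) by rw [hl0]; exact Θ.open_target.mem_nhds hy₀))
  have hder : ∀ t ∈ Metric.ball (0 : 𝕜) ε, HasFDerivAt ((g ∘ Θ.symm) ∘ line) (0 : 𝕜 →L[𝕜] E') t := by
    intro t ht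
    obtain ⟨D, hD, hD0⟩ := hvan _ (hball ht)
    have h := hD.comp t (hline t)
    have h0 : D ∘L ((ContinuousLinearMap.id 𝕜 𝕜).smulRight (0, k')) = 0 := by
      ext
      simp [hD0]
    rwa [h0] at h
  have hε2 : ((ε / 2 : ℝ) : 𝕜) ∈ Metric.ball (0 : 𝕜) ε := by
    simp only [Metric.mem_ball, dist_zero_right, RCLike.norm_ofReal]
    rw [abs_of_pos (by positivity)]
    linarith
  have hconst := Metric.isOpen_ball.is_const_of_fderiv_eq_zero
    (convex_ball (0 : 𝕜) ε).isPreconnected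
    (fun t ht => (hder t ht).differentiableAt.differentiableWithinAt)
    (fun t ht => (hder t ht).fderiv) hε2 (Metric.mem_ball_self hε)
  have hmem : ∀ t ∈ Metric.ball (0 : 𝕜) ε, Θ.symm (line t) ∈ U :=
    fun t ht => hΘU (Θ.map_target (hball ht))
  have h5 := hinj (hmem _ hε2) (hmem _ (Metric.mem_ball_self hε)) hconst
  have h6 := Θ.symm.injOn (hball hε2) (hball (Metric.mem_ball_self hε)) h5
  have h7 : ((ε / 2 : ℝ) : 𝕜) • k' = 0 := by
    simpa [line] using h6
  rcases smul_eq_zero.1 h7 with h | h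
  · have : (ε / 2 : ℝ) = 0 := by exact_mod_cast h
    linarith
  · exact hk0 (by rw [← hk', h]; rfl)

end Analysis

/-! ### Immersions and submersions from local left inverses and sections -/

section Charts

variable {𝕜 : Type*} [RCLike 𝕜]
  {E : Type*} [NormedAddCommGroup E] [NormedSpace 𝕜 E]
  {E' : Type*} [NormedAddCommGroup E'] [NormedSpace 𝕜 E']
  {F : Type*} [NormedAddCommGroup F] [NormedSpace 𝕜 F]
  {M : Type*} [TopologicalSpace M] [ChartedSpace E M] [IsManifold 𝓘(𝕜, E) ∞ M]
  {N : Type*} [TopologicalSpace N] [ChartedSpace E' N] [IsManifold 𝓘(𝕜, E') ∞ N]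

-- Charts may be straightened by a local diffeomorphism of the model space; the two criteria below
-- obtain their adapted charts this way.
omit [IsManifold 𝓘(𝕜, E) ∞ M] in
theorem OpenPartialHomeomorph.trans_mem_maximalAtlas {φ : OpenPartialHomeomorph M E}
    (hφ : φ ∈ IsManifold.maximalAtlas 𝓘(𝕜, E) ∞ M) {Θ : OpenPartialHomeomorph E E}
    (h : ContDiffOn 𝕜 ∞ Θ Θ.source) (h' : ContDiffOn 𝕜 ∞ Θ.symm Θ.target) :
    φ.trans Θ ∈ IsManifold.maximalAtlas 𝓘(𝕜, E) ∞ M := by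
  have hΘ : Θ ∈ contDiffGroupoid ∞ 𝓘(𝕜, E) := by
    rw [contDiffGroupoid, mem_groupoid_of_pregroupoid]
    simpa [contDiffPregroupoid] using ⟨h, h'⟩
  rw [IsManifold.maximalAtlas, mem_maximalAtlas_iff] at hφ ⊢
  intro e he
  obtain ⟨h1, h2⟩ := hφ e he
  rw [OpenPartialHomeomorph.trans_symm_eq_symm_trans_symm, OpenPartialHomeomorph.trans_assoc,
    ← OpenPartialHomeomorph.trans_assoc e.symm]
  exact ⟨StructureGroupoid.trans _ (StructureGroupoid.symm _ hΘ) h1,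
    StructureGroupoid.trans _ h2 hΘ⟩

omit [IsManifold 𝓘(𝕜, E) ∞ M] [IsManifold 𝓘(𝕜, E') ∞ N] in
/-- A smooth map, read in two charts. -/
theorem ContMDiffOn.contDiffOn_charts {f : M → N} {O : Set M} (hO : IsOpen O)
    (hf : ContMDiffOn 𝓘(𝕜, E) 𝓘(𝕜, E') ∞ f O) {φ : OpenPartialHomeomorph M E}
    (hφ : φ ∈ IsManifold.maximalAtlas 𝓘(𝕜, E) ∞ M) {ψ : OpenPartialHomeomorph N E'}
    (hψ : ψ ∈ IsManifold.maximalAtlas 𝓘(𝕜, E') ∞ N) :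
    IsOpen (φ.target ∩ φ.symm ⁻¹' (O ∩ f ⁻¹' ψ.source)) ∧
      ContDiffOn 𝕜 ∞ (ψ ∘ f ∘ φ.symm) (φ.target ∩ φ.symm ⁻¹' (O ∩ f ⁻¹' ψ.source)) := by
  refine ⟨φ.isOpen_inter_preimage_symm (hf.continuousOn.isOpen_inter_preimage hO ψ.open_source), ?_⟩
  rw [← contMDiffOn_iff_contDiffOn]
  refine (contMDiffOn_of_mem_maximalAtlas hψ).comp (t := ψ.source) (hf.comp (t := O)
    ((contMDiffOn_symm_of_mem_maximalAtlas hφ).mono Set.inter_subset_left) ?_) ?_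
  · exact fun x hx => hx.2.1
  · exact fun x hx => hx.2.2

variable [FiniteDimensional 𝕜 E] [FiniteDimensional 𝕜 E'] 

/-- A smooth map with a smooth local section through a point is a submersion at this point. -/
theorem isSubmersionAtOfComplement_of_section [FiniteDimensional 𝕜 F] {f : M → N}
    (hf : ContMDiff 𝓘(𝕜, E) 𝓘(𝕜, E') ∞ f)
    (hF : Module.finrank 𝕜 F = Module.finrank 𝕜 E - Module.finrank 𝕜 E') {x : M} {V : Set N}
    (hV : IsOpen V) (hxV : f x ∈ V) {σ : N → M} (hσ : ContMDiffOn 𝓘(𝕜, E') 𝓘(𝕜, E) ∞ σ V)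
    (hσx : σ (f x) = x) (hfσ : ∀ y ∈ V, f (σ y) = y) :
    IsSubmersionAtOfComplement F 𝓘(𝕜, E) 𝓘(𝕜, E') ∞ f x := by
  have : CompleteSpace E := FiniteDimensional.complete 𝕜 E
  set φ := chartAt E x
  set ψ := chartAt E' (f x)
  have hφ : φ ∈ IsManifold.maximalAtlas 𝓘(𝕜, E) ∞ M := IsManifold.chart_mem_maximalAtlas x
  have hψ : ψ ∈ IsManifold.maximalAtlas 𝓘(𝕜, E') ∞ N := IsManifold.chart_mem_maximalAtlas (f x)
  have hxφ : x ∈ φ.source := mem_chart_source E x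
  have hxψ : f x ∈ ψ.source := mem_chart_source E' (f x)
  obtain ⟨hU, hg⟩ := hf.contMDiffOn.contDiffOn_charts isOpen_univ hφ hψ
  obtain ⟨hU', hg'⟩ := hσ.contDiffOn_charts hV hψ hφ
  set U := φ.target ∩ φ.symm ⁻¹' (Set.univ ∩ f ⁻¹' ψ.source)
  set U' := ψ.target ∩ ψ.symm ⁻¹' (V ∩ σ ⁻¹' φ.source)
  have hxU : φ x ∈ U := ⟨φ.map_source hxφ, trivial, by simpa [φ.left_inv hxφ] using hxψ⟩
  have hxU' : ψ (f x) ∈ U' := ⟨ψ.map_source hxψ, by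
    simpa only [Set.mem_preimage, ψ.left_inv hxψ, Set.mem_inter_iff, hσx] using ⟨hxV, hxφ⟩⟩
  have hd : HasFDerivAt (ψ ∘ f ∘ φ.symm) (fderiv 𝕜 (ψ ∘ f ∘ φ.symm) (φ x)) (φ x) :=
    ((hg.contDiffAt (hU.mem_nhds hxU)).differentiableAt (by simp)).hasFDerivAt
  have hd' : HasFDerivAt (φ ∘ σ ∘ ψ.symm) (fderiv 𝕜 (φ ∘ σ ∘ ψ.symm) (ψ (f x))) (ψ (f x)) :=
    ((hg'.contDiffAt (hU'.mem_nhds hxU')).differentiableAt (by simp)).hasFDerivAt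
  generalize fderiv 𝕜 (ψ ∘ f ∘ φ.symm) (φ x) = L at hd
  generalize fderiv 𝕜 (φ ∘ σ ∘ ψ.symm) (ψ (f x)) = L' at hd'
  have hb : (φ ∘ σ ∘ ψ.symm) (ψ (f x)) = φ x := by simp [ψ.left_inv hxψ, hσx]
  have hcomp : L ∘L L' = ContinuousLinearMap.id 𝕜 E' := by
    rw [← hb] at hd
    refine (hd.comp _ hd').unique (HasFDerivAt.congr_of_eventuallyEq (f := id)
      (hasFDerivAt_id _) ?_)
    filter_upwards [hU'.mem_nhds hxU'] with y hy
    simp [φ.left_inv hy.2.2, hfσ _ hy.2.1, ψ.right_inv hy.1]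
  have hsurj : Function.Surjective L := fun y => ⟨L' y, DFunLike.congr_fun hcomp y⟩
  obtain ⟨K, P, e, -, he⟩ := L.exists_equiv_prod_ker hsurj
  -- The chain rule for f ∘ σ = id makes `L` surjective, so `f` together with a projection onto the
  -- kernel of `L` is a local diffeomorphism.
  have hdG : HasFDerivAt (fun z => ((ψ ∘ f ∘ φ.symm) z, P z)) (e : E →L[𝕜] E' × K) (φ x) := by
    rw [he]
    exact hd.prodMk P.hasFDerivAt
  obtain ⟨Θ, hxΘ, hΘU, hΘ, hs, hs'⟩ := exists_openPartialHomeomorph_of_hasFDerivAt hU hxU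
    (n := ⊤) le_top (hg.prodMk P.contDiff.contDiffOn) e hdG
  have hKF : Module.finrank 𝕜 K = Module.finrank 𝕜 F := by
    have := e.toLinearEquiv.finrank_eq
    rw [Module.finrank_prod] at this
    omega
  refine IsSubmersionAtOfComplement.trans_F (F := K) ?_ (ContinuousLinearEquiv.ofFinrankEq hKF)
  -- Charts of `M` must take values in `E`, so the straightened coordinates in `E' × K` are carried
  -- back by the linear map `e.symm`.
  set Θ' : OpenPartialHomeomorph E E := Θ.trans e.symm.toHomeomorph.toOpenPartialHomeomorph
  have hΘ'1 : ContDiffOn 𝕜 ∞ Θ' Θ'.source :=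
    e.symm.contDiff.comp_contDiffOn (hs.mono (by simp [Θ']))
  have hΘ'2 : ContDiffOn 𝕜 ∞ Θ'.symm Θ'.target :=
    hs'.comp e.contDiff.contDiffOn fun y hy => by simpa [Θ'] using hy
  refine IsSubmersionAtOfComplement.mk_of_continuousAt hf.continuous.continuousAt e
    (φ.trans Θ') ψ ?_ hxψ (OpenPartialHomeomorph.trans_mem_maximalAtlas hφ hΘ'1 hΘ'2) hψ ?_
  · simpa [Θ', hxφ] using hxΘ
  · intro y hy
    have hy' : e y ∈ Θ.target := by
      simp [Θ'] at hy
      exact hy.1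
    have h1 := congrArg Prod.fst (hΘ (Θ.symm (e y)))
    rw [Θ.right_inv hy'] at h1
    simpa [Θ'] using h1.symm

/-- A smooth map with a smooth local left inverse is an immersion. -/
theorem isImmersionAtOfComplement_of_leftInverse [FiniteDimensional 𝕜 F] {f : M → N}
    (hf : ContMDiff 𝓘(𝕜, E) 𝓘(𝕜, E') ∞ f)
    (hF : Module.finrank 𝕜 F = Module.finrank 𝕜 E' - Module.finrank 𝕜 E) {x : M} {W : Set N}
    (hW : IsOpen W) (hxW : f x ∈ W) {r : N → M} (hr : ContMDiffOn 𝓘(𝕜, E') 𝓘(𝕜, E) ∞ r W)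
    (hrf : ∀ᶠ y in 𝓝 x, r (f y) = y) :
    IsImmersionAtOfComplement F 𝓘(𝕜, E) 𝓘(𝕜, E') ∞ f x := by
  have : CompleteSpace E := FiniteDimensional.complete 𝕜 E
  have : CompleteSpace F := FiniteDimensional.complete 𝕜 F
  set φ := chartAt E x
  set ψ := chartAt E' (f x)
  have hφ : φ ∈ IsManifold.maximalAtlas 𝓘(𝕜, E) ∞ M := IsManifold.chart_mem_maximalAtlas x
  have hψ : ψ ∈ IsManifold.maximalAtlas 𝓘(𝕜, E') ∞ N := IsManifold.chart_mem_maximalAtlas (f x)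
  have hxφ : x ∈ φ.source := mem_chart_source E x
  have hxψ : f x ∈ ψ.source := mem_chart_source E' (f x)
  have hrx : r (f x) = x := hrf.self_of_nhds
  obtain ⟨hU, hg⟩ := hf.contMDiffOn.contDiffOn_charts isOpen_univ hφ hψ
  obtain ⟨hU', hg'⟩ := hr.contDiffOn_charts hW hψ hφ
  set U := φ.target ∩ φ.symm ⁻¹' (Set.univ ∩ f ⁻¹' ψ.source)
  set U' := ψ.target ∩ ψ.symm ⁻¹' (W ∩ r ⁻¹' φ.source)
  have hxU : φ x ∈ U := ⟨φ.map_source hxφ, trivial, by simpa [φ.left_inv hxφ] using hxψ⟩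
  have hxU' : ψ (f x) ∈ U' := ⟨ψ.map_source hxψ, by
    simpa only [Set.mem_preimage, ψ.left_inv hxψ, Set.mem_inter_iff, hrx] using ⟨hxW, hxφ⟩⟩
  have hd : HasFDerivAt (ψ ∘ f ∘ φ.symm) (fderiv 𝕜 (ψ ∘ f ∘ φ.symm) (φ x)) (φ x) :=
    ((hg.contDiffAt (hU.mem_nhds hxU)).differentiableAt (by simp)).hasFDerivAt
  have hd' : HasFDerivAt (φ ∘ r ∘ ψ.symm) (fderiv 𝕜 (φ ∘ r ∘ ψ.symm) (ψ (f x))) (ψ (f x)) :=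
    ((hg'.contDiffAt (hU'.mem_nhds hxU')).differentiableAt (by simp)).hasFDerivAt
  generalize fderiv 𝕜 (ψ ∘ f ∘ φ.symm) (φ x) = L at hd
  generalize fderiv 𝕜 (φ ∘ r ∘ ψ.symm) (ψ (f x)) = L' at hd'
  have hb : (ψ ∘ f ∘ φ.symm) (φ x) = ψ (f x) := by simp [φ.left_inv hxφ]
  have hcomp : L' ∘L L = ContinuousLinearMap.id 𝕜 E := by
    rw [← hb] at hd'
    refine (hd'.comp _ hd).unique (HasFDerivAt.congr_of_eventuallyEq (f := id)
      (hasFDerivAt_id _) ?_)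
    have h1 : ∀ᶠ z in 𝓝 (φ x), r (f (φ.symm z)) = φ.symm z := by
      have := φ.continuousAt_symm (φ.map_source hxφ)
      rw [ContinuousAt, φ.left_inv hxφ] at this
      exact this.eventually hrf
    filter_upwards [hU.mem_nhds hxU, h1] with z hz hz'
    simp [ψ.left_inv hz.2.2, hz', φ.right_inv hz.1]
  have hinj : Function.Injective L := fun y z hyz => by
    have := congrArg L' hyz
    rwa [← ContinuousLinearMap.comp_apply, ← ContinuousLinearMap.comp_apply, hcomp] at this
  have hsurj : Function.Surjective L' := fun y => ⟨L y, DFunLike.congr_fun hcomp y⟩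
  obtain ⟨K, P, e', hK, he'⟩ := L'.exists_equiv_prod_ker hsurj
  have hKF : Module.finrank 𝕜 F = Module.finrank 𝕜 K := by
    have := e'.toLinearEquiv.finrank_eq
    rw [Module.finrank_prod] at this
    omega
  -- Since L' ∘ L = id, the kernel of `L'` is a complement of the range of `L`; it provides the
  -- directions normal to the image of `f`.
  set ι : F →L[𝕜] E' := K.subtypeL ∘L (ContinuousLinearEquiv.ofFinrankEq hKF : F →L[𝕜] K)
  have hι : ∀ w, L' (ι w) = 0 := fun w => (hK _).1 (ContinuousLinearEquiv.ofFinrankEq hKF w).2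
  have hιinj : Function.Injective ι :=
    Subtype.val_injective.comp (ContinuousLinearEquiv.ofFinrankEq hKF).injective
  have hbij : Function.Bijective (L.coprod ι) := by
    constructor
    · rw [injective_iff_map_eq_zero]
      rintro ⟨u, w⟩ h
      have h1 : L u + ι w = 0 := by simpa using h
      have h2 := congrArg L' h1
      rw [map_add, hι, map_zero, add_zero] at h2
      have h3 : u = 0 := by
        have := DFunLike.congr_fun hcomp u
        simpa [h2] using this.symm
      have h4 : w = 0 := hιinj (by simpa [h3] using h1)
      rw [h3, h4]; rfl
    · intro y
      have h1 : y - L (L' y) ∈ K := by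
        rw [hK, map_sub, sub_eq_zero]
        exact (DFunLike.congr_fun hcomp (L' y)).symm
      refine ⟨(L' y, (ContinuousLinearEquiv.ofFinrankEq hKF).symm ⟨_, h1⟩), ?_⟩
      simp [ι]
  set e : (E × F) ≃L[𝕜] E' :=
    (LinearEquiv.ofBijective (L.coprod ι).toLinearMap hbij).toContinuousLinearEquiv
  have hdG : HasFDerivAt (fun z : E × F => (ψ ∘ f ∘ φ.symm) z.1 + ι z.2) (e : E × F →L[𝕜] E')
      (φ x, 0) := by
    have h1 : HasFDerivAt (fun z : E × F => (ψ ∘ f ∘ φ.symm) z.1)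
      (L ∘L ContinuousLinearMap.fst 𝕜 E F) (φ x, 0) :=
      HasFDerivAt.comp (𝕜 := 𝕜) (E := E × F) (φ x, (0 : F)) (g := ψ ∘ f ∘ φ.symm) hd hasFDerivAt_fst
    have h2 : HasFDerivAt (fun z : E × F => ι z.2)
      (ι ∘L ContinuousLinearMap.snd 𝕜 E F) (φ x, 0) := ι.hasFDerivAt.comp _ hasFDerivAt_snd
    convert! h1.add h2 using 1
  obtain ⟨Θ, hxΘ, hΘU, hΘ, hs, hs'⟩ := exists_openPartialHomeomorph_of_hasFDerivAt
    (hU.prod (isOpen_univ (X := F))) (a := (φ x, 0)) ⟨hxU, trivial⟩ (n := ⊤) le_top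
    ((hg.comp contDiff_fst.contDiffOn fun z hz => hz.1).add
      (ι.contDiff.comp contDiff_snd).contDiffOn) e hdG
  have hΘ0 : ∀ u, Θ (u, 0) = ψ (f (φ.symm u)) := fun u => by simp [hΘ]
  set Θ' : OpenPartialHomeomorph E' E' := Θ.symm.trans e.toHomeomorph.toOpenPartialHomeomorph
  have hΘ'1 : ContDiffOn 𝕜 ∞ Θ' Θ'.source :=
    e.contDiff.comp_contDiffOn (hs'.mono (by simp [Θ']))
  have hΘ'2 : ContDiffOn 𝕜 ∞ Θ'.symm Θ'.target :=
    hs.comp e.symm.contDiff.contDiffOn fun y hy => by simpa [Θ'] using hy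
  -- The domain chart is restricted to those `u` for which `(u, 0)` lies in the source of `Θ`, so
  -- that `Θ` can be inverted at `ψ (f (φ.symm u))`.
  have hT : IsOpen ((fun u : E => ((u, 0) : E × F)) ⁻¹' Θ.source) :=
    Θ.open_source.preimage (by fun_prop)
  have hφΘ : ContDiffOn 𝕜 ∞ (OpenPartialHomeomorph.ofSet _ hT)
    (OpenPartialHomeomorph.ofSet _ hT).source := contDiff_id.contDiffOn
  refine IsImmersionAtOfComplement.mk_of_continuousAt hf.continuous.continuousAt e
    (φ.trans (OpenPartialHomeomorph.ofSet _ hT)) (ψ.trans Θ') ?_ ?_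
    (OpenPartialHomeomorph.trans_mem_maximalAtlas hφ hφΘ hφΘ)
    (OpenPartialHomeomorph.trans_mem_maximalAtlas hψ hΘ'1 hΘ'2) ?_
  · simpa [hxφ] using hxΘ
  · have := Θ.map_source hxΘ
    rw [hΘ0, φ.left_inv hxφ] at this
    simpa [Θ', hxψ] using this
  · intro y hy
    have hy' : (y, 0) ∈ Θ.source := by
      simp at hy
      exact hy.1
    have h1 := Θ.left_inv hy'
    rw [hΘ0] at h1
    simp [Θ', h1]

end Charts

/-- One Euclidean space, of dimension the codimension, serves as the complement at all points. -/
theorem isImmersion_of_leftInverse {𝕜 : Type*} [RCLike 𝕜]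
    {E : Type*} [NormedAddCommGroup E] [NormedSpace 𝕜 E] [FiniteDimensional 𝕜 E]
    {E' : Type*} [NormedAddCommGroup E'] [NormedSpace 𝕜 E'] [FiniteDimensional 𝕜 E']
    {M : Type*} [TopologicalSpace M] [ChartedSpace E M] [IsManifold 𝓘(𝕜, E) ∞ M]
    {N : Type*} [TopologicalSpace N] [ChartedSpace E' N] [IsManifold 𝓘(𝕜, E') ∞ N]
    {f : M → N} (hf : ContMDiff 𝓘(𝕜, E) 𝓘(𝕜, E') ∞ f)
    (h : ∀ x, ∃ (W : Set N) (r : N → M), IsOpen W ∧ f x ∈ W ∧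
      ContMDiffOn 𝓘(𝕜, E') 𝓘(𝕜, E) ∞ r W ∧ ∀ᶠ y in 𝓝 x, r (f y) = y) :
    IsImmersion 𝓘(𝕜, E) 𝓘(𝕜, E') ∞ f := by
  refine IsImmersionOfComplement.isImmersion
    (F := EuclideanSpace 𝕜 (Fin (Module.finrank 𝕜 E' - Module.finrank 𝕜 E))) fun x => ?_
  obtain ⟨W, r, hW, hxW, hr, hrf⟩ := h x
  exact isImmersionAtOfComplement_of_leftInverse hf (by simp) hW hxW hr hrf

/-- A subset of a manifold which is locally a smooth retract of the manifold. -/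
def IsLocalSmoothRetract {𝕜 : Type*} [NontriviallyNormedField 𝕜]
    {E : Type*} [NormedAddCommGroup E] [NormedSpace 𝕜 E] {H : Type*} [TopologicalSpace H]
    (I : ModelWithCorners 𝕜 E H) {N : Type*} [TopologicalSpace N] [ChartedSpace H N]
    (S : Set N) : Prop :=
  ∀ z ∈ S, ∃ (O : Set N) (R : N → N), IsOpen O ∧ z ∈ O ∧ ContMDiffOn I I ∞ R O ∧
    Set.MapsTo R O S ∧ ∀ w ∈ O ∩ S, R w = w

/-! ### Fibre coordinates of submersions and smooth maps on fibre products -/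

namespace Mfd

variable {𝕜 : Type} [RCLike 𝕜] {X Y Z M : Mfd.{u} 𝕜}

theorem submersion_of_section {f : X → Y} (hf : Smooth f)
    (h : ∀ x, ∃ (V : Set Y) (σ : Y → X), IsOpen V ∧ f x ∈ V ∧ ContMDiffOn Y.I X.I ∞ σ V ∧
      σ (f x) = x ∧ ∀ y ∈ V, f (σ y) = y) : Submersion f := by
  refine IsSubmersionOfComplement.isSubmersion
    (F := EuclideanSpace 𝕜 (Fin (X.dim - Y.dim))) fun x => ?_
  obtain ⟨V, σ, hV, hxV, hσ, hσx, hfσ⟩ := h x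
  exact isSubmersionAtOfComplement_of_section hf (by simp) hV hxV hσ hσx hfσ

theorem injImmersion_of_leftInverse {f : X → Y} (hf : Smooth f) (hi : Function.Injective f)
    (h : ∀ x, ∃ (W : Set Y) (r : Y → X), IsOpen W ∧ f x ∈ W ∧
      ContMDiffOn Y.I X.I ∞ r W ∧ ∀ᶠ y in 𝓝 x, r (f y) = y) : InjImmersion f :=
  ⟨hi, isImmersion_of_leftInverse hf h⟩

theorem isImmersion_prod_of_leftInverse {f : X → Y × Z}
    (hf : ContMDiff X.I (Y.I.prod Z.I) ∞ f)
    (h : ∀ x, ∃ (W : Set (Y × Z)) (r : Y × Z → X), IsOpen W ∧ f x ∈ W ∧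
      ContMDiffOn (Y.I.prod Z.I) X.I ∞ r W ∧ ∀ᶠ y in 𝓝 x, r (f y) = y) :
    IsImmersion X.I (Y.I.prod Z.I) ∞ f := by
  let i : ChartedSpace (EuclideanSpace 𝕜 (Fin Y.dim) × EuclideanSpace 𝕜 (Fin Z.dim)) (Y × Z) :=
    prodChartedSpace _ _ _ _
  have hm : IsManifold (Y.I.prod Z.I) ∞ (Y × Z) := inferInstance
  -- The target is a product with the product model; identifying that model with the self-model of
  -- the product space makes the general criterion applicable.
  unfold Mfd.I at hm hf h ⊢
  rw [← modelWithCornersSelf_prod] at hm hf h ⊢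
  exact isImmersion_of_leftInverse (𝕜 := 𝕜) (M := X) (N := Y × Z) hf h

/-- An immersion has smooth local left inverses. -/
theorem InjImmersion.exists_leftInverse {f : X → Y} (hf : InjImmersion f) (x : X) :
    ∃ (W : Set Y) (r : Y → X), IsOpen W ∧ f x ∈ W ∧ ContMDiffOn Y.I X.I ∞ r W ∧
      ∀ᶠ y in 𝓝 x, r (f y) = y := by
  have h := (hf.2.isImmersionAt x).isImmersionAtOfComplement_complement
  set φ := h.domChart
  set ψ := h.codChart
  have h1 := h.writtenInCharts
  have hφ : ContMDiffOn X.I X.I ∞ φ.symm φ.target :=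
    contMDiffOn_symm_of_mem_maximalAtlas h.domChart_mem_maximalAtlas
  have hψ : ContMDiffOn Y.I Y.I ∞ ψ ψ.source :=
    contMDiffOn_of_mem_maximalAtlas h.codChart_mem_maximalAtlas
  have hL : ContMDiff Y.I X.I ∞ fun y => (h.equiv.symm y).1 :=
    ((ContinuousLinearMap.fst 𝕜 _ _).contDiff.comp h.equiv.symm.contDiff).contMDiff
  have hLψ := hL.comp_contMDiffOn hψ
  -- In adapted charts `f` reads u ↦ (u, 0), so dropping the second component inverts it.
  have hkey : ∀ z ∈ φ.source, (h.equiv.symm (ψ (f z))).1 = φ z := by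
    intro z hz
    have h2 := h1 (x := φ z) (by simpa using φ.map_source hz)
    have h3 : ψ (f z) = h.equiv (φ z, 0) := by
      have h4 : ψ (f (φ.symm (φ z))) = h.equiv (φ z, 0) := by simpa using h2
      rwa [φ.left_inv hz] at h4
    simp [h3]
  refine ⟨ψ.source ∩ (fun y => (h.equiv.symm (ψ y)).1) ⁻¹' φ.target,
    fun y => φ.symm (h.equiv.symm (ψ y)).1,
    hLψ.continuousOn.isOpen_inter_preimage ψ.open_source φ.open_target,
    ⟨h.mem_codChart_source, ?_⟩, ?_, ?_⟩
  · rw [Set.mem_preimage, hkey x h.mem_domChart_source]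
    exact φ.map_source h.mem_domChart_source
  · exact hφ.comp (hLψ.mono Set.inter_subset_left) fun y hy => hy.2
  · filter_upwards [φ.open_source.mem_nhds h.mem_domChart_source] with z hz
    rw [hkey z hz, φ.left_inv hz]

/-- The model of the fibres of a submersion `X → M`. -/
abbrev FibreModel (X M : Mfd.{u} 𝕜) : Type := EuclideanSpace 𝕜 (Fin (X.dim - M.dim))

/-- The pair `(f, w)` is a diffeomorphism from the open set `U` onto the open set `V`, with inverse
`c`. -/
structure IsFibreCoord (f : X → M) (U : Set X) (w : X → FibreModel X M)
    (V : Set (M × FibreModel X M)) (c : M × FibreModel X M → X) : Prop where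
  isOpen_U : IsOpen U
  isOpen_V : IsOpen V
  smooth_w : ContMDiffOn X.I 𝓘(𝕜, FibreModel X M) ∞ w U
  smooth_c : ContMDiffOn (M.I.prod 𝓘(𝕜, FibreModel X M)) X.I ∞ c V
  mem_V : ∀ x ∈ U, (f x, w x) ∈ V
  c_eq : ∀ x ∈ U, c (f x, w x) = x
  mem_U : ∀ z ∈ V, c z ∈ U
  f_c : ∀ z ∈ V, f (c z) = z.1
  w_c : ∀ z ∈ V, w (c z) = z.2

/-- This is the local normal form of a submersion. The complement chosen at `x` is replaced by a
Euclidean space depending only on the dimensions, so that charts built at different points share one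
model. -/
theorem Submersion.exists_fibreCoord {f : X → M} (hf : Submersion f) (x : X) :
    ∃ U w V c, IsFibreCoord f U w V c ∧ x ∈ U := by
  have h₀ := (hf.isSubmersionAt x).isSubmersionAtOfComplement_complement
  have hfin : FiniteDimensional 𝕜 (hf.isSubmersionAt x).complement :=
    FiniteDimensional.of_surjective
      ((LinearMap.snd 𝕜 _ _) ∘ₗ h₀.equiv.toLinearEquiv.toLinearMap)
      (Prod.snd_surjective.comp h₀.equiv.surjective)
  have hfr : Module.finrank 𝕜 (hf.isSubmersionAt x).complement =
      Module.finrank 𝕜 (FibreModel X M) := by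
    have := h₀.equiv.toLinearEquiv.finrank_eq
    rw [Module.finrank_prod] at this
    simp at this ⊢
    omega
  have h := h₀.trans_F (ContinuousLinearEquiv.ofFinrankEq hfr)
  set φ := h.domChart
  set ψ := h.codChart
  have h1 := h.writtenInCharts
  have hφ : ContMDiffOn X.I X.I ∞ φ φ.source :=
    contMDiffOn_of_mem_maximalAtlas h.domChart_mem_maximalAtlas
  have hφ' : ContMDiffOn X.I X.I ∞ φ.symm φ.target :=
    contMDiffOn_symm_of_mem_maximalAtlas h.domChart_mem_maximalAtlas
  have hψ : ContMDiffOn M.I M.I ∞ ψ ψ.source :=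
    contMDiffOn_of_mem_maximalAtlas h.codChart_mem_maximalAtlas
  have hL : ContMDiff X.I 𝓘(𝕜, FibreModel X M) ∞ fun y => (h.equiv y).2 :=
    ((ContinuousLinearMap.snd 𝕜 _ _).contDiff.comp h.equiv.contDiff).contMDiff
  have hkey : ∀ y ∈ φ.target, ψ (f (φ.symm y)) = (h.equiv y).1 := fun y hy => by
    simpa using h1 (x := y) (by simpa using hy)
  have hkey' : ∀ z ∈ φ.source, ψ (f z) = (h.equiv (φ z)).1 := fun z hz => by
    have := hkey (φ z) (φ.map_source hz)
    rwa [φ.left_inv hz] at this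
  have hsub : ∀ z ∈ φ.source, f z ∈ ψ.source := h.source_subset_preimage_source
  have hj : ContMDiffOn (M.I.prod 𝓘(𝕜, FibreModel X M)) X.I ∞
      (fun z : M × FibreModel X M => h.equiv.symm (ψ z.1, z.2)) (ψ.source ×ˢ Set.univ) := by
    have h2 : ContMDiff 𝓘(𝕜, EuclideanSpace 𝕜 (Fin M.dim) × FibreModel X M) X.I ∞ h.equiv.symm :=
      h.equiv.symm.contDiff.contMDiff
    refine h2.comp_contMDiffOn ?_
    exact (hψ.comp contMDiff_fst.contMDiffOn fun z hz => hz.1).prodMk_space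
      contMDiff_snd.contMDiffOn
  refine ⟨φ.source, fun z => (h.equiv (φ z)).2,
    (ψ.source ×ˢ Set.univ) ∩ (fun z => h.equiv.symm (ψ z.1, z.2)) ⁻¹' φ.target,
    fun z => φ.symm (h.equiv.symm (ψ z.1, z.2)),
    ⟨φ.open_source, ?_, ?_, ?_, ?_, ?_, ?_, ?_, ?_⟩, h.mem_domChart_source⟩
  · exact hj.continuousOn.isOpen_inter_preimage (ψ.open_source.prod isOpen_univ) φ.open_target
  · exact hL.comp_contMDiffOn hφ
  · exact hφ'.comp (hj.mono Set.inter_subset_left) fun z hz => hz.2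
  · intro z hz
    refine ⟨⟨hsub z hz, trivial⟩, ?_⟩
    simp only [Set.mem_preimage, hkey' z hz, Prod.mk.eta, ContinuousLinearEquiv.symm_apply_apply]
    exact φ.map_source hz
  · intro z hz
    simp only [hkey' z hz, Prod.mk.eta, ContinuousLinearEquiv.symm_apply_apply]
    exact φ.left_inv hz
  · exact fun z hz => φ.map_target hz.2
  · intro z hz
    refine ψ.injOn (hsub _ (φ.map_target hz.2)) hz.1.1 ?_
    rw [hkey _ hz.2]
    simp
  · intro z hz
    simp only [φ.right_inv hz.2]
    simp

/-- Freeze the fibre coordinate at its value at `x`; the section then passes through `x`. -/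
theorem Submersion.exists_section {f : X → M} (hf : Submersion f) (x : X) :
    ∃ (V : Set M) (σ : M → X), IsOpen V ∧ f x ∈ V ∧ ContMDiffOn M.I X.I ∞ σ V ∧
      σ (f x) = x ∧ ∀ y ∈ V, f (σ y) = y := by
  obtain ⟨U, w, V, c, h, hx⟩ := hf.exists_fibreCoord x
  refine ⟨(fun m => (m, w x)) ⁻¹' V, fun m => c (m, w x), h.isOpen_V.preimage (by fun_prop),
    h.mem_V x hx, ?_, h.c_eq x hx, fun y hy => h.f_c _ hy⟩
  exact h.smooth_c.comp (contMDiffOn_id.prodMk contMDiffOn_const) fun y hy => hy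

/-- A fibre product along a submersion is locally a smooth retract of the product. -/
theorem isLocalSmoothRetract_fibreProduct_right {f : X → M} {g : Y → M} (hf : Smooth f)
    (hg : Submersion g) :
    IsLocalSmoothRetract (X.I.prod Y.I) {z : X × Y | f z.1 = g z.2} := by
  rintro ⟨a, b⟩ hz
  obtain ⟨U, w, V, c, h, hb⟩ := hg.exists_fibreCoord b
  have hj : ContMDiffOn (X.I.prod Y.I) (M.I.prod 𝓘(𝕜, FibreModel Y M)) ∞
      (fun z : X × Y => (f z.1, w z.2)) (Set.univ ×ˢ U) :=
    (hf.comp contMDiff_fst).contMDiffOn.prodMk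
      (h.smooth_w.comp contMDiff_snd.contMDiffOn fun z hz => hz.2)
  -- The retraction keeps the first component and moves the second into the fibre over its image,
  -- with unchanged fibre coordinate.
  refine ⟨(Set.univ ×ˢ U) ∩ (fun z : X × Y => (f z.1, w z.2)) ⁻¹' V,
    fun z => (z.1, c (f z.1, w z.2)),
    hj.continuousOn.isOpen_inter_preimage (isOpen_univ.prod h.isOpen_U) h.isOpen_V,
    ⟨⟨trivial, hb⟩, ?_⟩, ?_, ?_, ?_⟩
  · have h1 : f a = g b := hz
    simpa only [Set.mem_preimage, h1] using h.mem_V b hb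
  · exact contMDiff_fst.contMDiffOn.prodMk
      (h.smooth_c.comp (hj.mono Set.inter_subset_left) fun z hz => hz.2)
  · exact fun z hz => (h.f_c _ hz.2).symm
  · rintro ⟨x, y⟩ ⟨⟨⟨-, hy⟩, -⟩, hxy⟩
    have h1 : f x = g y := hxy
    simp only [h1, h.c_eq y hy]

theorem isLocalSmoothRetract_fibreProduct_left {f : X → M} {g : Y → M} (hf : Submersion f)
    (hg : Smooth g) :
    IsLocalSmoothRetract (X.I.prod Y.I) {z : X × Y | f z.1 = g z.2} := by
  rintro ⟨a, b⟩ hz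
  obtain ⟨O, R, hO, hzO, hR, hRS, hRid⟩ :=
    isLocalSmoothRetract_fibreProduct_right hg hf (b, a) (Eq.symm hz)
  have hsw : ContMDiff (X.I.prod Y.I) (Y.I.prod X.I) ∞ (Prod.swap : X × Y → Y × X) :=
    contMDiff_snd.prodMk contMDiff_fst
  have hsw' : ContMDiff (Y.I.prod X.I) (X.I.prod Y.I) ∞ (Prod.swap : Y × X → X × Y) :=
    contMDiff_snd.prodMk contMDiff_fst
  refine ⟨Prod.swap ⁻¹' O, fun z => (R z.swap).swap, hO.preimage continuous_swap, hzO,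
    hsw'.comp_contMDiffOn (hR.comp hsw.contMDiffOn fun z hz => hz), ?_, ?_⟩
  · exact fun z hz => Eq.symm (hRS (x := z.swap) hz)
  · intro z hz
    change (R z.swap).swap = z
    rw [hRid z.swap ⟨hz.1, Eq.symm hz.2⟩, Prod.swap_swap]

/-- Precomposing with a local retraction onto `S` extends the map to an open set. With the converse
below, smoothness by local extension and `ContMDiffOn` become interchangeable on fibre products. -/
theorem smoothOnSubset_of_contMDiffOn {S : Set (X × Y)} (hS : IsLocalSmoothRetract (X.I.prod Y.I) S)
    {f : S → Z} {g : X × Y → Z} (hg : ContMDiffOn (X.I.prod Y.I) Z.I ∞ g S)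
    (hgf : ∀ z : S, g z = f z) : SmoothOnSubset S f := by
  intro z
  obtain ⟨O, R, hO, hzO, hR, hRS, hRid⟩ := hS z z.2
  exact ⟨O, hO, hzO, g ∘ R, hg.comp hR hRS, fun w hw => by
    rw [Function.comp_apply, hRid w ⟨hw, w.2⟩, hgf]⟩

theorem SmoothOnSubset.contMDiffOn {S : Set (X × Y)} {f : S → Z} (hf : SmoothOnSubset S f)
    {g : X × Y → Z} (hgf : ∀ z : S, g z = f z) : ContMDiffOn (X.I.prod Y.I) Z.I ∞ g S := by
  intro z hz
  obtain ⟨U, hU, hzU, G, hG, hGf⟩ := hf ⟨z, hz⟩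
  have h1 : ContMDiffWithinAt (X.I.prod Y.I) Z.I ∞ G S z :=
    (hG.contMDiffAt (hU.mem_nhds hzU)).contMDiffWithinAt
  refine h1.congr_of_eventuallyEq ?_ ?_
  · filter_upwards [self_mem_nhdsWithin, mem_nhdsWithin_of_mem_nhds (hU.mem_nhds hzU)] with y hy hyU
    rw [hgf ⟨y, hy⟩, hGf ⟨y, hy⟩ hyU]
  · rw [hgf ⟨z, hz⟩, hGf ⟨z, hz⟩ hzU]

end Mfd

/-! ### Algebra of actions and continuity of division -/

section TotalMaps

variable {𝕜 : Type} [RCLike 𝕜]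

open Classical in
/-- The product of a groupoid, extended by a junk value to a total map. -/
noncomputable def LieGroupoid.m (G : LieGroupoid.{u} 𝕜) (z : G.Arr × G.Arr) : G.Arr :=
  if h : G.t z.1 = G.s z.2 then G.mul z.1 z.2 h else z.1

namespace LieGroupoid

variable (G : LieGroupoid.{u} 𝕜) {g h k : G.Arr}

theorem m_eq (e : G.t g = G.s h) : G.m (g, h) = G.mul g h e := dif_pos e

theorem s_m (e : G.t g = G.s h) : G.s (G.m (g, h)) = G.s g := by rw [G.m_eq e, G.s_mul]

theorem t_m (e : G.t g = G.s h) : G.t (G.m (g, h)) = G.t h := by rw [G.m_eq e, G.t_mul]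

theorem m_assoc (e : G.t g = G.s h) (e' : G.t h = G.s k) :
    G.m (G.m (g, h), k) = G.m (g, G.m (h, k)) := by
  rw [G.m_eq ((G.t_m e).trans e'), G.m_eq (e.trans (G.s_m e').symm)]
  simp only [G.m_eq e, G.m_eq e']
  exact G.mul_assoc _ _ _ e e'

theorem m_inv (g : G.Arr) : G.m (g, G.inv g) = G.unit (G.s g) := by
  rw [G.m_eq (G.s_inv g).symm, G.mul_inv]

theorem inv_m (g : G.Arr) : G.m (G.inv g, g) = G.unit (G.t g) := by
  rw [G.m_eq (G.t_inv g), G.inv_mul]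

theorem unit_m {x : G.Obj} (e : x = G.s g) : G.m (G.unit x, g) = g := by
  subst e
  rw [G.m_eq (G.t_unit _), G.unit_mul]

theorem m_unit {x : G.Obj} (e : G.t g = x) : G.m (g, G.unit x) = g := by
  subst e
  rw [G.m_eq (G.s_unit _).symm, G.mul_unit]

theorem m_right_cancel {g' : G.Arr} (e : G.t g = G.s h) (e' : G.t g' = G.s h)
    (heq : G.m (g, h) = G.m (g', h)) : g = g' := by
  have h1 : G.m (G.m (g, h), G.inv h) = g := by
    rw [G.m_assoc e (G.s_inv h).symm, G.m_inv, G.m_unit e]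
  rw [← h1, heq, G.m_assoc e' (G.s_inv h).symm, G.m_inv, G.m_unit e']

theorem m_left_cancel {h' : G.Arr} (e : G.t g = G.s h) (e' : G.t g = G.s h')
    (heq : G.m (g, h) = G.m (g, h')) : h = h' := by
  have h1 : G.m (G.inv g, G.m (g, h)) = h := by
    rw [← G.m_assoc (G.t_inv g) e, G.inv_m, G.unit_m e]
  rw [← h1, heq, ← G.m_assoc (G.t_inv g) e', G.inv_m, G.unit_m e']

theorem contMDiffOn_m :
    ContMDiffOn (G.Arr.I.prod G.Arr.I) G.Arr.I ∞ G.m {z | G.t z.1 = G.s z.2} :=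
  G.smooth_mul.contMDiffOn fun z => G.m_eq z.2

end LieGroupoid

namespace BimoduleData

variable {G H : LieGroupoid.{u} 𝕜} {X : Type u} (B : BimoduleData G H X)

open Classical in
/-- The left action, extended by a junk value to a total map. -/
noncomputable def l (z : G.Arr × X) : X :=
  if h : G.t z.1 = B.p z.2 then B.lact z.1 z.2 h else z.2

open Classical in
/-- The right action, extended by a junk value to a total map. -/
noncomputable def r (z : X × H.Arr) : X :=
  if h : B.p' z.1 = H.s z.2 then B.ract z.1 z.2 h else z.1

open Classical in
/-- The left division: the arrow `g` with `g · z.2 = z.1`. -/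
noncomputable def dl (z : X × X) : G.Arr :=
  if h : ∃ g, G.t g = B.p z.2 ∧ B.l (g, z.2) = z.1 then h.choose else G.unit (B.p z.2)

open Classical in
/-- The right division: the arrow `h` with `z.1 · h = z.2`. -/
noncomputable def dr (z : X × X) : H.Arr :=
  if h : ∃ k, B.p' z.1 = H.s k ∧ B.r (z.1, k) = z.2 then h.choose else H.unit (B.p' z.1)

variable {B}

theorem l_eq {g : G.Arr} {x : X} (e : G.t g = B.p x) : B.l (g, x) = B.lact g x e := dif_pos e

theorem r_eq {x : X} {h : H.Arr} (e : B.p' x = H.s h) : B.r (x, h) = B.ract x h e := dif_pos e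

end BimoduleData

/-- A proper injective map is a closed embedding, so continuity can be tested after composing with
it. -/
theorem IsProperMap.continuous_of_comp {S T P : Type*} [TopologicalSpace S] [TopologicalSpace T]
    [TopologicalSpace P] {Φ : S → T} (hΦ : IsProperMap Φ) (hi : Function.Injective Φ) {ψ : P → S}
    (h : Continuous (Φ ∘ ψ)) : Continuous ψ :=
  (IsClosedEmbedding.of_continuous_injective_isClosedMap hΦ.continuous hi
    hΦ.isClosedMap).isInducing.continuous_iff.2 h

namespace IsBimodule

variable {G H : LieGroupoid.{u} 𝕜} {X : Mfd.{u} 𝕜} {B : BimoduleData G H X}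
  (hB : IsBimodule G H X B) {g g' : G.Arr} {h h' : H.Arr} {x y : X}

include hB

theorem p_l (e : G.t g = B.p x) : B.p (B.l (g, x)) = G.s g := by
  rw [BimoduleData.l_eq e, hB.p_lact]

theorem p'_l (e : G.t g = B.p x) : B.p' (B.l (g, x)) = B.p' x := by
  rw [BimoduleData.l_eq e, hB.p'_lact]

theorem p_r (e : B.p' x = H.s h) : B.p (B.r (x, h)) = B.p x := by
  rw [BimoduleData.r_eq e, hB.p_ract]

theorem p'_r (e : B.p' x = H.s h) : B.p' (B.r (x, h)) = H.t h := by
  rw [BimoduleData.r_eq e, hB.p'_ract]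

theorem l_unit {m : G.Obj} (e : m = B.p x) : B.l (G.unit m, x) = x := by
  subst e
  rw [BimoduleData.l_eq (G.t_unit _), hB.unit_lact]

theorem r_unit {m : H.Obj} (e : B.p' x = m) : B.r (x, H.unit m) = x := by
  subst e
  rw [BimoduleData.r_eq (H.s_unit _).symm, hB.ract_unit]

theorem l_l (e : G.t g = G.s g') (e' : G.t g' = B.p x) :
    B.l (g, B.l (g', x)) = B.l (G.m (g, g'), x) := by
  rw [BimoduleData.l_eq (e.trans (hB.p_l e').symm), BimoduleData.l_eq ((G.t_m e).trans e')]
  simp only [BimoduleData.l_eq e', G.m_eq e]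
  exact (hB.mul_lact _ _ _ e e').symm

theorem r_r (e : B.p' x = H.s h) (e' : H.t h = H.s h') :
    B.r (B.r (x, h), h') = B.r (x, H.m (h, h')) := by
  rw [BimoduleData.r_eq ((hB.p'_r e).trans e'), BimoduleData.r_eq (e.trans (H.s_m e').symm)]
  simp only [BimoduleData.r_eq e, H.m_eq e']
  exact (hB.ract_mul _ _ _ e e').symm

theorem contMDiffOn_l : ContMDiffOn (G.Arr.I.prod X.I) X.I ∞ B.l {z | G.t z.1 = B.p z.2} :=
  hB.smooth_lact.contMDiffOn fun z => BimoduleData.l_eq z.2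

theorem contMDiffOn_r : ContMDiffOn (X.I.prod H.Arr.I) X.I ∞ B.r {z | B.p' z.1 = H.s z.2} :=
  hB.smooth_ract.contMDiffOn fun z => BimoduleData.r_eq z.2

theorem l_inv_l (e : G.t g = B.p x) : B.l (G.inv g, B.l (g, x)) = x := by
  rw [hB.l_l (G.t_inv g) e, G.inv_m, hB.l_unit e]

theorem r_r_inv (e : B.p' x = H.s h) : B.r (B.r (x, h), H.inv h) = x := by
  rw [hB.r_r e (H.s_inv h).symm, H.m_inv, hB.r_unit e]

end IsBimodule

namespace IsMoritaEquivalence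

variable {G H : LieGroupoid.{u} 𝕜} {X : Mfd.{u} 𝕜} {B : BimoduleData G H X}
  (hB : IsMoritaEquivalence G H X B) {g g' : G.Arr} {h h' : H.Arr} {x y z : X}

include hB

/-- The arrow g'⁻¹ g fixes `x`, so freeness makes it a unit. -/
theorem l_cancel (e : G.t g = B.p x) (e' : G.t g' = B.p x) (heq : B.l (g, x) = B.l (g', x)) :
    g = g' := by
  have hs : G.s g = G.s g' := by rw [← hB.p_l e, heq, hB.p_l e']
  have e1 : G.t (G.inv g') = G.s g := (G.t_inv g').trans hs.symm
  have h1 : B.l (G.m (G.inv g', g), x) = x := by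
    rw [← hB.l_l e1 e, heq, hB.l_inv_l e']
  have e2 : G.t (G.m (G.inv g', g)) = B.p x := (G.t_m e1).trans e
  rw [BimoduleData.l_eq e2] at h1
  have h2 := hB.free_left _ _ _ h1
  refine G.m_left_cancel e1 (G.t_inv g') ?_
  rw [h2, G.inv_m, e']

theorem r_cancel (e : B.p' x = H.s h) (e' : B.p' x = H.s h') (heq : B.r (x, h) = B.r (x, h')) :
    h = h' := by
  have ht : H.t h = H.t h' := by rw [← hB.p'_r e, heq, hB.p'_r e']
  have e1 : H.t h = H.s (H.inv h') := ht.trans (H.s_inv h').symm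
  have h1 : B.r (x, H.m (h, H.inv h')) = x := by
    rw [← hB.r_r e e1, heq, hB.r_r_inv e']
  have e2 : B.p' x = H.s (H.m (h, H.inv h')) := e.trans (H.s_m e1).symm
  rw [BimoduleData.r_eq e2] at h1
  have h2 := hB.free_right _ _ _ h1
  refine H.m_right_cancel e1 (H.s_inv h').symm ?_
  rw [h2, H.m_inv, e']

theorem dl_spec (e : B.p' x = B.p' y) : G.t (B.dl (x, y)) = B.p y ∧ B.l (B.dl (x, y), y) = x := by
  obtain ⟨g, hg, hgy⟩ := hB.transitive_left y x e.symm
  have hex : ∃ g, G.t g = B.p y ∧ B.l (g, y) = x := ⟨g, hg, by rw [BimoduleData.l_eq hg, hgy]⟩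
  have : B.dl (x, y) = hex.choose := dif_pos hex
  rw [this]
  exact hex.choose_spec

theorem t_dl (e : B.p' x = B.p' y) : G.t (B.dl (x, y)) = B.p y := (hB.dl_spec e).1

theorem l_dl (e : B.p' x = B.p' y) : B.l (B.dl (x, y), y) = x := (hB.dl_spec e).2

theorem s_dl (e : B.p' x = B.p' y) : G.s (B.dl (x, y)) = B.p x := by
  rw [← hB.p_l (hB.t_dl e), hB.l_dl e]

theorem dr_spec (e : B.p x = B.p y) : B.p' x = H.s (B.dr (x, y)) ∧ B.r (x, B.dr (x, y)) = y := by
  obtain ⟨h, hh, hxy⟩ := hB.transitive_right x y e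
  have hex : ∃ k, B.p' x = H.s k ∧ B.r (x, k) = y := ⟨h, hh, by rw [BimoduleData.r_eq hh, hxy]⟩
  have : B.dr (x, y) = hex.choose := dif_pos hex
  rw [this]
  exact hex.choose_spec

theorem s_dr (e : B.p x = B.p y) : B.p' x = H.s (B.dr (x, y)) := (hB.dr_spec e).1

theorem r_dr (e : B.p x = B.p y) : B.r (x, B.dr (x, y)) = y := (hB.dr_spec e).2

theorem t_dr (e : B.p x = B.p y) : H.t (B.dr (x, y)) = B.p' y := by
  rw [← hB.p'_r (hB.s_dr e), hB.r_dr e]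

theorem dr_r (e : B.p' x = H.s h) : B.dr (x, B.r (x, h)) = h :=
  hB.r_cancel (hB.s_dr (hB.p_r e).symm) e (hB.r_dr (hB.p_r e).symm)

theorem dr_self : B.dr (x, x) = H.unit (B.p' x) := by
  have := hB.dr_r (x := x) (H.s_unit _).symm
  rwa [hB.r_unit rfl] at this

/-- Both arrows carry `x` to `z`, and freeness leaves only one such arrow. This cocycle rule drives
both the smoothness of division and the analysis of the diagonal action. -/
theorem m_dr (e : B.p x = B.p y) (e' : B.p y = B.p z) :
    H.m (B.dr (x, y), B.dr (y, z)) = B.dr (x, z) := by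
  have e1 : H.t (B.dr (x, y)) = H.s (B.dr (y, z)) := (hB.t_dr e).trans (hB.s_dr e')
  have e2 : B.p' x = H.s (H.m (B.dr (x, y), B.dr (y, z))) := by rw [H.s_m e1, hB.s_dr e]
  rw [← hB.dr_r e2, ← hB.r_r (hB.s_dr e) e1, hB.r_dr e, hB.r_dr e']

theorem inv_dr (e : B.p x = B.p y) : H.inv (B.dr (x, y)) = B.dr (y, x) := by
  have e1 : B.p' y = H.s (H.inv (B.dr (x, y))) := by rw [H.s_inv, hB.t_dr e]
  have h1 := hB.dr_r e1
  have h2 := hB.r_r_inv (hB.s_dr e)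
  rw [hB.r_dr e] at h2
  rw [← h1, h2]

/-- The action map (g, x) ↦ (g · x, x) is proper, and injective by freeness; composed with (x, y) ↦
(dl (x, y), y) it gives the inclusion of the fibre product. -/
theorem continuousOn_dl : ContinuousOn B.dl {z : X × X | B.p' z.1 = B.p' z.2} := by
  rw [continuousOn_iff_continuous_domRestrict]
  have hinj : Function.Injective (fun z : {z : G.Arr × X // G.t z.1 = B.p z.2} =>
      (B.lact z.1.1 z.1.2 z.2, z.1.2)) := by
    rintro ⟨⟨g, x⟩, e⟩ ⟨⟨g', x'⟩, e'⟩ heq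
    obtain rfl : x = x' := congrArg Prod.snd heq
    have h1 : B.lact g x e = B.lact g' x e' := congrArg Prod.fst heq
    rw [← BimoduleData.l_eq, ← BimoduleData.l_eq] at h1
    obtain rfl := hB.l_cancel e e' h1
    rfl
  have := hB.proper_left.continuous_of_comp hinj
    (ψ := fun z : {z : X × X | B.p' z.1 = B.p' z.2} => ⟨(B.dl z.1, z.1.2), hB.t_dl z.2⟩) (by
      refine continuous_subtype_val.congr ?_
      rintro ⟨⟨x, y⟩, e⟩
      refine Prod.ext ?_ rfl
      exact ((BimoduleData.l_eq _).symm.trans (hB.l_dl e)).symm)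
  exact continuous_fst.comp (continuous_subtype_val.comp this)

theorem continuousOn_dr : ContinuousOn B.dr {z : X × X | B.p z.1 = B.p z.2} := by
  rw [continuousOn_iff_continuous_domRestrict]
  have hinj : Function.Injective (fun z : {z : X × H.Arr // B.p' z.1 = H.s z.2} =>
      (z.1.1, B.ract z.1.1 z.1.2 z.2)) := by
    rintro ⟨⟨x, h⟩, e⟩ ⟨⟨x', h'⟩, e'⟩ heq
    obtain rfl : x = x' := congrArg Prod.fst heq
    have h1 : B.ract x h e = B.ract x h' e' := congrArg Prod.snd heq
    rw [← BimoduleData.r_eq, ← BimoduleData.r_eq] at h1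
    obtain rfl := hB.r_cancel e e' h1
    rfl
  have := hB.proper_right.continuous_of_comp hinj
    (ψ := fun z : {z : X × X | B.p z.1 = B.p z.2} => ⟨(z.1.1, B.dr z.1), hB.s_dr z.2⟩) (by
      refine continuous_subtype_val.congr ?_
      rintro ⟨⟨x, y⟩, e⟩
      refine Prod.ext rfl ?_
      exact ((BimoduleData.r_eq _).symm.trans (hB.r_dr e)).symm)
  exact continuous_snd.comp (continuous_subtype_val.comp this)

end IsMoritaEquivalence

end TotalMaps

/-! ### Smoothness of division -/

section Division

variable {𝕜 : Type} [RCLike 𝕜]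

/-- A family of maps into a manifold `X`, parametrised by a manifold `X'` and injective in the
variable of a vector space `F`, has arbitrarily close to any point `v₀` of `F` a point `v₁` such
that near `v₁` the variable in `F` is a smooth function of the parameter and of the value. -/
theorem exists_smooth_solution {X X' : Mfd.{u} 𝕜} {F : Type}
    [NormedAddCommGroup F] [NormedSpace 𝕜 F] [FiniteDimensional 𝕜 F]
    {A : X' × F → X} {Ω : Set (X' × F)}
    (hΩ : IsOpen Ω)
    (hA : ContMDiffOn (X'.I.prod 𝓘(𝕜, F)) X.I ∞ A Ω) {x₀ : X'}
    {v₀ : F} (hv₀ : (x₀, v₀) ∈ Ω)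
    (hinj : ∀ v v', (x₀, v) ∈ Ω → (x₀, v') ∈ Ω → A (x₀, v) = A (x₀, v') → v = v')
    {O : Set X} (hO : IsOpen O) (hAO : A (x₀, v₀) ∈ O) :
    ∃ v₁, (x₀, v₁) ∈ Ω ∧ A (x₀, v₁) ∈ O ∧
      ∃ (W : Set (X' × X)) (V : X' × X → F), IsOpen W ∧
        (x₀, A (x₀, v₁)) ∈ W ∧ ContMDiffOn (X'.I.prod X.I) 𝓘(𝕜, F) ∞ V W ∧
        ∀ᶠ z in 𝓝 (x₀, v₁), V (z.1, A z) = z.2 := by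
  set φ := chartAt (EuclideanSpace 𝕜 (Fin X.dim)) (A (x₀, v₀))
  set φ₀ := chartAt (EuclideanSpace 𝕜 (Fin X'.dim)) x₀
  have hφ : ContMDiffOn X.I X.I ∞ φ φ.source := contMDiffOn_chart
  have hφ₀ : ContMDiffOn X'.I X'.I ∞ φ₀ φ₀.source := contMDiffOn_chart
  have hφ₀' : ContMDiffOn X'.I X'.I ∞ φ₀.symm φ₀.target := contMDiffOn_chart_symm
  have hx₀ : x₀ ∈ φ₀.source := mem_chart_source _ x₀
  -- the map in charts
  have hQ : IsOpen (Ω ∩ A ⁻¹' (O ∩ φ.source)) :=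
    hA.continuousOn.isOpen_inter_preimage hΩ (hO.inter φ.open_source)
  have hφA : ContMDiffOn (X'.I.prod 𝓘(𝕜, F)) X.I ∞ (φ ∘ A) (Ω ∩ A ⁻¹' (O ∩ φ.source)) :=
    hφ.comp (hA.mono Set.inter_subset_left) fun z hz => hz.2.2
  set Q := Ω ∩ A ⁻¹' (O ∩ φ.source)
  have hvQ : (x₀, v₀) ∈ Q := ⟨hv₀, hAO, mem_chart_source _ _⟩
  have hg₀ : ContDiffOn 𝕜 ∞ (fun v => φ (A (x₀, v))) ((fun v : F => (x₀, v)) ⁻¹' Q) := by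
    rw [← contMDiffOn_iff_contDiffOn]
    exact hφA.comp (contMDiffOn_const.prodMk contMDiffOn_id) fun v hv => hv
  -- Injectivity does not make the map immersive at `v₀` itself, only at some point of each
  -- neighbourhood; hence the move to `v₁`.
  obtain ⟨v₁, hv₁, hD₁⟩ := exists_injective_fderiv_of_injOn
    (hQ.preimage (by fun_prop : Continuous fun v : F => (x₀, v))) ⟨v₀, hvQ⟩
    (hg₀.of_le (by exact_mod_cast le_top)) (fun v hv v' hv' h =>
      hinj v v' hv.1 hv'.1 (φ.injOn hv.2.2 hv'.2.2 h))
  have hj : ContinuousOn (fun z : EuclideanSpace 𝕜 (Fin X'.dim) × F => (φ₀.symm z.1, z.2))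
      (φ₀.target ×ˢ Set.univ) :=
    (hφ₀'.continuousOn.comp continuousOn_fst fun z hz => hz.1).prodMk continuousOn_snd
  set P := (φ₀.target ×ˢ Set.univ) ∩
    (fun z : EuclideanSpace 𝕜 (Fin X'.dim) × F => (φ₀.symm z.1, z.2)) ⁻¹' Q
  have hP : IsOpen P := hj.isOpen_inter_preimage (φ₀.open_target.prod isOpen_univ) hQ
  have hvP : (φ₀ x₀, v₁) ∈ P :=
    ⟨⟨φ₀.map_source hx₀, trivial⟩, by simpa [φ₀.left_inv hx₀] using hv₁⟩
  -- With the parameter kept as first component the derivative is block triangular with an identity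
  -- block, so injectivity in the direction of `F` suffices, and a left inverse solves for the
  -- variable in `F`.
  have hg : ContDiffOn 𝕜 ∞ (fun z : EuclideanSpace 𝕜 (Fin X'.dim) × F =>
      (z.1, φ (A (φ₀.symm z.1, z.2)))) P := by
    refine contDiff_fst.contDiffOn.prodMk ?_
    rw [← contMDiffOn_iff_contDiffOn]
    exact hφA.comp (ContMDiffOn.prodMk
      (hφ₀'.comp contDiff_fst.contMDiff.contMDiffOn fun z hz => hz.1.1)
      contDiff_snd.contMDiff.contMDiffOn) fun z hz => hz.2
  have hd : HasFDerivAt (fun z : EuclideanSpace 𝕜 (Fin X'.dim) × F =>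
      (z.1, φ (A (φ₀.symm z.1, z.2)))) _ (φ₀ x₀, v₁) :=
    ((hg.contDiffAt (hP.mem_nhds hvP)).differentiableAt (by simp)).hasFDerivAt
  have hDinj : Function.Injective (fderiv 𝕜 (fun z : EuclideanSpace 𝕜 (Fin X'.dim) × F =>
      (z.1, φ (A (φ₀.symm z.1, z.2)))) (φ₀ x₀, v₁)) := by
    generalize fderiv 𝕜 (fun z : EuclideanSpace 𝕜 (Fin X'.dim) × F =>
      (z.1, φ (A (φ₀.symm z.1, z.2)))) (φ₀ x₀, v₁) = D at hd
    have h1 : ContinuousLinearMap.fst 𝕜 _ _ ∘L D = ContinuousLinearMap.fst 𝕜 _ _ :=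
      (hasFDerivAt_fst.comp _ hd).unique hasFDerivAt_fst
    have h2 : ContinuousLinearMap.snd 𝕜 _ _ ∘L D ∘L ContinuousLinearMap.inr 𝕜 _ F =
        fderiv 𝕜 (fun v => φ (A (x₀, v))) v₁ := by
      have h3 := hasFDerivAt_snd.comp v₁ (hd.comp v₁ (hasFDerivAt_prodMk_right (φ₀ x₀) v₁))
      rw [← h3.fderiv]
      simp [Function.comp_def, φ₀.left_inv hx₀]
    rw [injective_iff_map_eq_zero]
    rintro ⟨e, v⟩ h
    have h4 : e = 0 := by
      have := DFunLike.congr_fun h1 (e, v)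
      simpa [h] using this.symm
    subst h4
    have h5 : v = 0 := by
      refine (injective_iff_map_eq_zero _).1 hD₁ v ?_
      rw [← h2]
      simp [h]
    rw [h5]; rfl
  obtain ⟨W, ρ, hW, hxW, hρ, hρg⟩ := exists_contDiffOn_leftInverse hP hvP hg hDinj
  rw [φ₀.left_inv hx₀] at hxW
  have hφφ : ContMDiffOn (X'.I.prod X.I)
      𝓘(𝕜, EuclideanSpace 𝕜 (Fin X'.dim) × EuclideanSpace 𝕜 (Fin X.dim)) ∞
      (fun z : X' × X => (φ₀ z.1, φ z.2)) (φ₀.source ×ˢ φ.source) :=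
    (hφ₀.comp contMDiffOn_fst fun z hz => hz.1).prodMk_space
      (hφ.comp contMDiffOn_snd fun z hz => hz.2)
  have hρ2 := (contDiff_snd.comp_contDiffOn hρ).contMDiffOn
  refine ⟨v₁, hv₁.1, hv₁.2.1, (φ₀.source ×ˢ φ.source) ∩ (fun z => (φ₀ z.1, φ z.2)) ⁻¹' W,
    fun z => (ρ (φ₀ z.1, φ z.2)).2, ?_, ⟨⟨hx₀, hv₁.2.2⟩, hxW⟩, ?_, ?_⟩
  · exact hφφ.continuousOn.isOpen_inter_preimage (φ₀.open_source.prod φ.open_source) hW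
  · exact hρ2.comp (hφφ.mono Set.inter_subset_left) fun z hz => hz.2
  · have h1 : ContinuousAt (fun z : X' × F => (φ₀ z.1, z.2)) (x₀, v₁) :=
      ((φ₀.continuousAt hx₀).comp continuousAt_fst).prodMk continuousAt_snd
    have h2 : ∀ᶠ z : X' × F in 𝓝 (x₀, v₁), z.1 ∈ φ₀.source :=
      continuousAt_fst.preimage_mem_nhds (φ₀.open_source.mem_nhds hx₀)
    filter_upwards [h1.eventually hρg, h2] with z hz hz'
    rw [φ₀.left_inv hz'] at hz
    rw [hz]

namespace IsMoritaEquivalence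

variable {G H : LieGroupoid.{u} 𝕜} {X : Mfd.{u} 𝕜} {B : BimoduleData G H X}
  (hB : IsMoritaEquivalence G H X B)

include hB

/-- In fibre coordinates of the source map, x · h = y is an equation for the coordinate of `h`,
injective in it by freeness, so it is smoothly solvable near a point arbitrarily close to `y`. Thus
the points `y` at which division by `x` is smooth contain a dense open subset of the fibre. -/
theorem exists_contMDiffWithinAt_dr {x y : X} (e : B.p x = B.p y) {O : Set X} (hO : IsOpen O)
    (hy : y ∈ O) : ∃ y₁ ∈ O, B.p x = B.p y₁ ∧ ∀ᶠ y' in 𝓝 y₁, B.p x = B.p y' →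
      ContMDiffWithinAt (X.I.prod X.I) H.Arr.I ∞ B.dr {z | B.p z.1 = B.p z.2} (x, y') := by
  obtain ⟨U, w, V, c, hc, hU⟩ := H.submersion_s.exists_fibreCoord (B.dr (x, y))
  have hp' := hB.submersion_p'.contMDiff
  have hj : ContMDiff (X.I.prod 𝓘(𝕜, Mfd.FibreModel H.Arr H.Obj))
      (H.Obj.I.prod 𝓘(𝕜, Mfd.FibreModel H.Arr H.Obj)) ∞
      (fun z : X × Mfd.FibreModel H.Arr H.Obj => (B.p' z.1, z.2)) :=
    (hp'.comp contMDiff_fst).prodMk contMDiff_snd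
  have hΩ : IsOpen ((fun z : X × Mfd.FibreModel H.Arr H.Obj => (B.p' z.1, z.2)) ⁻¹' V) :=
    hc.isOpen_V.preimage hj.continuous
  have hcj : ContMDiffOn (X.I.prod 𝓘(𝕜, Mfd.FibreModel H.Arr H.Obj)) H.Arr.I ∞
      (fun z : X × Mfd.FibreModel H.Arr H.Obj => c (B.p' z.1, z.2))
      ((fun z : X × Mfd.FibreModel H.Arr H.Obj => (B.p' z.1, z.2)) ⁻¹' V) :=
    hc.smooth_c.comp hj.contMDiffOn fun z hz => hz
  have hA : ContMDiffOn (X.I.prod 𝓘(𝕜, Mfd.FibreModel H.Arr H.Obj)) X.I ∞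
      (fun z : X × Mfd.FibreModel H.Arr H.Obj => B.r (z.1, c (B.p' z.1, z.2)))
      ((fun z : X × Mfd.FibreModel H.Arr H.Obj => (B.p' z.1, z.2)) ⁻¹' V) :=
    hB.contMDiffOn_r.comp (contMDiffOn_fst.prodMk hcj) fun z hz => (hc.f_c _ hz).symm
  have hs := hB.s_dr e
  have h0 : (x, w (B.dr (x, y))) ∈
      (fun z : X × Mfd.FibreModel H.Arr H.Obj => (B.p' z.1, z.2)) ⁻¹' V := by
    simpa only [Set.mem_preimage, hs] using hc.mem_V _ hU
  have hA0 : B.r (x, c (B.p' x, w (B.dr (x, y)))) = y := by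
    rw [hs, hc.c_eq _ hU, hB.r_dr e]
  obtain ⟨v₁, hv₁, hO₁, W, Vs, hW, hxW, hVs, hVA⟩ := exists_smooth_solution hΩ hA h0
    (fun v v' hv hv' h => by
      have h1 := hB.r_cancel (hc.f_c _ hv).symm (hc.f_c _ hv').symm h
      have h2 := congrArg w h1
      rwa [hc.w_c _ hv, hc.w_c _ hv'] at h2) hO (by simpa only [hA0] using hy)
  set y₁ := B.r (x, c (B.p' x, v₁))
  have e₁ : B.p x = B.p y₁ := (hB.p_r (hc.f_c _ hv₁).symm).symm
  have hdr : B.dr (x, y₁) = c (B.p' x, v₁) := hB.dr_r (hc.f_c _ hv₁).symm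
  refine ⟨y₁, hO₁, e₁, ?_⟩
  have hcont := hB.continuousOn_dr (x, y₁) e₁
  -- near `(x, y₁)` the division is given by a smooth formula
  have hev : ∀ᶠ z in 𝓝[{z : X × X | B.p z.1 = B.p z.2}] (x, y₁),
      (B.p' z.1, Vs z) ∈ V ∧ z ∈ W ∧ B.dr z = c (B.p' z.1, Vs z) := by
    -- Continuity of division, hence properness, enters here: it keeps the dividing arrow inside the
    -- coordinate domain `U`, where the local solution applies.
    have hUn : ∀ᶠ z in 𝓝[{z : X × X | B.p z.1 = B.p z.2}] (x, y₁), B.dr z ∈ U := by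
      refine hcont.preimage_mem_nhdsWithin (hc.isOpen_U.mem_nhds ?_)
      rw [hdr]
      exact hc.mem_U _ hv₁
    have hwc : ContinuousWithinAt (fun z => (z.1, w (B.dr z))) {z : X × X | B.p z.1 = B.p z.2}
        (x, y₁) := by
      refine continuousWithinAt_fst.prodMk (ContinuousAt.comp_continuousWithinAt ?_ hcont)
      refine hc.smooth_w.continuousOn.continuousAt (hc.isOpen_U.mem_nhds ?_)
      rw [hdr]
      exact hc.mem_U _ hv₁
    have hw1 : w (B.dr (x, y₁)) = v₁ := by rw [hdr, hc.w_c _ hv₁]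
    have hev1 := hwc.tendsto.eventually (by simpa only [hw1] using hVA)
    filter_upwards [hUn, hev1, self_mem_nhdsWithin,
      mem_nhdsWithin_of_mem_nhds (hW.mem_nhds hxW)] with z hzU hz1 hzP hzW
    have hs' := hB.s_dr (x := z.1) (y := z.2) hzP
    have h3 : c (B.p' z.1, w (B.dr z)) = B.dr z := by rw [hs', hc.c_eq _ hzU]
    have h5 : Vs z = w (B.dr z) := by
      rw [← hz1]
      simp only [h3, hB.r_dr (x := z.1) (y := z.2) hzP]
    rw [h5, h3]
    exact ⟨by rw [hs']; exact hc.mem_V _ hzU, hzW, rfl⟩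
  -- The formula persists near every (x, y') with y' close to `y₁` in the fibre. This openness in y'
  -- allows a second point to be accommodated later.
  have hev' := eventually_eventually_nhdsWithin.2 hev
  have hmap : Filter.Tendsto (fun y' => (x, y')) (𝓝[{y' | B.p x = B.p y'}] y₁)
      (𝓝[{z : X × X | B.p z.1 = B.p z.2}] (x, y₁)) :=
    tendsto_nhdsWithin_iff.2 ⟨(Continuous.tendsto (by fun_prop) y₁).mono_left nhdsWithin_le_nhds,
      eventually_mem_nhdsWithin⟩
  refine eventually_nhdsWithin_iff.1 ?_
  filter_upwards [hmap.eventually hev', self_mem_nhdsWithin] with y' hy' he'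
  have hself := hy'.self_of_nhdsWithin he'
  refine ContMDiffWithinAt.congr_of_eventuallyEq (f := fun z => c (B.p' z.1, Vs z)) ?_
    (hy'.mono fun z hz => hz.2.2) hself.2.2
  have hVs' := (hp'.comp (contMDiff_fst (I := X.I) (J := X.I))).contMDiffAt.prodMk
    (hVs.contMDiffAt (hW.mem_nhds hself.2.1))
  have hc' := hc.smooth_c.contMDiffAt (hc.isOpen_V.mem_nhds hself.1)
  exact (hc'.comp (x, y') hVs').contMDiffWithinAt

/-- The division map of a Morita equivalence is smooth. -/
theorem contMDiffOn_dr :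
    ContMDiffOn (X.I.prod X.I) H.Arr.I ∞ B.dr {z | B.p z.1 = B.p z.2} := by
  rintro ⟨x, z⟩ e
  obtain ⟨y₁, -, e₁, h₁⟩ := hB.exists_contMDiffWithinAt_dr (x := x) rfl isOpen_univ trivial
  obtain ⟨O, hOs, hO, hyO⟩ := eventually_nhds_iff.1 h₁
  have e' : B.p z = B.p x := Eq.symm e
  -- The open set `O` consists of points good for `x` within the fibre; density for `z` gives a
  -- point of `O` good for both.
  obtain ⟨y, hyO', e₂, h₂⟩ := hB.exists_contMDiffWithinAt_dr (e'.trans e₁) hO hyO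
  have hxy := hOs y hyO' (e'.symm.trans e₂)
  have hzy := h₂.self_of_nhds e₂
  -- The auxiliary point must move with the base, so `y` is extended to a section σ; near (x, z),
  -- division is dr(w₁, σ) · dr(w₂, σ)⁻¹ with σ evaluated at p w₁.
  obtain ⟨V, σ, hV, hyV, hσ, hσy, hpσ⟩ := hB.submersion_p.exists_section y
  have hV' : IsOpen {w : X × X | B.p w.1 ∈ V} :=
    hV.preimage (hB.submersion_p.contMDiff.continuous.comp continuous_fst)
  have hxV : B.p x ∈ V := by rw [← e', e₂]; exact hyV
  have hσx : σ (B.p x) = y := by rw [← e', e₂, hσy]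
  have hσ' : ContMDiffWithinAt (X.I.prod X.I) X.I ∞ (fun w : X × X => σ (B.p w.1))
      ({w | B.p w.1 = B.p w.2} ∩ {w | B.p w.1 ∈ V}) (x, z) :=
    ((hσ.contMDiffAt (hV.mem_nhds hxV)).comp (x, z)
      (hB.submersion_p.contMDiff.comp contMDiff_fst).contMDiffAt).contMDiffWithinAt
  have h3 : ContMDiffWithinAt (X.I.prod X.I) H.Arr.I ∞ (fun w : X × X => B.dr (w.1, σ (B.p w.1)))
      ({w | B.p w.1 = B.p w.2} ∩ {w | B.p w.1 ∈ V}) (x, z) := by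
    rw [← hσx] at hxy
    exact ContMDiffWithinAt.comp (x, z) (g := B.dr) hxy (contMDiffWithinAt_fst.prodMk hσ')
      fun w hw => (hpσ _ hw.2).symm
  have h4 : ContMDiffWithinAt (X.I.prod X.I) H.Arr.I ∞
      (fun w : X × X => H.inv (B.dr (w.2, σ (B.p w.1))))
      ({w | B.p w.1 = B.p w.2} ∩ {w | B.p w.1 ∈ V}) (x, z) := by
    rw [← hσx] at hzy
    exact H.smooth_inv.contMDiffAt.comp_contMDiffWithinAt _
      (ContMDiffWithinAt.comp (x, z) (g := B.dr) hzy (contMDiffWithinAt_snd.prodMk hσ')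
      fun w hw => hw.1.symm.trans (hpσ _ hw.2).symm)
  have key : ∀ w : X × X, B.p w.1 = B.p w.2 → B.p w.1 ∈ V → H.t (B.dr (w.1, σ (B.p w.1))) =
      H.s (H.inv (B.dr (w.2, σ (B.p w.1)))) ∧ B.dr w =
      H.m (B.dr (w.1, σ (B.p w.1)), H.inv (B.dr (w.2, σ (B.p w.1)))) := by
    intro w hw hwV
    have e3 : B.p w.1 = B.p (σ (B.p w.1)) := (hpσ _ hwV).symm
    have e4 : B.p w.2 = B.p (σ (B.p w.1)) := hw.symm.trans e3
    exact ⟨by rw [H.s_inv, hB.t_dr e3, hB.t_dr e4],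
      by rw [hB.inv_dr e4, hB.m_dr e3 e4.symm]⟩
  have h5 : ContMDiffWithinAt (X.I.prod X.I) H.Arr.I ∞
      (fun w : X × X => H.m (B.dr (w.1, σ (B.p w.1)), H.inv (B.dr (w.2, σ (B.p w.1)))))
      ({w | B.p w.1 = B.p w.2} ∩ {w | B.p w.1 ∈ V}) (x, z) :=
    ContMDiffWithinAt.comp (x, z) (g := H.m) (H.contMDiffOn_m _ (key (x, z) e hxV).1)
      (h3.prodMk h4) fun w hw => (key w hw.1 hw.2).1
  refine (h5.congr (fun w hw => (key w hw.1 hw.2).2) (key (x, z) e hxV).2).mono_of_mem_nhdsWithin ?_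
  exact Filter.inter_mem self_mem_nhdsWithin (mem_nhdsWithin_of_mem_nhds (hV'.mem_nhds hxV))

end IsMoritaEquivalence

end Division

/-! ### Manifold structures on quotients from slices -/

section Quotients

variable {𝕜 : Type} [RCLike 𝕜]
  {E : Type*} [NormedAddCommGroup E] [NormedSpace 𝕜 E] {H : Type*} [TopologicalSpace H]
  (J : ModelWithCorners 𝕜 E H) {N : Type*} [TopologicalSpace N] [ChartedSpace H N]

/-- A smooth local slice `ℓ` for a map `π` defined on a subset `S` of a manifold: `π ∘ ℓ`
parametrises `π(D)` bijectively, and the parameter of `π s` is a smooth function `G` of `s`. -/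
structure IsSlice {Q : Type u} (π : N → Q) (S : Set N) {n : ℕ}
    (T : Set (EuclideanSpace 𝕜 (Fin n))) (ℓ : EuclideanSpace 𝕜 (Fin n) → N) (D : Set N)
    (G : N → EuclideanSpace 𝕜 (Fin n)) : Prop where
  isOpen_T : IsOpen T
  smooth_ℓ : ContMDiffOn 𝓘(𝕜, EuclideanSpace 𝕜 (Fin n)) J ∞ ℓ T
  mem_D : ∀ t ∈ T, ℓ t ∈ D
  injOn : Set.InjOn (π ∘ ℓ) T
  exists_isOpen : ∃ O, IsOpen O ∧ D = S ∩ O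
  saturated : ∀ s ∈ S, ∀ d ∈ D, π s = π d → s ∈ D
  smooth_G : ContMDiffOn J 𝓘(𝕜, EuclideanSpace 𝕜 (Fin n)) ∞ G D
  mem_T : ∀ s ∈ D, G s ∈ T
  π_ℓ_G : ∀ s ∈ D, π (ℓ (G s)) = π s

namespace IsSlice

variable {J} {Q : Type u} {π : N → Q} {S : Set N} {n : ℕ}
  {T : Set (EuclideanSpace 𝕜 (Fin n))} {ℓ : EuclideanSpace 𝕜 (Fin n) → N} {D : Set N}
  {G : N → EuclideanSpace 𝕜 (Fin n)} (h : IsSlice J π S T ℓ D G)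

include h

theorem G_eq {s : N} (hs : s ∈ D) {t : EuclideanSpace 𝕜 (Fin n)} (ht : t ∈ T)
    (hst : π s = π (ℓ t)) : G s = t :=
  h.injOn (h.mem_T s hs) ht ((h.π_ℓ_G s hs).trans hst)

theorem subset : D ⊆ S := by
  obtain ⟨O, -, hO⟩ := h.exists_isOpen
  exact hO ▸ Set.inter_subset_left

theorem mem_nhdsWithin {s : N} (hs : s ∈ D) : D ∈ 𝓝[S] s := by
  obtain ⟨O, hO, hDO⟩ := h.exists_isOpen
  rw [hDO] at hs ⊢
  exact Filter.inter_mem self_mem_nhdsWithin (mem_nhdsWithin_of_mem_nhds (hO.mem_nhds hs.2))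

end IsSlice

open Classical in
/-- The chart defined by a slice. -/
noncomputable def IsSlice.chart {J : ModelWithCorners 𝕜 E H} {Q : Type u} [TopologicalSpace Q]
    {π : N → Q} {S : Set N} {n : ℕ}
    {T : Set (EuclideanSpace 𝕜 (Fin n))} {ℓ : EuclideanSpace 𝕜 (Fin n) → N} {D : Set N}
    {G : N → EuclideanSpace 𝕜 (Fin n)} (h : IsSlice J π S T ℓ D G) (hπ : ContinuousOn π S)
    (hopen : ∀ O, IsOpen O → IsOpen (π '' (S ∩ O))) :
    OpenPartialHomeomorph Q (EuclideanSpace 𝕜 (Fin n)) :=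
  -- The value of `G` depends only on the class, so evaluating it at a chosen representative in `D`
  -- is harmless.
  have key : ∀ s ∈ D, (if hq : π s ∈ π '' D then G hq.choose else 0) = G s := fun s hs => by
    have hq : π s ∈ π '' D := ⟨s, hs, rfl⟩
    rw [dif_pos hq]
    refine h.G_eq hq.choose_spec.1 (h.mem_T s hs) ?_
    rw [hq.choose_spec.2, h.π_ℓ_G s hs]
  have hsrc : IsOpen (π '' D) := by
    obtain ⟨O, hO, hDO⟩ := h.exists_isOpen
    exact hDO ▸ hopen O hO
  { toFun := fun q => if hq : q ∈ π '' D then G hq.choose else 0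
    invFun := π ∘ ℓ
    source := π '' D
    target := T
    map_source' := by
      rintro _ ⟨s, hs, rfl⟩
      rw [key s hs]
      exact h.mem_T s hs
    map_target' := fun t ht => ⟨ℓ t, h.mem_D t ht, rfl⟩
    left_inv' := by
      rintro _ ⟨s, hs, rfl⟩
      rw [key s hs]
      exact h.π_ℓ_G s hs
    right_inv' := fun t ht => by
      rw [Function.comp_apply, key _ (h.mem_D t ht)]
      exact h.G_eq (h.mem_D t ht) ht rfl
    open_source := hsrc
    open_target := h.isOpen_T
    continuousOn_toFun := by
      rw [continuousOn_open_iff hsrc]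
      intro V hV
      obtain ⟨O, hO, hDO⟩ := h.exists_isOpen
      obtain ⟨O', hO', hGO'⟩ := continuousOn_iff'.1 h.smooth_G.continuousOn V hV
      convert hopen (O ∩ O') (hO.inter hO') using 1
      rw [← Set.inter_assoc, ← hDO, Set.inter_comm D, ← hGO']
      ext q
      constructor
      · rintro ⟨⟨s, hs, rfl⟩, hq⟩
        rw [Set.mem_preimage, key s hs] at hq
        exact ⟨s, ⟨hq, hs⟩, rfl⟩
      · rintro ⟨s, ⟨hs1, hs2⟩, rfl⟩
        refine ⟨⟨s, hs2, rfl⟩, ?_⟩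
        rw [Set.mem_preimage, key s hs2]
        exact hs1
    continuousOn_invFun :=
      hπ.comp h.smooth_ℓ.continuousOn fun t ht => h.subset (h.mem_D t ht) }

theorem IsSlice.chart_apply {J : ModelWithCorners 𝕜 E H} {Q : Type u} [TopologicalSpace Q]
    {π : N → Q} {S : Set N} {n : ℕ}
    {T : Set (EuclideanSpace 𝕜 (Fin n))} {ℓ : EuclideanSpace 𝕜 (Fin n) → N} {D : Set N}
    {G : N → EuclideanSpace 𝕜 (Fin n)} (h : IsSlice J π S T ℓ D G) (hπ : ContinuousOn π S)
    (hopen : ∀ O, IsOpen O → IsOpen (π '' (S ∩ O))) {s : N} (hs : s ∈ D) :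
    h.chart hπ hopen (π s) = G s := by
  have h1 : π s ∈ (h.chart hπ hopen).source := ⟨s, hs, rfl⟩
  have h2 := (h.chart hπ hopen).left_inv h1
  exact (h.G_eq hs ((h.chart hπ hopen).map_source h1) h2.symm).symm

/-- The restriction to `S` of the map `π : N → Q` is smooth and onto, and has smooth local sections
through all points of `S`. -/
structure IsLocalQuotient {Q : Mfd.{u} 𝕜} (π : N → Q) (S : Set N) : Prop where
  smooth : ContMDiffOn J Q.I ∞ π S
  exists_lift : ∀ z ∈ S, ∃ (O : Set Q) (σ : Q → N), IsOpen O ∧ π z ∈ O ∧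
    ContMDiffOn Q.I J ∞ σ O ∧ (∀ q ∈ O, σ q ∈ S) ∧ (∀ q ∈ O, π (σ q) = q) ∧ σ (π z) = z
  surj : ∀ q, ∃ z ∈ S, π z = q

/-- The chart of a slice sends π s to `G s`, with inverse π ∘ ℓ. A transition from one slice to
another is therefore G' ∘ ℓ, a composite of smooth maps upstairs; saturation of the domains makes it
defined wherever the charts overlap. -/
theorem exists_smoothStructure_of_isSlice {Q : Type u} [TopologicalSpace Q] [T2Space Q]
    [SecondCountableTopology Q] {π : N → Q} {S : Set N} {n : ℕ} (hπ : ContinuousOn π S)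
    (hopen : ∀ O, IsOpen O → IsOpen (π '' (S ∩ O))) (hsurj : ∀ q, ∃ z ∈ S, π z = q)
    (hslice : ∀ z ∈ S, ∃ (T : Set (EuclideanSpace 𝕜 (Fin n)))
      (ℓ : EuclideanSpace 𝕜 (Fin n) → N) (D : Set N) (G : N → EuclideanSpace 𝕜 (Fin n)),
      IsSlice J π S T ℓ D G ∧ z ∈ ℓ '' T) :
    ∃ P : SmoothStructure 𝕜 Q, IsLocalQuotient J (Q := P.toMfd) π S := by
  choose T ℓ D G h hz using fun z : S => hslice z z.2
  choose lift hlift hlift' using hsurj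
  have hzD : ∀ z, (z : N) ∈ D z := fun z => by
    obtain ⟨t, ht, e⟩ := hz z
    exact e ▸ (h z).mem_D t ht
  let e : S → OpenPartialHomeomorph Q (EuclideanSpace 𝕜 (Fin n)) :=
    fun z => (h z).chart hπ hopen
  have he : ∀ z s, s ∈ D z → e z (π s) = G z s := fun z s hs => (h z).chart_apply hπ hopen hs
  have hsource : ∀ z s, s ∈ S → π s ∈ (e z).source → s ∈ D z := by
    rintro z s hs ⟨d, hd, hds⟩
    exact (h z).saturated s hs d hd hds.symm
  let cs : ChartedSpace (EuclideanSpace 𝕜 (Fin n)) Q :=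
    { atlas := Set.range e
      chartAt := fun q => e ⟨lift q, hlift q⟩
      mem_chart_source := fun q => ⟨lift q, hzD ⟨lift q, hlift q⟩, hlift' q⟩
      chart_mem_atlas := fun q => ⟨_, rfl⟩ }
  have hm : IsManifold 𝓘(𝕜, EuclideanSpace 𝕜 (Fin n)) ∞ Q := by
    refine isManifold_of_contDiffOn _ _ _ ?_
    rintro _ _ ⟨z, rfl⟩ ⟨z', rfl⟩
    rw [← contMDiffOn_iff_contDiffOn]
    have hmem : ∀ t ∈ ((e z).symm.trans (e z')).source, t ∈ T z ∧ ℓ z t ∈ D z' := by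
      intro t ht
      rw [OpenPartialHomeomorph.trans_source] at ht
      exact ⟨ht.1, hsource z' _ ((h z).subset ((h z).mem_D t ht.1)) ht.2⟩
    refine (ContMDiffOn.comp (h z').smooth_G ((h z).smooth_ℓ.mono fun t ht => (hmem t ht).1)
      fun t ht => (hmem t ht).2).congr (s := ((e z).symm.trans (e z')).source) ?_ |>.mono ?_
    · exact fun t ht => he z' _ (hmem t ht).2
    · intro t ht
      simpa using ht.1
  refine ⟨⟨n, cs, hm, inferInstance, inferInstance⟩, ?_, ?_, fun q => ⟨lift q, hlift q, hlift' q⟩⟩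
  · intro s hs
    set z : S := ⟨lift (π s), hlift (π s)⟩
    have hsD : s ∈ D z := (h z).saturated s hs z (hzD z) (hlift' (π s)).symm
    have hmax : e z ∈ IsManifold.maximalAtlas 𝓘(𝕜, EuclideanSpace 𝕜 (Fin n)) ∞ Q :=
      IsManifold.subset_maximalAtlas ⟨z, rfl⟩
    have h1 : ContMDiffOn J 𝓘(𝕜, EuclideanSpace 𝕜 (Fin n)) ∞ π (D z) :=
      ((contMDiffOn_symm_of_mem_maximalAtlas hmax).comp (h z).smooth_G (h z).mem_T).congr
        fun s hs => ((h z).π_ℓ_G s hs).symm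
    exact (h1 s hsD).mono_of_mem_nhdsWithin ((h z).mem_nhdsWithin hsD)
  · intro s hs
    set z : S := ⟨s, hs⟩
    have hmax : e z ∈ IsManifold.maximalAtlas 𝓘(𝕜, EuclideanSpace 𝕜 (Fin n)) ∞ Q :=
      IsManifold.subset_maximalAtlas ⟨z, rfl⟩
    -- The slice chosen at `s` contains `s` itself, so the resulting section passes through `s`, as
    -- the submersion criterion requires.
    refine ⟨(e z).source, ℓ z ∘ e z, (e z).open_source, ⟨s, hzD z, rfl⟩,
      (h z).smooth_ℓ.comp (contMDiffOn_of_mem_maximalAtlas hmax)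
        fun q hq => (e z).map_source hq,
      fun q hq => (h z).subset ((h z).mem_D _ ((e z).map_source hq)),
      fun q hq => (e z).left_inv hq, ?_⟩
    obtain ⟨t, ht, hts⟩ := hz z
    change ℓ z (e z (π s)) = s
    rw [he z s (hzD z), (h z).G_eq (hzD z) ht (by rw [hts]), hts]

end Quotients

/-! ### Slices of a fibre product from a normal form -/

section Slices

variable {𝕜 : Type} [RCLike 𝕜]

/-- Slices of a fibre product `X ×_M X'` from a smooth local section `σ` of a map `b : X → L` and a
normalisation `(x, x') ~ (σ (b x), ν (x, x'))`. -/
theorem exists_isSlice {X X' M L : Mfd.{u} 𝕜} {f : X → M} {g : X' → M} (hf : Mfd.Smooth f)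
    (hg : Mfd.Submersion g) {Q : Type u} {π : X × X' → Q} {b : X → L} (hb : Mfd.Smooth b)
    {V : Set L} (hV : IsOpen V) {σ : L → X} (hσ : ContMDiffOn L.I X.I ∞ σ V)
    (hbσ : ∀ y ∈ V, b (σ y) = y) {ν : X × X' → X'}
    (hν : ContMDiffOn (X.I.prod X'.I) X'.I ∞ ν ({z | f z.1 = g z.2} ∩ {z | b z.1 ∈ V}))
    (hgν : ∀ z : X × X', f z.1 = g z.2 → b z.1 ∈ V → f (σ (b z.1)) = g (ν z))
    (hπν : ∀ z : X × X', f z.1 = g z.2 → b z.1 ∈ V → π (σ (b z.1), ν z) = π z)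
    (hνσ : ∀ y x', y ∈ V → f (σ y) = g x' → ν (σ y, x') = x')
    (hπ : ∀ z w : X × X', f z.1 = g z.2 → f w.1 = g w.2 → b w.1 ∈ V → π z = π w →
      b z.1 = b w.1 ∧ ν z = ν w) {z₀ : X × X'} (hz₀ : f z₀.1 = g z₀.2) (hz₀V : b z₀.1 ∈ V)
    (hσz₀ : σ (b z₀.1) = z₀.1) :
    ∃ (T : Set (EuclideanSpace 𝕜 (Fin (L.dim + (X'.dim - M.dim)))))
      (ℓ : EuclideanSpace 𝕜 (Fin (L.dim + (X'.dim - M.dim))) → X × X') (D : Set (X × X'))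
      (G : X × X' → EuclideanSpace 𝕜 (Fin (L.dim + (X'.dim - M.dim)))),
      IsSlice (X.I.prod X'.I) π {z | f z.1 = g z.2} T ℓ D G ∧ z₀ ∈ ℓ '' T := by
  -- A parameter is a pair: the chart coordinate of a base point y in `L`, and the fibre coordinate
  -- of a point of `X'` over f (σ y). Since the normal form determines the class and is determined
  -- by it, these coordinates are faithful.
  set n := L.dim + (X'.dim - M.dim) with hn
  obtain ⟨θ⟩ : Nonempty (EuclideanSpace 𝕜 (Fin n) ≃L[𝕜]
    EuclideanSpace 𝕜 (Fin L.dim) × Mfd.FibreModel X' M) :=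
    FiniteDimensional.nonempty_continuousLinearEquiv_of_finrank_eq (by simp [hn])
  obtain ⟨U, w, Vc, c, hc, hU⟩ := hg.exists_fibreCoord z₀.2
  set φ := chartAt (EuclideanSpace 𝕜 (Fin L.dim)) (b z₀.1)
  have hφ : ContMDiffOn L.I L.I ∞ φ φ.source := contMDiffOn_chart
  have hφ' : ContMDiffOn L.I L.I ∞ φ.symm φ.target := contMDiffOn_chart_symm
  have hbφ : b z₀.1 ∈ φ.source := mem_chart_source _ _
  have hbX : ContMDiff (X.I.prod X'.I) L.I ∞ (fun z : X × X' => b z.1) := hb.comp contMDiff_fst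
  -- the base point and the fibre coordinate of a parameter
  have hθ1 : ContMDiff 𝓘(𝕜, EuclideanSpace 𝕜 (Fin n)) L.I ∞ (fun t => (θ t).1) :=
    (contDiff_fst.comp θ.contDiff).contMDiff
  have hθ2 : ContMDiff 𝓘(𝕜, EuclideanSpace 𝕜 (Fin n)) 𝓘(𝕜, Mfd.FibreModel X' M) ∞
      (fun t => (θ t).2) := (contDiff_snd.comp θ.contDiff).contMDiff
  have hT₁ : IsOpen ((fun t => (θ t).1) ⁻¹' φ.target) := φ.open_target.preimage hθ1.continuous
  have hy : ContMDiffOn 𝓘(𝕜, EuclideanSpace 𝕜 (Fin n)) L.I ∞ (fun t => φ.symm (θ t).1)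
      ((fun t => (θ t).1) ⁻¹' φ.target) := hφ'.comp hθ1.contMDiffOn fun t ht => ht
  have hT₂ := hy.continuousOn.isOpen_inter_preimage hT₁ hV
  set T₂ := ((fun t => (θ t).1) ⁻¹' φ.target) ∩ (fun t => φ.symm (θ t).1) ⁻¹' V
  have hx : ContMDiffOn 𝓘(𝕜, EuclideanSpace 𝕜 (Fin n)) X.I ∞ (fun t => σ (φ.symm (θ t).1)) T₂ :=
    hσ.comp (hy.mono Set.inter_subset_left) fun t ht => ht.2
  have hu : ContMDiffOn 𝓘(𝕜, EuclideanSpace 𝕜 (Fin n)) (M.I.prod 𝓘(𝕜, Mfd.FibreModel X' M)) ∞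
      (fun t => (f (σ (φ.symm (θ t).1)), (θ t).2)) T₂ :=
    (hf.comp_contMDiffOn hx).prodMk hθ2.contMDiffOn
  have hT := hu.continuousOn.isOpen_inter_preimage hT₂ hc.isOpen_V
  have hνc := hν.continuousOn
  obtain ⟨O, hO, hνO⟩ := continuousOn_iff'.1 hνc U hc.isOpen_U
  set T := T₂ ∩ (fun t => (f (σ (φ.symm (θ t).1)), (θ t).2)) ⁻¹' Vc
  set D := {z : X × X' | f z.1 = g z.2 ∧ b z.1 ∈ V ∧ b z.1 ∈ φ.source ∧ ν z ∈ U}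
  set ℓ : EuclideanSpace 𝕜 (Fin n) → X × X' := fun t =>
    (σ (φ.symm (θ t).1), c (f (σ (φ.symm (θ t).1)), (θ t).2))
  set G : X × X' → EuclideanSpace 𝕜 (Fin n) := fun z => θ.symm (φ (b z.1), w (ν z))
  have hbℓ : ∀ t ∈ T, b (ℓ t).1 = φ.symm (θ t).1 := fun t ht => hbσ _ ht.1.2
  have hℓZ : ∀ t ∈ T, f (ℓ t).1 = g (ℓ t).2 := fun t ht => (hc.f_c _ ht.2).symm
  have hνℓ : ∀ t ∈ T, ν (ℓ t) = (ℓ t).2 := fun t ht => hνσ _ _ ht.1.2 (hℓZ t ht)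
  have hℓD : ∀ t ∈ T, ℓ t ∈ D := by
    refine fun t ht => ⟨hℓZ t ht, ?_, ?_, ?_⟩
    · rw [hbℓ t ht]; exact ht.1.2
    · rw [hbℓ t ht]; exact φ.map_target ht.1.1
    · rw [hνℓ t ht]; exact hc.mem_U _ ht.2
  have hGℓ : ∀ t ∈ T, G (ℓ t) = t := by
    intro t ht
    change θ.symm (φ (b (ℓ t).1), w (ν (ℓ t))) = t
    rw [hbℓ t ht, hνℓ t ht, φ.right_inv ht.1.1]
    change θ.symm ((θ t).1, w (c (f (σ (φ.symm (θ t).1)), (θ t).2))) = t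
    rw [hc.w_c _ ht.2, Prod.mk.eta, θ.symm_apply_apply]
  have hνz : ∀ z ∈ D, (f (σ (b z.1)), w (ν z)) ∈ Vc := fun z hz => by
    rw [hgν z hz.1 hz.2.1]
    exact hc.mem_V _ hz.2.2.2
  have hGT : ∀ z ∈ D, G z ∈ T := by
    intro z hz
    refine ⟨⟨?_, ?_⟩, ?_⟩
    · simpa [G] using φ.map_source hz.2.2.1
    · simpa [G, φ.left_inv hz.2.2.1] using hz.2.1
    · simpa [G, φ.left_inv hz.2.2.1] using hνz z hz
  have hℓG : ∀ z ∈ D, ℓ (G z) = (σ (b z.1), ν z) := by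
    intro z hz
    simp only [ℓ, G, θ.apply_symm_apply, φ.left_inv hz.2.2.1]
    rw [hgν z hz.1 hz.2.1, hc.c_eq _ hz.2.2.2]
  have hz₀ν : ν z₀ = z₀.2 := by
    have := hνσ (b z₀.1) z₀.2 hz₀V (by rw [hσz₀, hz₀])
    rwa [hσz₀] at this
  have hz₀D : z₀ ∈ D := ⟨hz₀, hz₀V, hbφ, by rwa [hz₀ν]⟩
  refine ⟨T, ℓ, D, G, ⟨hT, ?_, hℓD, ?_, ?_, ?_, ?_, hGT, ?_⟩, G z₀, hGT z₀ hz₀D, ?_⟩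
  · exact (hx.mono Set.inter_subset_left).prodMk
      (hc.smooth_c.comp (hu.mono Set.inter_subset_left) fun t ht => ht.2)
  · intro t ht t' ht' h
    obtain ⟨h1, h2⟩ := hπ _ _ (hℓZ t ht) (hℓZ t' ht') (hℓD t' ht').2.1 h
    rw [← hGℓ t ht, ← hGℓ t' ht']
    simp only [G, h1, h2]
  · refine ⟨{z | b z.1 ∈ V} ∩ {z | b z.1 ∈ φ.source} ∩ O,
      ((hV.preimage hbX.continuous).inter (φ.open_source.preimage hbX.continuous)).inter hO, ?_⟩
    ext z
    have := Set.ext_iff.1 hνO z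
    simp only [Set.mem_inter_iff, Set.mem_preimage, Set.mem_ofPred_eq] at this
    simp only [D, Set.mem_inter_iff, Set.mem_ofPred_eq]
    tauto
  · rintro s hs d hd h
    obtain ⟨h1, h2⟩ := hπ s d hs hd.1 hd.2.1 h
    exact ⟨hs, h1 ▸ hd.2.1, h1 ▸ hd.2.2.1, h2 ▸ hd.2.2.2⟩
  · refine (θ.symm.contDiff.contMDiff).comp_contMDiffOn (ContMDiffOn.prodMk_space ?_ ?_)
    · exact hφ.comp hbX.contMDiffOn fun z hz => hz.2.2.1
    · exact hc.smooth_w.comp (hν.mono fun z hz => ⟨hz.1, hz.2.1⟩) fun z hz => hz.2.2.2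
  · intro z hz
    rw [hℓG z hz, hπν z hz.1 hz.2.1]
  · rw [hℓG z₀ hz₀D, hσz₀, hz₀ν]

end Slices

/-! ### The quotient space and its manifold structure -/

section Composition

variable {𝕜 : Type} [RCLike 𝕜] {G₁ G₂ G₃ : LieGroupoid.{u} 𝕜}
  (A : LieMoritaEquivalence G₁ G₂) (B : LieMoritaEquivalence G₂ G₃)

/-- The fibre product as a subset of `X × X'`. -/
abbrev fibSet : Set (A.X × B.X) := {z | A.data.p' z.1 = B.data.p z.2}

open Classical in
/-- The corestriction to the fibre product, extended by junk values. -/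
noncomputable def fibMk (z : A.X × B.X) : FibreProduct A B :=
  if h : A.data.p' z.1 = B.data.p z.2 then ⟨z, h⟩
  -- Surjectivity of the moment map supplies a junk value over every pair, so no separate
  -- nonemptiness assumption is needed.
  else ⟨(z.1, (B.isMorita.surjective_p (A.data.p' z.1)).choose),
    (B.isMorita.surjective_p (A.data.p' z.1)).choose_spec.symm⟩

/-- The class of a point of the fibre product, extended by junk values. -/
noncomputable def classMk (z : A.X × B.X) : CompSpace A B := compMk A B (fibMk A B z)

variable {A B}

theorem fibMk_eq {z : A.X × B.X} (h : z ∈ fibSet A B) : fibMk A B z = ⟨z, h⟩ := dif_pos h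

theorem fibMk_val (z : FibreProduct A B) : fibMk A B z = z := fibMk_eq z.2

theorem classMk_val (z : FibreProduct A B) : classMk A B z = compMk A B z := by
  rw [classMk, fibMk_val]

theorem exists_classMk_eq (q : CompSpace A B) : ∃ z ∈ fibSet A B, classMk A B z = q := by
  obtain ⟨z, rfl⟩ := Quot.exists_rep q
  exact ⟨z, z.2, classMk_val z⟩

theorem normal_mem {z : A.X × B.X} (hz : z ∈ fibSet A B) {x : A.X}
    (hx : A.data.p x = A.data.p z.1) :
    (x, B.data.l (A.data.dr (x, z.1), z.2)) ∈ fibSet A B := by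
  change A.data.p' x = B.data.p _
  rw [B.isMorita.p_l ((A.isMorita.t_dr hx).trans hz), ← A.isMorita.s_dr hx]

/-- Every class has a representative with a prescribed first component in the right fibre. -/
theorem classMk_normal {z : A.X × B.X} (hz : z ∈ fibSet A B) {x : A.X}
    (hx : A.data.p x = A.data.p z.1) :
    classMk A B (x, B.data.l (A.data.dr (x, z.1), z.2)) = classMk A B z := by
  have e : G₂.t (A.data.dr (x, z.1)) = B.data.p z.2 := (A.isMorita.t_dr hx).trans hz
  rw [classMk, classMk, fibMk_eq hz, fibMk_eq (normal_mem hz hx)]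
  refine (Quot.sound ⟨A.data.dr (x, z.1), e, Subtype.ext (Prod.ext ?_ ?_)⟩).symm
  · change A.data.ract z.1 (G₂.inv (A.data.dr (x, z.1))) _ = x
    rw [← BimoduleData.r_eq, A.isMorita.inv_dr hx, A.isMorita.r_dr hx.symm]
  · exact (BimoduleData.l_eq e).symm

/-- The equivalence relation generated by the diagonal action. -/
theorem diagRel_normal (z w : FibreProduct A B) (h : compMk A B z = compMk A B w) :
    A.data.p z.1.1 = A.data.p w.1.1 ∧
      B.data.l (A.data.dr (w.1.1, z.1.1), z.1.2) = w.1.2 := by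
  -- `Quot` uses the equivalence generated by `diagRel`. The explicit relation `R` is itself an
  -- equivalence containing `diagRel`, so it contains the generated one.
  let R : FibreProduct A B → FibreProduct A B → Prop := fun z w =>
    A.data.p z.1.1 = A.data.p w.1.1 ∧ B.data.l (A.data.dr (w.1.1, z.1.1), z.1.2) = w.1.2
  have htrans : ∀ {z w v}, R z w → R w v → R z v := by
    rintro ⟨⟨x, x'⟩, hx⟩ ⟨⟨y, y'⟩, hy⟩ ⟨⟨v, v'⟩, hv⟩ ⟨h1, h2⟩ ⟨h3, h4⟩
    simp only at h1 h2 h3 h4 hx hy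
    refine ⟨h1.trans h3, ?_⟩
    change B.data.l (A.data.dr (v, x), x') = v'
    rw [← h4, ← h2, B.isMorita.l_l, A.isMorita.m_dr h3.symm h1.symm]
    · rw [A.isMorita.t_dr h3.symm, A.isMorita.s_dr h1.symm]
    · rw [A.isMorita.t_dr h1.symm, hx]
  have hrefl : ∀ z, R z z := fun z =>
    ⟨rfl, by rw [A.isMorita.dr_self, B.isMorita.l_unit z.2]⟩
  have hsymm : ∀ {z w}, R z w → R w z := by
    rintro ⟨⟨x, x'⟩, hx⟩ ⟨⟨y, y'⟩, hy⟩ ⟨h1, h2⟩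
    simp only at h1 h2 hx hy
    refine ⟨h1.symm, ?_⟩
    change B.data.l (A.data.dr (x, y), y') = x'
    rw [← h2, B.isMorita.l_l, A.isMorita.m_dr h1 h1.symm, A.isMorita.dr_self,
      B.isMorita.l_unit hx]
    · rw [A.isMorita.t_dr h1, A.isMorita.s_dr h1.symm]
    · rw [A.isMorita.t_dr h1.symm, hx]
  have hR : Equivalence R := ⟨hrefl, hsymm, htrans⟩
  have hsub : ∀ z w, diagRel A B z w → R z w := by
    rintro ⟨⟨x, x'⟩, hx⟩ _ ⟨g, e, rfl⟩
    have e' : G₂.t g = B.data.p x' := e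
    have e1 : A.data.p' x = G₂.s (G₂.inv g) := by rw [G₂.s_inv, e', hx]
    change A.data.p x = A.data.p (A.data.ract x (G₂.inv g) _) ∧
      B.data.l (A.data.dr (A.data.ract x (G₂.inv g) _, x), x') = B.data.lact g x' _
    rw [← BimoduleData.r_eq e1, ← BimoduleData.l_eq e']
    have h2 : A.data.p' (A.data.r (x, G₂.inv g)) = G₂.s g := by
      rw [A.isMorita.p'_r e1, G₂.t_inv]
    have h3 : A.data.r (A.data.r (x, G₂.inv g), g) = x := by
      rw [A.isMorita.r_r e1 (G₂.t_inv g), G₂.inv_m, A.isMorita.r_unit]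
      rw [e', hx]
    have h4 := A.isMorita.dr_r h2
    rw [h3] at h4
    exact ⟨(A.isMorita.p_r e1).symm, by rw [h4]⟩
  exact hR.eqvGen_iff.1 ((Quot.eqvGen_exact h).mono hsub)

theorem classMk_eq {z w : A.X × B.X} (hz : z ∈ fibSet A B) (hw : w ∈ fibSet A B)
    (h : classMk A B z = classMk A B w) :
    A.data.p z.1 = A.data.p w.1 ∧ B.data.l (A.data.dr (w.1, z.1), z.2) = w.2 := by
  rw [classMk, classMk, fibMk_eq hz, fibMk_eq hw] at h
  exact diagRel_normal _ _ h

theorem classMk_eq_iff {z w : A.X × B.X} (hz : z ∈ fibSet A B) (hw : w ∈ fibSet A B) :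
    classMk A B z = classMk A B w ↔
      A.data.p z.1 = A.data.p w.1 ∧ B.data.l (A.data.dr (w.1, z.1), z.2) = w.2 := by
  refine ⟨classMk_eq hz hw, fun ⟨h1, h2⟩ => ?_⟩
  rw [← classMk_normal hz h1.symm, h2]

/-- Smoothness of division makes passage to the representative over σ smooth; this is the source of
the charts on the quotient. -/
theorem contMDiffOn_normal {σ : G₁.Obj → A.X} {V : Set G₁.Obj}
    (hσ : ContMDiffOn G₁.Obj.I A.X.I ∞ σ V) (hpσ : ∀ y ∈ V, A.data.p (σ y) = y) :
    ContMDiffOn (A.X.I.prod B.X.I) B.X.I ∞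
      (fun z : A.X × B.X => B.data.l (A.data.dr (σ (A.data.p z.1), z.1), z.2))
      (fibSet A B ∩ {z | A.data.p z.1 ∈ V}) := by
  have hσ' : ContMDiffOn (A.X.I.prod B.X.I) A.X.I ∞ (fun z : A.X × B.X => σ (A.data.p z.1))
      (fibSet A B ∩ {z | A.data.p z.1 ∈ V}) :=
    hσ.comp (A.isMorita.submersion_p.contMDiff.comp contMDiff_fst).contMDiffOn fun z hz => hz.2
  have hdr : ContMDiffOn (A.X.I.prod B.X.I) G₂.Arr.I ∞
      (fun z : A.X × B.X => A.data.dr (σ (A.data.p z.1), z.1))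
      (fibSet A B ∩ {z | A.data.p z.1 ∈ V}) :=
    A.isMorita.contMDiffOn_dr.comp (hσ'.prodMk contMDiffOn_fst) fun z hz => hpσ _ hz.2
  exact B.isMorita.contMDiffOn_l.comp (hdr.prodMk contMDiffOn_snd) fun z hz =>
    (A.isMorita.t_dr (hpσ _ hz.2)).trans hz.1

theorem continuousOn_fibMk : ContinuousOn (fibMk A B) (fibSet A B) := by
  refine (IsInducing.subtypeVal (t := fibSet A B)).continuousOn_iff.2 ?_
  exact continuousOn_id.congr fun z hz => by rw [Function.comp_apply, fibMk_eq hz]; rfl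

theorem continuousOn_classMk : ContinuousOn (classMk A B) (fibSet A B) :=
  continuous_quot_mk.comp_continuousOn continuousOn_fibMk

theorem isOpen_fibMk_image {O : Set (A.X × B.X)} (hO : IsOpen O) :
    IsOpen (fibMk A B '' (fibSet A B ∩ O)) := by
  convert hO.preimage continuous_subtype_val using 1
  ext z
  constructor
  · rintro ⟨w, ⟨hw, hwO⟩, rfl⟩
    rwa [Set.mem_preimage, fibMk_eq hw]
  · exact fun hz => ⟨z, ⟨z.2, hz⟩, fibMk_val z⟩

/-- If `z` is equivalent to `w` in `O`, normalise along a section through the first component of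
`w`. This is continuous near `z` and sends `z` to `w`, so nearby points also have representatives in
`O`. -/
theorem isOpen_classMk_image {O : Set (A.X × B.X)} (hO : IsOpen O) :
    IsOpen (classMk A B '' (fibSet A B ∩ O)) := by
  refine isOpen_coinduced.2 (isOpen_iff_mem_nhds.2 ?_)
  rintro z ⟨w, ⟨hw, hwO⟩, hwz⟩
  have hwz' : classMk A B w = classMk A B z := hwz.trans (classMk_val z).symm
  obtain ⟨h1, h2⟩ := classMk_eq z.2 hw hwz'.symm
  obtain ⟨V, σ, hV, hwV, hσ, hσw, hpσ⟩ := A.isMorita.submersion_p.exists_section w.1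
  have hzV : A.data.p z.1.1 ∈ V := by rwa [h1]
  have hσz : σ (A.data.p z.1.1) = w.1 := by rw [h1, hσw]
  have hVo : IsOpen {z : A.X × B.X | A.data.p z.1 ∈ V} :=
    hV.preimage (A.isMorita.submersion_p.contMDiff.continuous.comp continuous_fst)
  have hn : ContinuousOn (fun z : A.X × B.X =>
      (σ (A.data.p z.1), B.data.l (A.data.dr (σ (A.data.p z.1), z.1), z.2)))
      (fibSet A B ∩ {z | A.data.p z.1 ∈ V}) := by
    refine ContinuousOn.prodMk ?_ (contMDiffOn_normal hσ hpσ).continuousOn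
    exact hσ.continuousOn.comp
      (A.isMorita.submersion_p.contMDiff.continuous.comp continuous_fst).continuousOn
      fun z hz => hz.2
  have hev := (hn z.1 ⟨z.2, hzV⟩).preimage_mem_nhdsWithin (hO.mem_nhds (by
    rwa [hσz, h2]))
  rw [nhdsWithin_inter_of_mem' (mem_nhdsWithin_of_mem_nhds (hVo.mem_nhds hzV))] at hev
  have hev' := preimage_coe_mem_nhds_subtype.2
    (Filter.inter_mem hev (mem_nhdsWithin_of_mem_nhds (hVo.mem_nhds hzV)))
  filter_upwards [hev'] with y hy
  have hpy := hpσ _ hy.2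
  exact ⟨_, ⟨normal_mem y.2 hpy, hy.1⟩, (classMk_normal y.2 hpy).trans (classMk_val y)⟩

theorem isOpenQuotientMap_compMk : IsOpenQuotientMap (compMk A B) where
  surjective := Quot.mk_surjective
  continuous := continuous_quot_mk
  isOpenMap := by
    intro O hO
    obtain ⟨O', hO', rfl⟩ := isOpen_induced_iff.1 hO
    convert isOpen_classMk_image (A := A) (B := B) hO' using 1
    ext q
    constructor
    · rintro ⟨z, hz, rfl⟩
      exact ⟨z, ⟨z.2, hz⟩, classMk_val z⟩
    · rintro ⟨z, ⟨hz, hzO⟩, rfl⟩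
      exact ⟨⟨z, hz⟩, hzO, (classMk_val (⟨z, hz⟩ : FibreProduct A B)).symm⟩

instance : SecondCountableTopology (FibreProduct A B) :=
  TopologicalSpace.Subtype.secondCountableTopology (fibSet A B)

instance : SecondCountableTopology (CompSpace A B) :=
  isOpenQuotientMap_compMk.isQuotientMap.secondCountableTopology isOpenQuotientMap_compMk.isOpenMap

/-- For an open quotient map, the quotient is Hausdorff when the relation is closed. Here it is cut
out, on the closed set where the values of p agree, by an equation between continuous maps;
continuity of division is what properness contributes. -/
instance : T2Space (CompSpace A B) := by
  rw [t2Space_iff_of_isOpenQuotientMap isOpenQuotientMap_compMk]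
  let C : Set (FibreProduct A B × FibreProduct A B) :=
    {q | A.data.p q.1.1.1 = A.data.p q.2.1.1}
  have hp : Continuous A.data.p := A.isMorita.submersion_p.contMDiff.continuous
  have hC : IsClosed C := isClosed_eq (by fun_prop) (by fun_prop)
  have hf : ContinuousOn (fun q : FibreProduct A B × FibreProduct A B =>
      B.data.l (A.data.dr (q.2.1.1, q.1.1.1), q.1.1.2)) C := by
    refine B.isMorita.contMDiffOn_l.continuousOn.comp
      (ContinuousOn.prodMk (A.isMorita.continuousOn_dr.comp (f := fun q :
        FibreProduct A B × FibreProduct A B => (q.2.1.1, q.1.1.1)) ?_ fun q hq => Eq.symm hq) ?_)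
      fun q hq => (A.isMorita.t_dr (Eq.symm hq)).trans q.1.2
    · exact Continuous.continuousOn (by fun_prop)
    · exact Continuous.continuousOn (by fun_prop)
  have hg : ContinuousOn (fun q : FibreProduct A B × FibreProduct A B => q.2.1.2) C :=
    Continuous.continuousOn (by fun_prop)
  convert (hf.prodMk hg).preimage_isClosed_of_isClosed hC isClosed_diagonal using 1
  ext q
  change compMk A B q.1 = compMk A B q.2 ↔ _
  rw [← classMk_val, ← classMk_val, classMk_eq_iff q.1.2 q.2.2]
  rfl

/-- The fibre product is treated as a trivial quotient: with the identity as section, every point is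
already in normal form. -/
theorem exists_fibreProduct_structure : ∃ P : SmoothStructure 𝕜 (FibreProduct A B),
    IsLocalQuotient (A.X.I.prod B.X.I) (Q := P.toMfd) (fibMk A B) (fibSet A B) := by
  have hf := A.isMorita.submersion_p'.contMDiff
  refine exists_smoothStructure_of_isSlice (n := A.X.dim + (B.X.dim - G₂.Obj.dim)) _
    continuousOn_fibMk (fun O hO => isOpen_fibMk_image hO)
    (fun z => ⟨z, z.2, fibMk_val z⟩) fun z hz => ?_
  refine exists_isSlice hf B.isMorita.submersion_p (b := id) contMDiff_id isOpen_univ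
    (σ := id) contMDiffOn_id (fun _ _ => rfl) (ν := Prod.snd) contMDiffOn_snd
    (fun z hz _ => hz) (fun z _ _ => rfl) (fun _ _ _ _ => rfl) ?_ hz trivial rfl
  intro z w hz hw _ h
  rw [fibMk_eq hz, fibMk_eq hw] at h
  have h' : z = w := congrArg Subtype.val h
  exact ⟨congrArg Prod.fst h', congrArg Prod.snd h'⟩

theorem exists_compSpace_structure : ∃ S : SmoothStructure 𝕜 (CompSpace A B),
    IsLocalQuotient (A.X.I.prod B.X.I) (Q := S.toMfd) (classMk A B) (fibSet A B) := by
  refine exists_smoothStructure_of_isSlice (n := G₁.Obj.dim + (B.X.dim - G₂.Obj.dim)) _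
    continuousOn_classMk (fun O hO => isOpen_classMk_image hO) exists_classMk_eq fun z hz => ?_
  obtain ⟨V, σ, hV, hzV, hσ, hσz, hpσ⟩ := A.isMorita.submersion_p.exists_section z.1
  refine exists_isSlice A.isMorita.submersion_p'.contMDiff B.isMorita.submersion_p
    A.isMorita.submersion_p.contMDiff hV hσ hpσ (contMDiffOn_normal hσ hpσ)
    (fun w hw hwV => normal_mem hw (hpσ _ hwV)) (fun w hw hwV => classMk_normal hw (hpσ _ hwV))
    ?_ ?_ hz hzV hσz
  · intro y x' hy hx'
    change B.data.l (A.data.dr (σ (A.data.p (σ y)), σ y), x') = x'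
    rw [hpσ y hy, A.isMorita.dr_self, B.isMorita.l_unit hx']
  · intro z w hz hw hwV h
    obtain ⟨h1, h2⟩ := classMk_eq hz hw h
    refine ⟨h1, ?_⟩
    have h3 : A.data.p (σ (A.data.p w.1)) = A.data.p w.1 := hpσ _ hwV
    change B.data.l (A.data.dr (σ (A.data.p z.1), z.1), z.2) =
      B.data.l (A.data.dr (σ (A.data.p w.1), w.1), w.2)
    rw [h1, ← h2, B.isMorita.l_l, A.isMorita.m_dr h3 h1.symm]
    · rw [A.isMorita.t_dr h3, A.isMorita.s_dr h1.symm]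
    · rw [A.isMorita.t_dr h1.symm, hz]

theorem isQuotientStructure_of_isLocalQuotient {S : SmoothStructure 𝕜 (CompSpace A B)}
    (hS : IsLocalQuotient (A.X.I.prod B.X.I) (Q := S.toMfd) (classMk A B) (fibSet A B)) :
    IsQuotientStructure A B S := by
  obtain ⟨P, hP⟩ := exists_fibreProduct_structure (A := A) (B := B)
  have hret : IsLocalSmoothRetract (A.X.I.prod B.X.I) (fibSet A B) :=
    Mfd.isLocalSmoothRetract_fibreProduct_right A.isMorita.submersion_p'.contMDiff
      B.isMorita.submersion_p
  -- By definition of `fibMk`, a local lift of it is the inclusion itself, so the inclusion inherits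
  -- smoothness from the lifts.
  have hval : ContMDiff (M := P.toMfd) P.toMfd.I (A.X.I.prod B.X.I) ∞
      (Subtype.val : FibreProduct A B → A.X × B.X) := by
    intro z
    obtain ⟨O, σ, hO, hzO, hσ, hσS, hπσ, -⟩ := hP.exists_lift z.1 z.2
    have h0 : fibMk A B z.1 = z := fibMk_val z
    have hzO' : z ∈ O := h0 ▸ hzO
    refine (hσ.contMDiffAt (hO.mem_nhds hzO')).congr_of_eventuallyEq ?_
    filter_upwards [hO.mem_nhds hzO'] with q hq
    have := hπσ q hq
    rw [fibMk_eq (hσS q hq)] at this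
    exact (congrArg Subtype.val this).symm
  refine ⟨P, ⟨Mfd.isImmersion_prod_of_leftInverse (X := P.toMfd) hval fun z => ?_,
    IsEmbedding.subtypeVal⟩, Mfd.submersion_of_section ?_ fun z => ?_⟩
  · obtain ⟨O, R, hO, hzO, hR, hRS, hRid⟩ := hret z.1 z.2
    refine ⟨O, fibMk A B ∘ R, hO, hzO, hP.smooth.comp hR hRS, ?_⟩
    filter_upwards [(hO.preimage continuous_subtype_val).mem_nhds hzO] with y hy
    exact (congrArg (fibMk A B) (hRid _ ⟨hy, y.2⟩)).trans (fibMk_val y)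
  · have := hS.smooth.comp_contMDiff hval fun z => z.2
    exact this.congr fun z => (classMk_val z).symm
  · obtain ⟨O, σ, hO, hzO, hσ, hσS, hπσ, hσz⟩ := hS.exists_lift z.1 z.2
    have h0 : classMk A B z.1 = compMk A B z := classMk_val z
    rw [h0] at hzO hσz
    refine ⟨O, fibMk A B ∘ σ, hO, hzO, hP.smooth.comp hσ hσS, ?_, fun q hq => ?_⟩
    · exact (congrArg (fibMk A B) hσz).trans (fibMk_val z)
    · exact hπσ q hq

end Composition

/-- A continuous inverse on the image makes Φ an embedding, and the closed image makes it a closed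
one. This converts continuous division back into properness. -/
theorem isProperMap_of_leftInverse {S T P : Type*} [TopologicalSpace S] [TopologicalSpace T]
    [TopologicalSpace P] {Φ : S → T} (hΦ : Continuous Φ) {j : S → P} (hj : IsEmbedding j)
    {ψ : T → P} (hψ : ContinuousOn ψ (Set.range Φ)) (hψΦ : ∀ s, ψ (Φ s) = j s)
    (hC : IsClosed (Set.range Φ)) : IsProperMap Φ := by
  have h1 : Continuous (Set.rangeFactorization Φ) := hΦ.subtype_mk _
  have h2 : IsEmbedding (Set.rangeFactorization Φ) :=
    IsEmbedding.of_comp h1 (continuousOn_iff_continuous_domRestrict.1 hψ)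
      (by convert hj using 1; exact funext hψΦ)
  exact IsClosedEmbedding.isProperMap ⟨IsEmbedding.subtypeVal.comp h2, by
    convert hC using 1⟩

namespace IsLocalQuotient

variable {𝕜 : Type} [RCLike 𝕜]
  {E : Type*} [NormedAddCommGroup E] [NormedSpace 𝕜 E] {H : Type*} [TopologicalSpace H]
  {J : ModelWithCorners 𝕜 E H} {N : Type*} [TopologicalSpace N] [ChartedSpace H N]
  {Q Z : Mfd.{u} 𝕜} {π : N → Q} {S : Set N} (h : IsLocalQuotient J π S)

include h

theorem exists_lift_at (q : Q) : ∃ (O : Set Q) (σ : Q → N), IsOpen O ∧ q ∈ O ∧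
    ContMDiffOn Q.I J ∞ σ O ∧ (∀ q ∈ O, σ q ∈ S) ∧ ∀ q ∈ O, π (σ q) = q := by
  obtain ⟨z, hz, rfl⟩ := h.surj q
  obtain ⟨O, σ, hO, hzO, hσ, hσS, hπσ, -⟩ := h.exists_lift z hz
  exact ⟨O, σ, hO, hzO, hσ, hσS, hπσ⟩

theorem contMDiff_of_comp {f : Q → Z} (hf : ContMDiffOn J Z.I ∞ (fun z => f (π z)) S) :
    Mfd.Smooth f := by
  intro q
  obtain ⟨O, σ, hO, hqO, hσ, hσS, hπσ⟩ := h.exists_lift_at q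
  refine ((hf.comp hσ hσS).contMDiffAt (hO.mem_nhds hqO)).congr_of_eventuallyEq ?_
  filter_upwards [hO.mem_nhds hqO] with q hq
  rw [Function.comp_apply, hπσ q hq]

end IsLocalQuotient

/-! ### The bimodule structure of the composition -/

section Composition

variable {𝕜 : Type} [RCLike 𝕜] {G₁ G₂ G₃ : LieGroupoid.{u} 𝕜}

/-- The manifold `Q` with the bimodule data `D` is the quotient of the fibre product of `A` and `B`
by the diagonal action, with projection `π`. -/
structure IsComposition (A : LieMoritaEquivalence G₁ G₂) (B : LieMoritaEquivalence G₂ G₃)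
    (Q : Mfd.{u} 𝕜) (D : BimoduleData G₁ G₃ Q) (π : A.X × B.X → Q) : Prop
    extends IsLocalQuotient (A.X.I.prod B.X.I) π (fibSet A B) where
  π_eq_iff : ∀ {z w}, z ∈ fibSet A B → w ∈ fibSet A B → (π z = π w ↔
    A.data.p z.1 = A.data.p w.1 ∧ B.data.l (A.data.dr (w.1, z.1), z.2) = w.2)
  p_π : ∀ {z}, z ∈ fibSet A B → D.p (π z) = A.data.p z.1
  p'_π : ∀ {z}, z ∈ fibSet A B → D.p' (π z) = B.data.p' z.2
  l_π : ∀ {g z}, z ∈ fibSet A B → G₁.t g = A.data.p z.1 →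
    D.l (g, π z) = π (A.data.l (g, z.1), z.2)
  r_π : ∀ {z h}, z ∈ fibSet A B → B.data.p' z.2 = G₃.s h →
    D.r (π z, h) = π (z.1, B.data.r (z.2, h))

namespace IsComposition

variable {A : LieMoritaEquivalence G₁ G₂} {B : LieMoritaEquivalence G₂ G₃}
    {Q : Mfd.{u} 𝕜} {D : BimoduleData G₁ G₃ Q} {π : A.X × B.X → Q}
    (h : IsComposition A B Q D π)

theorem l_mem {g : G₁.Arr} {z : A.X × B.X} (hz : z ∈ fibSet A B) (e : G₁.t g = A.data.p z.1) :
    (A.data.l (g, z.1), z.2) ∈ fibSet A B :=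
  (A.isMorita.p'_l e).trans hz

theorem r_mem {z : A.X × B.X} {k : G₃.Arr} (hz : z ∈ fibSet A B) (e : B.data.p' z.2 = G₃.s k) :
    (z.1, B.data.r (z.2, k)) ∈ fibSet A B :=
  Eq.trans hz (B.isMorita.p_r e).symm

include h

/-- The balancing relation [(x · k, x')] = [(x, k · x')], through which arrows of the middle
groupoid move between the two factors. -/
theorem π_r_l {x : A.X} {x' : B.X} {k : G₂.Arr} (e : A.data.p' x = G₂.s k)
    (e' : G₂.t k = B.data.p x') : π (A.data.r (x, k), x') = π (x, B.data.l (k, x')) := by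
  refine (h.π_eq_iff (A := A) (B := B) (z := (A.data.r (x, k), x')) (w := (x, B.data.l (k, x')))
    ((A.isMorita.p'_r e).trans e') (e.trans (B.isMorita.p_l e').symm)).2
    ⟨A.isMorita.p_r e, ?_⟩
  change B.data.l (A.data.dr (x, A.data.r (x, k)), x') = B.data.l (k, x')
  rw [A.isMorita.dr_r e]

theorem smooth_p : Mfd.Smooth D.p :=
  h.contMDiff_of_comp <| ((A.isMorita.submersion_p.contMDiff.comp
    contMDiff_fst).contMDiffOn).congr fun _ hz => h.p_π hz

theorem smooth_p' : Mfd.Smooth D.p' :=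
  h.contMDiff_of_comp <| ((B.isMorita.submersion_p'.contMDiff.comp
    contMDiff_snd).contMDiffOn).congr fun _ hz => h.p'_π hz

/-- A section is m ↦ [(σ m, τ (p' (σ m)))], with σ and τ sections of the left moment maps of the two
factors through the given representative. -/
theorem submersion_p : Mfd.Submersion D.p := by
  refine Mfd.submersion_of_section h.smooth_p fun c => ?_
  obtain ⟨z, hz, rfl⟩ := h.surj c
  obtain ⟨V, σ, hV, hzV, hσ, hσz, hpσ⟩ := A.isMorita.submersion_p.exists_section z.1
  obtain ⟨W, τ, hW, hzW, hτ, hτz, hpτ⟩ := B.isMorita.submersion_p.exists_section z.2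
  have hσ' : ContMDiffOn G₁.Obj.I G₂.Obj.I ∞ (fun m => A.data.p' (σ m)) V :=
    A.isMorita.submersion_p'.contMDiff.comp_contMDiffOn hσ
  have hm : ∀ m ∈ V ∩ (fun m => A.data.p' (σ m)) ⁻¹' W,
      (σ m, τ (A.data.p' (σ m))) ∈ fibSet A B := fun m hm => (hpτ _ hm.2).symm
  refine ⟨V ∩ (fun m => A.data.p' (σ m)) ⁻¹' W, fun m => π (σ m, τ (A.data.p' (σ m))),
    hσ'.continuousOn.isOpen_inter_preimage hV hW, ?_, ?_, ?_, fun m hm' => ?_⟩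
  · rw [h.p_π hz]
    exact ⟨hzV, by rw [Set.mem_preimage, hσz, hz]; exact hzW⟩
  · exact h.smooth.comp ((hσ.mono Set.inter_subset_left).prodMk
      (hτ.comp (hσ'.mono Set.inter_subset_left) fun m hm => hm.2)) hm
  · beta_reduce
    rw [h.p_π hz, hσz, hz, hτz]
  · rw [h.p_π (hm m hm'), hpσ m hm'.1]

theorem submersion_p' : Mfd.Submersion D.p' := by
  refine Mfd.submersion_of_section h.smooth_p' fun c => ?_
  obtain ⟨z, hz, rfl⟩ := h.surj c
  obtain ⟨V, σ, hV, hzV, hσ, hσz, hpσ⟩ := B.isMorita.submersion_p'.exists_section z.2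
  obtain ⟨W, τ, hW, hzW, hτ, hτz, hpτ⟩ := A.isMorita.submersion_p'.exists_section z.1
  have hσ' : ContMDiffOn G₃.Obj.I G₂.Obj.I ∞ (fun m => B.data.p (σ m)) V :=
    B.isMorita.submersion_p.contMDiff.comp_contMDiffOn hσ
  have hm : ∀ m ∈ V ∩ (fun m => B.data.p (σ m)) ⁻¹' W,
      (τ (B.data.p (σ m)), σ m) ∈ fibSet A B := fun m hm => hpτ _ hm.2
  have hz' : B.data.p z.2 = A.data.p' z.1 := Eq.symm hz
  refine ⟨V ∩ (fun m => B.data.p (σ m)) ⁻¹' W, fun m => π (τ (B.data.p (σ m)), σ m),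
    hσ'.continuousOn.isOpen_inter_preimage hV hW, ?_, ?_, ?_, fun m hm' => ?_⟩
  · rw [h.p'_π hz]
    exact ⟨hzV, by rw [Set.mem_preimage, hσz, hz']; exact hzW⟩
  · exact h.smooth.comp ((hτ.comp (hσ'.mono Set.inter_subset_left) fun m hm => hm.2).prodMk
      (hσ.mono Set.inter_subset_left)) hm
  · beta_reduce
    rw [h.p'_π hz, hσz, hz', hτz]
  · rw [h.p'_π (hm m hm'), hpσ m hm'.1]

theorem contMDiffOn_l : ContMDiffOn (G₁.Arr.I.prod Q.I) Q.I ∞ D.l {z | G₁.t z.1 = D.p z.2} := by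
  refine contMDiffOn_of_locally_contMDiffOn fun z hz => ?_
  obtain ⟨O, σ, hO, hzO, hσ, hσS, hπσ⟩ := h.exists_lift_at z.2
  refine ⟨Set.univ ×ˢ O, isOpen_univ.prod hO, ⟨trivial, hzO⟩, ?_⟩
  have he : ∀ w ∈ {z : G₁.Arr × Q | G₁.t z.1 = D.p z.2} ∩ Set.univ ×ˢ O,
      G₁.t w.1 = A.data.p (σ w.2).1 := fun w hw => by
    rw [← h.p_π (hσS _ hw.2.2), hπσ _ hw.2.2]; exact hw.1
  have hσ' : ContMDiffOn (G₁.Arr.I.prod Q.I) (A.X.I.prod B.X.I) ∞ (fun w => σ w.2)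
      ({z : G₁.Arr × Q | G₁.t z.1 = D.p z.2} ∩ Set.univ ×ˢ O) :=
    hσ.comp contMDiffOn_snd fun w hw => hw.2.2
  refine ContMDiffOn.congr (f := fun w => π (A.data.l (w.1, (σ w.2).1), (σ w.2).2)) ?_ ?_
  · exact h.smooth.comp ((A.isMorita.contMDiffOn_l.comp
      (contMDiffOn_fst.prodMk (contMDiff_fst.comp_contMDiffOn hσ')) he).prodMk
      (contMDiff_snd.comp_contMDiffOn hσ')) fun w hw => l_mem (hσS _ hw.2.2) (he w hw)
  · intro w hw
    rw [← h.l_π (hσS _ hw.2.2) (he w hw), hπσ _ hw.2.2]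

theorem contMDiffOn_r : ContMDiffOn (Q.I.prod G₃.Arr.I) Q.I ∞ D.r {z | D.p' z.1 = G₃.s z.2} := by
  refine contMDiffOn_of_locally_contMDiffOn fun z hz => ?_
  obtain ⟨O, σ, hO, hzO, hσ, hσS, hπσ⟩ := h.exists_lift_at z.1
  refine ⟨O ×ˢ Set.univ, hO.prod isOpen_univ, ⟨hzO, trivial⟩, ?_⟩
  have he : ∀ w ∈ {z : Q × G₃.Arr | D.p' z.1 = G₃.s z.2} ∩ O ×ˢ Set.univ,
      B.data.p' (σ w.1).2 = G₃.s w.2 := fun w hw => by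
    rw [← h.p'_π (hσS _ hw.2.1), hπσ _ hw.2.1]; exact hw.1
  have hσ' : ContMDiffOn (Q.I.prod G₃.Arr.I) (A.X.I.prod B.X.I) ∞ (fun w => σ w.1)
      ({z : Q × G₃.Arr | D.p' z.1 = G₃.s z.2} ∩ O ×ˢ Set.univ) :=
    hσ.comp contMDiffOn_fst fun w hw => hw.2.1
  refine ContMDiffOn.congr (f := fun w => π ((σ w.1).1, B.data.r ((σ w.1).2, w.2))) ?_ ?_
  · exact h.smooth.comp ((contMDiff_fst.comp_contMDiffOn hσ').prodMk
      (B.isMorita.contMDiffOn_r.comp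
      ((contMDiff_snd.comp_contMDiffOn hσ').prodMk contMDiffOn_snd) he))
      fun w hw => r_mem (hσS _ hw.2.1) (he w hw)
  · intro w hw
    rw [← h.r_π (hσS _ hw.2.1) (he w hw), hπσ _ hw.2.1]

theorem isBimodule : IsBimodule G₁ G₃ Q D where
  submersion_p := h.submersion_p
  submersion_p' := h.submersion_p'
  surjective_p m := by
    obtain ⟨x, rfl⟩ := A.isMorita.surjective_p m
    obtain ⟨x', hx'⟩ := B.isMorita.surjective_p (A.data.p' x)
    exact ⟨π (x, x'), h.p_π (z := (x, x')) hx'.symm⟩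
  surjective_p' m := by
    obtain ⟨x', rfl⟩ := B.isMorita.surjective_p' m
    obtain ⟨x, hx⟩ := A.isMorita.surjective_p' (B.data.p x')
    exact ⟨π (x, x'), h.p'_π (z := (x, x')) hx⟩
  p_lact g c e := by
    obtain ⟨z, hz, rfl⟩ := h.surj c
    have e' := e.trans (h.p_π hz)
    rw [← BimoduleData.l_eq e, h.l_π hz e', h.p_π (l_mem hz e'), A.isMorita.p_l e']
  unit_lact c := by
    obtain ⟨z, hz, rfl⟩ := h.surj c
    rw [← BimoduleData.l_eq, h.l_π hz ((G₁.t_unit _).trans (h.p_π hz)),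
      A.isMorita.l_unit (h.p_π hz)]
  mul_lact g g' c e e' := by
    obtain ⟨z, hz, rfl⟩ := h.surj c
    have e1 := e'.trans (h.p_π hz)
    have e2 := e.trans (A.isMorita.p_l e1).symm
    rw [← BimoduleData.l_eq, ← BimoduleData.l_eq, ← BimoduleData.l_eq e', ← G₁.m_eq e,
      h.l_π hz ((G₁.t_m e).trans e1), h.l_π hz e1, h.l_π (l_mem hz e1) e2, A.isMorita.l_l e e1]
  smooth_lact := Mfd.smoothOnSubset_of_contMDiffOn
    (Mfd.isLocalSmoothRetract_fibreProduct_left G₁.submersion_t h.smooth_p) h.contMDiffOn_l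
    fun z => BimoduleData.l_eq z.2
  p'_ract c k e := by
    obtain ⟨z, hz, rfl⟩ := h.surj c
    have e' := (h.p'_π hz).symm.trans e
    rw [← BimoduleData.r_eq e, h.r_π hz e', h.p'_π (r_mem hz e'), B.isMorita.p'_r e']
  ract_unit c := by
    obtain ⟨z, hz, rfl⟩ := h.surj c
    rw [← BimoduleData.r_eq, h.r_π hz ((h.p'_π hz).symm.trans (G₃.s_unit _).symm),
      B.isMorita.r_unit (h.p'_π hz).symm]
  ract_mul c k k' e e' := by
    obtain ⟨z, hz, rfl⟩ := h.surj c
    have e1 := (h.p'_π hz).symm.trans e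
    have e2 := (B.isMorita.p'_r e1).trans e'
    rw [← BimoduleData.r_eq, ← BimoduleData.r_eq, ← BimoduleData.r_eq e, ← G₃.m_eq e',
      h.r_π hz (e1.trans (G₃.s_m e').symm), h.r_π hz e1, h.r_π (r_mem hz e1) e2,
      B.isMorita.r_r e1 e']
  smooth_ract := Mfd.smoothOnSubset_of_contMDiffOn
    (Mfd.isLocalSmoothRetract_fibreProduct_right h.smooth_p' G₃.submersion_s) h.contMDiffOn_r
    fun z => BimoduleData.r_eq z.2
  p_ract c k e := by
    obtain ⟨z, hz, rfl⟩ := h.surj c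
    have e' := (h.p'_π hz).symm.trans e
    rw [← BimoduleData.r_eq e, h.r_π hz e', h.p_π (r_mem hz e'), h.p_π hz]
  p'_lact g c e := by
    obtain ⟨z, hz, rfl⟩ := h.surj c
    have e' := e.trans (h.p_π hz)
    rw [← BimoduleData.l_eq e, h.l_π hz e', h.p'_π (l_mem hz e'), h.p'_π hz]
  comm g c k e e' := by
    obtain ⟨z, hz, rfl⟩ := h.surj c
    have e1 := e.trans (h.p_π hz)
    have e2 := (h.p'_π hz).symm.trans e'
    have key : D.r (D.lact g (π z) e, k) = D.l (g, D.ract (π z) k e') := by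
      rw [← BimoduleData.l_eq e, ← BimoduleData.r_eq e', h.l_π hz e1, h.r_π hz e2,
        h.r_π (l_mem hz e1) e2, h.l_π (r_mem hz e2) e1]
    exact (BimoduleData.r_eq _).symm.trans (key.trans (BimoduleData.l_eq _))

/-- The arrow dividing `y` by `x` fixes x', hence is a unit by freeness of the left action on the
second factor. -/
theorem π_eq_left {x y : A.X} {x' : B.X} (hx : (x, x') ∈ fibSet A B) (hy : (y, x') ∈ fibSet A B)
    (heq : π (x, x') = π (y, x')) : x = y := by
  obtain ⟨h1, h2⟩ := (h.π_eq_iff hx hy).1 heq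
  simp only at h1 h2
  have h3 := B.isMorita.free_left _ _ ((A.isMorita.t_dr h1.symm).trans hx)
    ((BimoduleData.l_eq _).symm.trans h2)
  have h4 := A.isMorita.r_dr h1.symm
  rw [h3, A.isMorita.r_unit hy] at h4
  exact h4.symm

theorem π_eq_right {x : A.X} {x' y' : B.X} (hx : (x, x') ∈ fibSet A B)
    (hy : (x, y') ∈ fibSet A B) (heq : π (x, x') = π (x, y')) : x' = y' := by
  obtain ⟨-, h2⟩ := (h.π_eq_iff hx hy).1 heq
  simp only at h2
  rwa [A.isMorita.dr_self, B.isMorita.l_unit hx] at h2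

end IsComposition

/-- The arrow taking the class of `z` to the class of `w` by the left action. -/
noncomputable def leftQuotient (A : LieMoritaEquivalence G₁ G₂) (B : LieMoritaEquivalence G₂ G₃)
    (q : (A.X × B.X) × (A.X × B.X)) : G₁.Arr :=
  A.data.dl (A.data.r (q.1.1, B.data.dl (q.1.2, q.2.2)), q.2.1)

/-- The arrow taking the class of `z` to the class of `w` by the right action. -/
noncomputable def rightQuotient (A : LieMoritaEquivalence G₁ G₂) (B : LieMoritaEquivalence G₂ G₃)
    (q : (A.X × B.X) × (A.X × B.X)) : G₃.Arr :=
  B.data.dr (q.1.2, B.data.l (A.data.dr (q.1.1, q.2.1), q.2.2))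

theorem continuousOn_leftQuotient (A : LieMoritaEquivalence G₁ G₂)
    (B : LieMoritaEquivalence G₂ G₃) : ContinuousOn (leftQuotient A B)
      {q | (q.1 ∈ fibSet A B ∧ q.2 ∈ fibSet A B) ∧ B.data.p' q.1.2 = B.data.p' q.2.2} := by
  have h1 : ContinuousOn (fun q : (A.X × B.X) × (A.X × B.X) => B.data.dl (q.1.2, q.2.2))
      {q | (q.1 ∈ fibSet A B ∧ q.2 ∈ fibSet A B) ∧ B.data.p' q.1.2 = B.data.p' q.2.2} :=
    B.isMorita.continuousOn_dl.comp (Continuous.continuousOn (by fun_prop)) fun q hq => hq.2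
  have h2 := A.isMorita.contMDiffOn_r.continuousOn.comp
    ((Continuous.continuousOn (by fun_prop : Continuous fun q : (A.X × B.X) × (A.X × B.X) =>
      q.1.1)).prodMk h1) fun q hq => hq.1.1.trans (B.isMorita.s_dl hq.2).symm
  exact A.isMorita.continuousOn_dl.comp (h2.prodMk (Continuous.continuousOn (by fun_prop)))
    fun q hq => ((A.isMorita.p'_r (hq.1.1.trans (B.isMorita.s_dl hq.2).symm)).trans
      (B.isMorita.t_dl hq.2)).trans hq.1.2.symm

theorem continuousOn_rightQuotient (A : LieMoritaEquivalence G₁ G₂)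
    (B : LieMoritaEquivalence G₂ G₃) : ContinuousOn (rightQuotient A B)
      {q | (q.1 ∈ fibSet A B ∧ q.2 ∈ fibSet A B) ∧ A.data.p q.1.1 = A.data.p q.2.1} := by
  have h1 : ContinuousOn (fun q : (A.X × B.X) × (A.X × B.X) => A.data.dr (q.1.1, q.2.1))
      {q | (q.1 ∈ fibSet A B ∧ q.2 ∈ fibSet A B) ∧ A.data.p q.1.1 = A.data.p q.2.1} :=
    A.isMorita.continuousOn_dr.comp (Continuous.continuousOn (by fun_prop)) fun q hq => hq.2
  have h2 := B.isMorita.contMDiffOn_l.continuousOn.comp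
    (h1.prodMk (Continuous.continuousOn (by fun_prop : Continuous fun q :
      (A.X × B.X) × (A.X × B.X) => q.2.2))) fun q hq => (A.isMorita.t_dr hq.2).trans hq.1.2
  exact B.isMorita.continuousOn_dr.comp ((Continuous.continuousOn (by fun_prop)).prodMk h2)
    fun q hq => (hq.1.1.symm.trans (A.isMorita.s_dr hq.2)).trans
      (B.isMorita.p_l ((A.isMorita.t_dr hq.2).trans hq.1.2)).symm

/-! ### Division and properness for the composition -/

namespace IsComposition

variable {A : LieMoritaEquivalence G₁ G₂} {B : LieMoritaEquivalence G₂ G₃}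
    {Q : Mfd.{u} 𝕜} {D : BimoduleData G₁ G₃ Q} {π : A.X × B.X → Q}
    (h : IsComposition A B Q D π)

include h

/-- With k · z₂ = w₂, balancing gives [(w₁, w₂)] = [(w₁ · k, z₂)]; it then remains to divide w₁ · k
by z₁ in the first factor. -/
theorem leftQuotient_spec {z w : A.X × B.X} (hz : z ∈ fibSet A B) (hw : w ∈ fibSet A B)
    (e : B.data.p' w.2 = B.data.p' z.2) :
    G₁.t (leftQuotient A B (w, z)) = A.data.p z.1 ∧ D.l (leftQuotient A B (w, z), π z) = π w := by
  have e1 : A.data.p' w.1 = G₂.s (B.data.dl (w.2, z.2)) := hw.trans (B.isMorita.s_dl e).symm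
  have e2 := B.isMorita.t_dl e
  have e3 : A.data.p' (A.data.r (w.1, B.data.dl (w.2, z.2))) = A.data.p' z.1 :=
    (A.isMorita.p'_r e1).trans (e2.trans hz.symm)
  refine ⟨A.isMorita.t_dl e3, (h.l_π hz (A.isMorita.t_dl e3)).trans ?_⟩
  rw [A.isMorita.l_dl e3, h.π_r_l e1 e2, B.isMorita.l_dl e]

theorem eq_of_l_eq {z : A.X × B.X} (hz : z ∈ fibSet A B) {g g' : G₁.Arr}
    (e : G₁.t g = A.data.p z.1) (e' : G₁.t g' = A.data.p z.1)
    (heq : D.l (g, π z) = D.l (g', π z)) : g = g' := by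
  rw [h.l_π hz e, h.l_π hz e'] at heq
  exact A.isMorita.l_cancel e e' (h.π_eq_left (l_mem hz e) (l_mem hz e') heq)

theorem rightQuotient_spec {z w : A.X × B.X} (hz : z ∈ fibSet A B) (hw : w ∈ fibSet A B)
    (e : A.data.p z.1 = A.data.p w.1) :
    B.data.p' z.2 = G₃.s (rightQuotient A B (z, w)) ∧
      D.r (π z, rightQuotient A B (z, w)) = π w := by
  have e1 : G₂.t (A.data.dr (z.1, w.1)) = B.data.p w.2 := (A.isMorita.t_dr e).trans hw
  have e2 : B.data.p z.2 = B.data.p (B.data.l (A.data.dr (z.1, w.1), w.2)) := by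
    rw [B.isMorita.p_l e1, ← A.isMorita.s_dr e, hz]
  refine ⟨B.isMorita.s_dr e2, (h.r_π hz (B.isMorita.s_dr e2)).trans ?_⟩
  rw [B.isMorita.r_dr e2, ← h.π_r_l (A.isMorita.s_dr e) e1, A.isMorita.r_dr e]

theorem eq_of_r_eq {z : A.X × B.X} (hz : z ∈ fibSet A B) {k k' : G₃.Arr}
    (e : B.data.p' z.2 = G₃.s k) (e' : B.data.p' z.2 = G₃.s k')
    (heq : D.r (π z, k) = D.r (π z, k')) : k = k' := by
  rw [h.r_π hz e, h.r_π hz e'] at heq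
  exact B.isMorita.r_cancel e e' (h.π_eq_right (r_mem hz e) (r_mem hz e') heq)

theorem exists_l_eq {c d : Q} (e : D.p' d = D.p' c) : ∃ g, G₁.t g = D.p c ∧ D.l (g, c) = d := by
  obtain ⟨z, hz, rfl⟩ := h.surj c
  obtain ⟨w, hw, rfl⟩ := h.surj d
  rw [h.p'_π hz, h.p'_π hw] at e
  rw [h.p_π hz]
  exact ⟨_, h.leftQuotient_spec hz hw e⟩

theorem exists_r_eq {c d : Q} (e : D.p c = D.p d) : ∃ k, D.p' c = G₃.s k ∧ D.r (c, k) = d := by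
  obtain ⟨z, hz, rfl⟩ := h.surj c
  obtain ⟨w, hw, rfl⟩ := h.surj d
  rw [h.p_π hz, h.p_π hw] at e
  rw [h.p'_π hz]
  exact ⟨_, h.rightQuotient_spec hz hw e⟩

theorem l_injective {c : Q} {g g' : G₁.Arr} (e : G₁.t g = D.p c) (e' : G₁.t g' = D.p c)
    (heq : D.l (g, c) = D.l (g', c)) : g = g' := by
  obtain ⟨z, hz, rfl⟩ := h.surj c
  exact h.eq_of_l_eq hz (e.trans (h.p_π hz)) (e'.trans (h.p_π hz)) heq

theorem r_injective {c : Q} {k k' : G₃.Arr} (e : D.p' c = G₃.s k) (e' : D.p' c = G₃.s k')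
    (heq : D.r (c, k) = D.r (c, k')) : k = k' := by
  obtain ⟨z, hz, rfl⟩ := h.surj c
  exact h.eq_of_r_eq hz ((h.p'_π hz).symm.trans e) ((h.p'_π hz).symm.trans e') heq

/-- This is proved from transitivity on classes, since the Morita property of `Q`, which would
otherwise give it, is still being established. -/
theorem dl_spec {q : Q × Q} (e : D.p' q.1 = D.p' q.2) :
    G₁.t (D.dl q) = D.p q.2 ∧ D.l (D.dl q, q.2) = q.1 := by
  rw [show D.dl q = (h.exists_l_eq e).choose from dif_pos (h.exists_l_eq e)]
  exact (h.exists_l_eq e).choose_spec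

theorem dr_spec {q : Q × Q} (e : D.p q.1 = D.p q.2) :
    D.p' q.1 = G₃.s (D.dr q) ∧ D.r (q.1, D.dr q) = q.2 := by
  rw [show D.dr q = (h.exists_r_eq e).choose from dif_pos (h.exists_r_eq e)]
  exact (h.exists_r_eq e).choose_spec

/-- On smooth local representatives, division of classes agrees with `leftQuotient` by freeness, and
the latter is continuous. -/
theorem continuousOn_dl : ContinuousOn D.dl {q : Q × Q | D.p' q.1 = D.p' q.2} := by
  refine continuousOn_of_locally_continuousOn fun q _ => ?_
  obtain ⟨O, σ, hO, hzO, hσ, hσS, hπσ⟩ := h.exists_lift_at q.1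
  obtain ⟨W, τ, hW, hzW, hτ, hτS, hπτ⟩ := h.exists_lift_at q.2
  refine ⟨O ×ˢ W, hO.prod hW, ⟨hzO, hzW⟩, ?_⟩
  have he : ∀ w ∈ {q : Q × Q | D.p' q.1 = D.p' q.2} ∩ O ×ˢ W,
      B.data.p' (σ w.1).2 = B.data.p' (τ w.2).2 := fun w hw => by
    rw [← h.p'_π (hσS _ hw.2.1), ← h.p'_π (hτS _ hw.2.2), hπσ _ hw.2.1, hπτ _ hw.2.2]
    exact hw.1
  refine ((continuousOn_leftQuotient A B).comp
    ((hσ.continuousOn.comp continuousOn_fst fun w hw => hw.2.1).prodMk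
      (hτ.continuousOn.comp continuousOn_snd fun w hw => hw.2.2))
    fun w hw => ⟨⟨hσS _ hw.2.1, hτS _ hw.2.2⟩, he w hw⟩).congr fun w hw => ?_
  obtain ⟨h1, h2⟩ := h.leftQuotient_spec (hτS _ hw.2.2) (hσS _ hw.2.1) (he w hw)
  rw [← h.p_π (hτS _ hw.2.2)] at h1
  rw [hπτ _ hw.2.2] at h1 h2
  rw [hπσ _ hw.2.1] at h2
  exact h.l_injective (h.dl_spec hw.1).1 h1 ((h.dl_spec hw.1).2.trans h2.symm)

theorem continuousOn_dr : ContinuousOn D.dr {q : Q × Q | D.p q.1 = D.p q.2} := by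
  refine continuousOn_of_locally_continuousOn fun q _ => ?_
  obtain ⟨O, σ, hO, hzO, hσ, hσS, hπσ⟩ := h.exists_lift_at q.1
  obtain ⟨W, τ, hW, hzW, hτ, hτS, hπτ⟩ := h.exists_lift_at q.2
  refine ⟨O ×ˢ W, hO.prod hW, ⟨hzO, hzW⟩, ?_⟩
  have he : ∀ w ∈ {q : Q × Q | D.p q.1 = D.p q.2} ∩ O ×ˢ W,
      A.data.p (σ w.1).1 = A.data.p (τ w.2).1 := fun w hw => by
    rw [← h.p_π (hσS _ hw.2.1), ← h.p_π (hτS _ hw.2.2), hπσ _ hw.2.1, hπτ _ hw.2.2]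
    exact hw.1
  refine ((continuousOn_rightQuotient A B).comp
    ((hσ.continuousOn.comp continuousOn_fst fun w hw => hw.2.1).prodMk
      (hτ.continuousOn.comp continuousOn_snd fun w hw => hw.2.2))
    fun w hw => ⟨⟨hσS _ hw.2.1, hτS _ hw.2.2⟩, he w hw⟩).congr fun w hw => ?_
  obtain ⟨h1, h2⟩ := h.rightQuotient_spec (hσS _ hw.2.1) (hτS _ hw.2.2) (he w hw)
  rw [← h.p'_π (hσS _ hw.2.1)] at h1
  rw [hπσ _ hw.2.1] at h1 h2
  rw [hπτ _ hw.2.2] at h2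
  exact h.r_injective (h.dr_spec hw.1).1 h1 ((h.dr_spec hw.1).2.trans h2.symm)

/-- The image of the action map is the closed set where the values of p' agree, and division
recovers the arrow continuously. -/
theorem proper_left : IsProperMap (fun z : {z : G₁.Arr × Q // G₁.t z.1 = D.p z.2} =>
    (D.lact z.1.1 z.1.2 z.2, z.1.2)) := by
  have hp' : Continuous D.p' := h.smooth_p'.continuous
  have hp'l := h.isBimodule.p'_lact
  have hr : Set.range (fun z : {z : G₁.Arr × Q // G₁.t z.1 = D.p z.2} =>
      (D.lact z.1.1 z.1.2 z.2, z.1.2)) = {q : Q × Q | D.p' q.1 = D.p' q.2} := by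
    ext ⟨d, c⟩
    constructor
    · rintro ⟨z, hz⟩
      rw [← hz]
      exact hp'l _ _ _
    · intro e
      obtain ⟨g, hg, hgc⟩ := h.exists_l_eq e
      exact ⟨⟨(g, c), hg⟩, Prod.ext ((BimoduleData.l_eq hg).symm.trans hgc) rfl⟩
  have hl := continuousOn_iff_continuous_domRestrict.1 h.contMDiffOn_l.continuousOn
  refine isProperMap_of_leftInverse (j := Subtype.val) (ψ := fun q => (D.dl q, q.2)) ?_
    IsEmbedding.subtypeVal ?_ (fun z => ?_) ?_
  · exact (hl.congr fun z => BimoduleData.l_eq z.2).prodMk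
      (continuous_snd.comp continuous_subtype_val)
  · rw [hr]
    exact h.continuousOn_dl.prodMk continuousOn_snd
  · have hs := h.dl_spec (q := (D.lact z.1.1 z.1.2 z.2, z.1.2)) (hp'l _ _ _)
    exact Prod.ext (h.l_injective hs.1 z.2 (hs.2.trans (BimoduleData.l_eq z.2).symm)) rfl
  · rw [hr]
    exact isClosed_eq (by fun_prop) (by fun_prop)

theorem proper_right : IsProperMap (fun z : {z : Q × G₃.Arr // D.p' z.1 = G₃.s z.2} =>
    (z.1.1, D.ract z.1.1 z.1.2 z.2)) := by
  have hp : Continuous D.p := h.smooth_p.continuous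
  have hpr := h.isBimodule.p_ract
  have hr : Set.range (fun z : {z : Q × G₃.Arr // D.p' z.1 = G₃.s z.2} =>
      (z.1.1, D.ract z.1.1 z.1.2 z.2)) = {q : Q × Q | D.p q.1 = D.p q.2} := by
    ext ⟨c, d⟩
    constructor
    · rintro ⟨z, hz⟩
      rw [← hz]
      exact (hpr _ _ _).symm
    · intro e
      obtain ⟨k, hk, hkc⟩ := h.exists_r_eq e
      exact ⟨⟨(c, k), hk⟩, Prod.ext rfl ((BimoduleData.r_eq hk).symm.trans hkc)⟩
  have hl := continuousOn_iff_continuous_domRestrict.1 h.contMDiffOn_r.continuousOn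
  refine isProperMap_of_leftInverse (j := Subtype.val) (ψ := fun q => (q.1, D.dr q)) ?_
    IsEmbedding.subtypeVal ?_ (fun z => ?_) ?_
  · exact (continuous_fst.comp continuous_subtype_val).prodMk
      (hl.congr fun z => BimoduleData.r_eq z.2)
  · rw [hr]
    exact continuousOn_fst.prodMk h.continuousOn_dr
  · have hs := h.dr_spec (q := (z.1.1, D.ract z.1.1 z.1.2 z.2)) (hpr _ _ _).symm
    exact Prod.ext rfl (h.r_injective hs.1 z.2 (hs.2.trans (BimoduleData.r_eq z.2).symm))
  · rw [hr]
    exact isClosed_eq (by fun_prop) (by fun_prop)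

/-- The composition of two Morita equivalences is a Morita equivalence. -/
theorem isMoritaEquivalence : IsMoritaEquivalence G₁ G₃ Q D where
  toIsBimodule := h.isBimodule
  free_left g c e heq := by
    refine h.l_injective e (G₁.t_unit _) ?_
    rw [BimoduleData.l_eq e, heq, h.isBimodule.l_unit rfl]
  free_right c k e heq := by
    refine h.r_injective e (G₃.s_unit _).symm ?_
    rw [BimoduleData.r_eq e, heq, h.isBimodule.r_unit rfl]
  transitive_left c d e := by
    obtain ⟨g, hg, hgc⟩ := h.exists_l_eq e.symm
    exact ⟨g, hg, (BimoduleData.l_eq hg).symm.trans hgc⟩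
  transitive_right c d e := by
    obtain ⟨k, hk, hkc⟩ := h.exists_r_eq e
    exact ⟨k, hk, (BimoduleData.r_eq hk).symm.trans hkc⟩
  proper_left := h.proper_left
  proper_right := h.proper_right

end IsComposition

end Composition

/-! ### The induced map between compositions -/

section Composition

variable {𝕜 : Type} [RCLike 𝕜] {G₁ G₂ G₃ : LieGroupoid.{u} 𝕜}

theorem isComposition_compData {A : LieMoritaEquivalence G₁ G₂} {B : LieMoritaEquivalence G₂ G₃}
    {S : SmoothStructure 𝕜 (CompSpace A B)}
    (hS : IsLocalQuotient (A.X.I.prod B.X.I) (Q := S.toMfd) (classMk A B) (fibSet A B)) :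
    IsComposition A B S.toMfd (compData A B) (classMk A B) where
  toIsLocalQuotient := hS
  π_eq_iff hz hw := classMk_eq_iff hz hw
  p_π hz := by rw [classMk, fibMk_eq hz]; rfl
  p'_π hz := by rw [classMk, fibMk_eq hz]; rfl
  l_π {g z} hz e := by
    rw [classMk, classMk, fibMk_eq hz, fibMk_eq (IsComposition.l_mem hz e)]
    refine (BimoduleData.l_eq (B := compData A B) e).trans
      (congrArg (compMk A B) (Subtype.ext (Prod.ext ?_ rfl)))
    exact (BimoduleData.l_eq e).symm
  r_π {z k} hz e := by
    rw [classMk, classMk, fibMk_eq hz, fibMk_eq (IsComposition.r_mem hz e)]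
    refine (BimoduleData.r_eq (B := compData A B) (x := compMk A B ⟨z, hz⟩) e).trans
      (congrArg (compMk A B) (Subtype.ext (Prod.ext rfl ?_)))
    exact (BimoduleData.r_eq e).symm

/-- A local section of the left moment map of `A` selects smooth local representatives. -/
theorem IsComposition.exists_normal_lift {A : LieMoritaEquivalence G₁ G₂}
    {B : LieMoritaEquivalence G₂ G₃} {Q : Mfd.{u} 𝕜} {D : BimoduleData G₁ G₃ Q}
    {π : A.X × B.X → Q} (h : IsComposition A B Q D π) {z : A.X × B.X} (hz : z ∈ fibSet A B)
    {V : Set G₁.Obj} {σ : G₁.Obj → A.X} (hV : IsOpen V) (hσ : ContMDiffOn G₁.Obj.I A.X.I ∞ σ V)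
    (hpσ : ∀ m ∈ V, A.data.p (σ m) = m) (hzV : A.data.p z.1 ∈ V)
    (hσz : σ (A.data.p z.1) = z.1) :
    ∃ (O : Set Q) (ν : Q → B.X), IsOpen O ∧ π z ∈ O ∧ ContMDiffOn Q.I B.X.I ∞ ν O ∧
      ν (π z) = z.2 ∧ ∀ c ∈ O, D.p c ∈ V ∧ (σ (D.p c), ν c) ∈ fibSet A B ∧
        π (σ (D.p c), ν c) = c := by
  obtain ⟨O, τ, hO, hzO, hτ, hτS, hπτ, hτz⟩ := h.exists_lift z hz
  have hp : ∀ c ∈ O, A.data.p (τ c).1 = D.p c := fun c hc => by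
    rw [← h.p_π (hτS c hc), hπτ c hc]
  have hmem : ∀ c ∈ O ∩ D.p ⁻¹' V, A.data.p (τ c).1 ∈ V := fun c hc => by
    rw [hp c hc.1]; exact hc.2
  -- Take any smooth local lift through `z` and normalise its first component to lie on σ.
  refine ⟨O ∩ D.p ⁻¹' V,
    fun c => B.data.l (A.data.dr (σ (A.data.p (τ c).1), (τ c).1), (τ c).2),
    hO.inter (hV.preimage h.smooth_p.continuous), ⟨hzO, ?_⟩, ?_, ?_, fun c hc => ⟨hc.2, ?_⟩⟩
  · rw [Set.mem_preimage, h.p_π hz]; exact hzV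
  · exact (contMDiffOn_normal hσ hpσ).comp (hτ.mono Set.inter_subset_left)
      fun c hc => ⟨hτS c hc.1, hmem c hc⟩
  · beta_reduce
    rw [hτz, hσz, A.isMorita.dr_self, B.isMorita.l_unit hz]
  · have h1 := hpσ _ (hmem c hc)
    have h2 := normal_mem (hτS c hc.1) h1
    rw [← hp c hc.1]
    refine ⟨h2, ?_⟩
    conv_rhs => rw [← hπτ c hc.1]
    exact ((h.π_eq_iff (hτS c hc.1) h2).2 ⟨h1.symm, rfl⟩).symm

namespace SubgroupoidMorita

variable {R₁ : LieSubgroupoid G₁} {R₂ : LieSubgroupoid G₂} {R₃ : LieSubgroupoid G₃}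
  (E : SubgroupoidMorita R₁ R₂) (E' : SubgroupoidMorita R₂ R₃)

theorem i_l {r : R₁.R.Arr} {y : E.Y.X} (e : R₁.R.t r = E.Y.data.p y) :
    E.i (E.Y.data.l (r, y)) = E.X.data.l (R₁.arr r, E.i y) := by
  have e' : G₁.t (R₁.arr r) = E.X.data.p (E.i y) := by rw [R₁.t_arr, E.isMorita.p_i, e]
  rw [BimoduleData.l_eq e, BimoduleData.l_eq e', E.i_lact r y e e']

theorem i_r {y : E.Y.X} {r : R₂.R.Arr} (e : E.Y.data.p' y = R₂.R.s r) :
    E.i (E.Y.data.r (y, r)) = E.X.data.r (E.i y, R₂.arr r) := by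
  have e' : E.X.data.p' (E.i y) = G₂.s (R₂.arr r) := by rw [R₂.s_arr, E.isMorita.p'_i, e]
  rw [BimoduleData.r_eq e, BimoduleData.r_eq e', E.i_ract y r e e']

/-- The arrow of `R₂` dividing in `Y` still divides after applying i, and freeness in `X` makes it
the only one. -/
theorem dr_i {y w : E.Y.X} (e : E.Y.data.p y = E.Y.data.p w) :
    E.X.data.dr (E.i y, E.i w) = R₂.arr (E.Y.data.dr (y, w)) := by
  have e' : E.X.data.p' (E.i y) = G₂.s (R₂.arr (E.Y.data.dr (y, w))) := by
    rw [R₂.s_arr, E.isMorita.p'_i, E.Y.isMorita.s_dr e]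
  have h := E.X.isMorita.dr_r e'
  rwa [← E.i_r (E.Y.isMorita.s_dr e), E.Y.isMorita.r_dr e] at h

variable {E E'} in
theorem i_mem {z : E.Y.X × E'.Y.X} (hz : z ∈ fibSet E.Y E'.Y) :
    (E.i z.1, E'.i z.2) ∈ fibSet E.X E'.X := by
  change E.X.data.p' (E.i z.1) = E'.X.data.p (E'.i z.2)
  rw [E.isMorita.p'_i, E'.isMorita.p_i, hz]

/-- Smooth local sections of the moment maps of `Y` and `X` that are compatible with `Y → X`. -/
theorem exists_compatible_sections (y : E.Y.X) :
    ∃ (V : Set R₁.R.Obj) (σ : R₁.R.Obj → E.Y.X) (W : Set G₁.Obj) (s : G₁.Obj → E.X.X)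
      (ρ : G₁.Obj → R₁.R.Obj), (IsOpen V ∧ E.Y.data.p y ∈ V ∧
      ContMDiffOn R₁.R.Obj.I E.Y.X.I ∞ σ V ∧ σ (E.Y.data.p y) = y ∧
      ∀ m ∈ V, E.Y.data.p (σ m) = m) ∧ (IsOpen W ∧ R₁.obj (E.Y.data.p y) ∈ W ∧
      ContMDiffOn G₁.Obj.I E.X.X.I ∞ s W ∧ ∀ m ∈ W, E.X.data.p (s m) = m) ∧
      ContMDiffOn G₁.Obj.I R₁.R.Obj.I ∞ ρ W ∧ Set.MapsTo ρ W V ∧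
      ∀ᶠ m in 𝓝 (E.Y.data.p y), ρ (R₁.obj m) = m ∧ s (R₁.obj m) = E.i (σ m) := by
  obtain ⟨V, σ, hV, hyV, hσ, hσy, hpσ⟩ := E.Y.isMorita.submersion_p.exists_section y
  obtain ⟨W, ρ, hW, hyW, hρ, hρo⟩ := R₁.injImmersion_obj.exists_leftInverse (E.Y.data.p y)
  obtain ⟨U, w, T, c, h, hyU⟩ := E.X.isMorita.submersion_p.exists_fibreCoord (E.i y)
  have hρy : ρ (R₁.obj (E.Y.data.p y)) = E.Y.data.p y := hρo.self_of_nhds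
  have hi : Mfd.Smooth E.i := E.isMorita.injImmersion.2.contMDiff
  have ho : Mfd.Smooth R₁.obj := R₁.injImmersion_obj.2.contMDiff
  have hW₁ : IsOpen (W ∩ ρ ⁻¹' V) := hρ.continuousOn.isOpen_inter_preimage hW hV
  have hk : ContMDiffOn G₁.Obj.I E.X.X.I ∞ (fun m => E.i (σ (ρ m))) (W ∩ ρ ⁻¹' V) :=
    hi.comp_contMDiffOn (hσ.comp (hρ.mono Set.inter_subset_left) fun m hm => hm.2)
  have hW₂ := hk.continuousOn.isOpen_inter_preimage hW₁ h.isOpen_U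
  set W₂ := W ∩ ρ ⁻¹' V ∩ (fun m => E.i (σ (ρ m))) ⁻¹' U
  have hj : ContMDiffOn G₁.Obj.I (G₁.Obj.I.prod 𝓘(𝕜, Mfd.FibreModel E.X.X G₁.Obj)) ∞
      (fun m => (m, w (E.i (σ (ρ m))))) W₂ :=
    contMDiffOn_id.prodMk (h.smooth_w.comp (hk.mono Set.inter_subset_left) fun m hm => hm.2)
  have hW₃ := hj.continuousOn.isOpen_inter_preimage hW₂ h.isOpen_V
  set W₃ := W₂ ∩ (fun m => (m, w (E.i (σ (ρ m))))) ⁻¹' T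
  have hk₀ : E.i (σ (ρ (R₁.obj (E.Y.data.p y)))) = E.i y := by rw [hρy, hσy]
  have hyW₃ : R₁.obj (E.Y.data.p y) ∈ W₃ := by
    refine ⟨⟨⟨hyW, ?_⟩, ?_⟩, ?_⟩
    · rw [Set.mem_preimage, hρy]; exact hyV
    · rw [Set.mem_preimage, hk₀]; exact hyU
    · rw [Set.mem_preimage, hk₀, ← E.isMorita.p_i]; exact h.mem_V _ hyU
  -- The point i (σ (ρ m)) need not lie over m, so it is moved to the fibre over m with its fibre
  -- coordinate kept. Over the image of `L₁` near the given point nothing moves, whence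
  -- compatibility.
  refine ⟨V, σ, W₃, fun m => c (m, w (E.i (σ (ρ m)))), ρ, ⟨hV, hyV, hσ, hσy, hpσ⟩,
    ⟨hW₃, hyW₃, h.smooth_c.comp (hj.mono Set.inter_subset_left) fun m hm => hm.2,
      fun m hm => h.f_c _ hm.2⟩, hρ.mono fun m hm => hm.1.1.1, fun m hm => hm.1.1.2, ?_⟩
  filter_upwards [hρo, hV.mem_nhds hyV,
    ho.continuous.continuousAt.preimage_mem_nhds (hW₃.mem_nhds hyW₃)] with m hm hmV hmW
  refine ⟨hm, ?_⟩
  have hmU : E.i (σ (ρ (R₁.obj m))) ∈ U := hmW.1.2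
  have h1 := h.c_eq _ hmU
  rw [hm] at h1 ⊢
  rwa [E.isMorita.p_i, hpσ m hmV] at h1

variable {E E'} {QX QY : Mfd.{u} 𝕜} {DX : BimoduleData G₁ G₃ QX}
  {DY : BimoduleData R₁.R R₃.R QY} {πX : E.X.X × E'.X.X → QX} {πY : E.Y.X × E'.Y.X → QY}
  (hX : IsComposition E.X E'.X QX DX πX) (hY : IsComposition E.Y E'.Y QY DY πY)
  {f : QY → QX} (hf : ∀ z ∈ fibSet E.Y E'.Y, f (πY z) = πX (E.i z.1, E'.i z.2))

include hX hY hf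

theorem smooth_comp : Mfd.Smooth f := by
  have hi : Mfd.Smooth E.i := E.isMorita.injImmersion.2.contMDiff
  have hi' : Mfd.Smooth E'.i := E'.isMorita.injImmersion.2.contMDiff
  exact hY.contMDiff_of_comp ((hX.smooth.comp
    ((hi.comp contMDiff_fst).prodMk (hi'.comp contMDiff_snd)).contMDiffOn fun z hz => i_mem hz).congr
    hf)

theorem p_comp (c : QY) : DX.p (f c) = R₁.obj (DY.p c) := by
  obtain ⟨z, hz, rfl⟩ := hY.surj c
  rw [hf z hz, hX.p_π (i_mem hz), hY.p_π hz, E.isMorita.p_i]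

theorem p'_comp (c : QY) : DX.p' (f c) = R₃.obj (DY.p' c) := by
  obtain ⟨z, hz, rfl⟩ := hY.surj c
  rw [hf z hz, hX.p'_π (i_mem hz), hY.p'_π hz, E'.isMorita.p'_i]

/-- The arrow relating the images in the first factor comes from `R₂`, by `dr_i`. So the relation
already holds in `Y'` after cancelling i', and the base points agree by injectivity of `L₁ → M₁`. -/
theorem injective_comp : Function.Injective f := by
  intro c d hcd
  obtain ⟨z, hz, rfl⟩ := hY.surj c
  obtain ⟨w, hw, rfl⟩ := hY.surj d
  rw [hf z hz, hf w hw, hX.π_eq_iff (i_mem hz) (i_mem hw)] at hcd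
  obtain ⟨h1, h2⟩ := hcd
  simp only [E.isMorita.p_i] at h1
  have h3 := R₁.injImmersion_obj.1 h1
  rw [hY.π_eq_iff hz hw]
  refine ⟨h3, E'.isMorita.injImmersion.1 ?_⟩
  simp only [E.dr_i h3.symm] at h2
  rw [E'.i_l ((E.Y.isMorita.t_dr h3.symm).trans hz), h2]

theorem comp_l {r : R₁.R.Arr} {c : QY} (e : R₁.R.t r = DY.p c) :
    f (DY.l (r, c)) = DX.l (R₁.arr r, f c) := by
  obtain ⟨z, hz, rfl⟩ := hY.surj c
  rw [hY.p_π hz] at e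
  have e' : G₁.t (R₁.arr r) = E.X.data.p (E.i z.1) := by rw [R₁.t_arr, E.isMorita.p_i, e]
  rw [hY.l_π hz e, hf z hz, hf _ (IsComposition.l_mem hz e), hX.l_π (i_mem hz) e', E.i_l e]

theorem comp_r {r : R₃.R.Arr} {c : QY} (e : DY.p' c = R₃.R.s r) :
    f (DY.r (c, r)) = DX.r (f c, R₃.arr r) := by
  obtain ⟨z, hz, rfl⟩ := hY.surj c
  rw [hY.p'_π hz] at e
  have e' : E'.X.data.p' (E'.i z.2) = G₃.s (R₃.arr r) := by
    rw [R₃.s_arr, E'.isMorita.p'_i, e]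
  rw [hY.r_π hz e, hf z hz, hf _ (IsComposition.r_mem hz e), hX.r_π (i_mem hz) e', E'.i_r e]

/-- Write c = [(σ, ν)] and f c = [(s, ν')] with compatible sections. Then ν' = i' ∘ ν along f, so
from f c one recovers the base point through ρ, the second component through τ, and finally c. -/
theorem injImmersion_comp : Mfd.InjImmersion f := by
  refine Mfd.injImmersion_of_leftInverse (smooth_comp hX hY hf) (injective_comp hX hY hf)
    fun c₀ => ?_
  obtain ⟨z, hz, rfl⟩ := hY.surj c₀
  obtain ⟨V, σ, W, s, ρ, ⟨hV, hzV, hσ, hσz, hpσ⟩, ⟨hW, hzW, hs, hps⟩, hρ, hρW, hev⟩ :=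
    E.exists_compatible_sections z.1
  have hsz : s (R₁.obj (E.Y.data.p z.1)) = E.i z.1 := by rw [hev.self_of_nhds.2, hσz]
  obtain ⟨O, ν, hO, hzO, hν, hνz, hνO⟩ := hY.exists_normal_lift hz hV hσ hpσ hzV hσz
  obtain ⟨O', ν', hO', hzO', hν', hνz', hνO'⟩ := hX.exists_normal_lift (i_mem hz) hW hs hps
    (by rw [E.isMorita.p_i]; exact hzW) (by rw [E.isMorita.p_i, hsz])
  rw [← hf z hz] at hzO' hνz'
  obtain ⟨U, τ, hU, hzU, hτ, hτi⟩ := E'.isMorita.injImmersion.exists_leftInverse z.2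
  -- Off the image of `f`, the recovered pair may fail to lie in the fibre product of `Y` and `Y'`;
  -- the retraction `R` corrects this and changes nothing on the image near the base point.
  obtain ⟨T, R, hT, hzT, hR, hRS, hRid⟩ := Mfd.isLocalSmoothRetract_fibreProduct_right
    E.Y.isMorita.submersion_p'.contMDiff E'.Y.isMorita.submersion_p z hz
  have hfc := (smooth_comp hX hY hf).continuous
  have hO₁ := hν'.continuousOn.isOpen_inter_preimage hO' hU
  set O₁ := O' ∩ ν' ⁻¹' U
  have hk : ContMDiffOn QX.I (E.Y.X.I.prod E'.Y.X.I) ∞ (fun c => (σ (ρ (DX.p c)), τ (ν' c))) O₁ :=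
    (hσ.comp (hρ.comp hX.smooth_p.contMDiffOn fun c hc => (hνO' c hc.1).1)
      fun c hc => hρW (hνO' c hc.1).1).prodMk
      (hτ.comp (hν'.mono Set.inter_subset_left) fun c hc => hc.2)
  have hO₂ := hk.continuousOn.isOpen_inter_preimage hO₁ hT
  set O₂ := O₁ ∩ (fun c => (σ (ρ (DX.p c)), τ (ν' c))) ⁻¹' T
  have hp₀ : DY.p (πY z) = E.Y.data.p z.1 := hY.p_π hz
  have hpf := p_comp hX hY hf
  have hk₀ : (σ (ρ (DX.p (f (πY z)))), τ (ν' (f (πY z)))) = z := by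
    rw [hpf, hp₀, hev.self_of_nhds.1, hσz, hνz', hτi.self_of_nhds]
  have hzO₂ : f (πY z) ∈ O₂ := by
    refine ⟨⟨hzO', ?_⟩, ?_⟩
    · rw [Set.mem_preimage, hνz']; exact hzU
    · rw [Set.mem_preimage, hk₀]; exact hzT
  refine ⟨O₂, fun c => πY (R (σ (ρ (DX.p c)), τ (ν' c))), hO₂, hzO₂,
    hY.smooth.comp (hR.comp (hk.mono Set.inter_subset_left) fun c hc => hc.2)
      fun c hc => hRS hc.2, ?_⟩
  have hνt : Filter.Tendsto ν (𝓝 (πY z)) (𝓝 z.2) := by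
    have := (hν.continuousOn.continuousAt (hO.mem_nhds hzO)).tendsto
    rwa [hνz] at this
  have hpt : Filter.Tendsto DY.p (𝓝 (πY z)) (𝓝 (E.Y.data.p z.1)) :=
    hp₀ ▸ hY.smooth_p.continuous.continuousAt.tendsto
  filter_upwards [hO.mem_nhds hzO, hfc.continuousAt.preimage_mem_nhds (hO₂.mem_nhds hzO₂),
    hpt.eventually hev, hνt.eventually hτi] with c hcO hcO₂ ⟨hc1, hc2⟩ hc3
  obtain ⟨-, hc4, hc5⟩ := hνO c hcO
  obtain ⟨-, hc6, hc7⟩ := hνO' (f c) hcO₂.1.1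
  -- Both are second components of representatives of f c with the same first component s (p (f c)),
  -- so they coincide.
  have hc8 : ν' (f c) = E'.i (ν c) := by
    have h1 := hf _ hc4
    rw [hc5] at h1
    have h2 := i_mem hc4
    simp only at h1 h2
    rw [← hc2, ← hpf] at h1 h2
    exact hX.π_eq_right hc6 h2 (hc7.trans h1)
  have hc9 : (σ (ρ (DX.p (f c))), τ (ν' (f c))) = (σ (DY.p c), ν c) := by
    rw [hpf, hc1, hc8, hc3]
  have hc10 := hcO₂.2
  rw [Set.mem_preimage, hc9] at hc10
  rw [hc9, hRid _ ⟨hc10, hc4⟩, hc5]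

theorem isSubgroupoidMorita_comp : IsSubgroupoidMorita R₁ R₃
    ⟨QX, DX, hX.isMoritaEquivalence⟩ ⟨QY, DY, hY.isMoritaEquivalence⟩ f where
  injImmersion := injImmersion_comp hX hY hf
  p_i := p_comp hX hY hf
  p'_i := p'_comp hX hY hf
  i_act r c r' e e' := by
    have e1 : DY.p' (DY.lact r c e) = R₃.R.s r' :=
      (hY.isMoritaEquivalence.p'_lact r c e).trans e'
    have e2 : G₁.t (R₁.arr r) = DX.p (f c) := by rw [R₁.t_arr, p_comp hX hY hf, e]
    have h1 : f (DY.lact r c e) = DX.lact (R₁.arr r) (f c) e2 := by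
      rw [← BimoduleData.l_eq e, ← BimoduleData.l_eq e2, comp_l hX hY hf e]
    have h2 := comp_r hX hY hf e1
    rw [BimoduleData.r_eq e1, h1] at h2
    exact h2.trans (BimoduleData.r_eq _)

end SubgroupoidMorita

end Composition

theorem mainTheorem8 {𝕜 : Type} [RCLike 𝕜] {G₁ G₂ G₃ : LieGroupoid.{u} 𝕜}
    (R₁ : LieSubgroupoid G₁) (R₂ : LieSubgroupoid G₂) (R₃ : LieSubgroupoid G₃)
    (E : SubgroupoidMorita R₁ R₂) (E' : SubgroupoidMorita R₂ R₃) :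
    ∃ (SX : SmoothStructure 𝕜 (CompSpace E.X E'.X)) (SY : SmoothStructure 𝕜 (CompSpace E.Y E'.Y))
      (hX : IsMoritaEquivalence G₁ G₃ SX.toMfd (compData E.X E'.X))
      (hY : IsMoritaEquivalence R₁.R R₃.R SY.toMfd (compData E.Y E'.Y)),
      IsQuotientStructure E.X E'.X SX ∧ IsQuotientStructure E.Y E'.Y SY ∧
      IsSubgroupoidMorita R₁ R₃ ⟨SX.toMfd, compData E.X E'.X, hX⟩
        ⟨SY.toMfd, compData E.Y E'.Y, hY⟩ (compMap E E') := by
  obtain ⟨SX, hSX⟩ := exists_compSpace_structure (A := E.X) (B := E'.X)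
  obtain ⟨SY, hSY⟩ := exists_compSpace_structure (A := E.Y) (B := E'.Y)
  have hX := isComposition_compData hSX
  have hY := isComposition_compData hSY
  refine ⟨SX, SY, hX.isMoritaEquivalence, hY.isMoritaEquivalence,
    isQuotientStructure_of_isLocalQuotient hSX, isQuotientStructure_of_isLocalQuotient hSY,
    SubgroupoidMorita.isSubgroupoidMorita_comp hX hY fun z hz => ?_⟩
  rw [classMk, classMk, fibMk_eq hz, fibMk_eq (SubgroupoidMorita.i_mem hz)]
  rfl
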